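/- Let $d\ge 1$, let $(\mathcal F_k)_{k\ge 0}$ be a filtration on a probability space, and consider the saturated model $$y_{k+1}=S_k(\phi_k^{\mathrm T}\theta+\varepsilon_{k+1}),\qquad S_k(x)=L_k\ (x<l_k),\quad S_k(x)=x\ (l_k\le x\le u_k),\quad S_k(x)=U_k\ (x>u_k),\qquad k\ge 0,$$ where $y_{k+1}$ is $\mathcal F_{k+1}$-measurable. Assume the following. 1. $\phi_k\in\mathbb R^d$ is $\mathcal F_k$-measurable, $\sup_k\|\phi_k\|<\infty$ a.s., and $\theta$ is an interior point of a known convex compact set $D\subseteq\mathbb R^d$. The $\mathcal F_k$-measurable random variables $C_k$ satisfy $\sup_{x\in D}|\phi_k^{\mathrm T}x|\le C_k$ a.s. 2. $l_k,u_k,L_k,U_k,b_k$ are $\mathcal F_k$-measurable; a.s., for all $k$, $L_k\le l_k\le u_k\le U_k$, the four are not all equal, and $\max\{l_k,-u_k\}\le M$ for a constant $M>0$; and $0<\inf_k b_k\le\sup_k b_k\le 1$ a.s. 3. Given $\mathcal F_k$, the noise $\varepsilon_{k+1}$ has a continuous conditional density $f_{k+1}$ and conditional distribution function $F_{k+1}$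 with $F_{k+1}(0)=\tfrac12$, and there is a constant $C\ge\sup_k C_k$ with $$0<\inf_{|x|\le\max\{2C,C+M\},\,k\ge0}f_{k+1}(x)\le\sup_{|x|\le\max\{2C,C+M\},\,k\ge0}f_{k+1}(x)<\infty\quad\text{a.s.}$$ For a positive definite matrix $Q$ let $\|x\|_Q^2=x^{\mathrm T}Qx$ and $\Pi_Q(x)=\arg\min_{y\in D}\|x-y\|_Q$, and for $t\in\mathbb R^d$ put $$v_{k+1}(t)=\operatorname{sgn}[y_{k+1}-S_k(\phi_k^{\mathrm T}t)]+F_{k+1}(u_k-\phi_k^{\mathrm T}t)\,\mathrm I_{[S_k(\phi_k^{\mathrm T}t)=U_k]}-[1-F_{k+1}(l_k-\phi_k^{\mathrm T}t)]\,\mathrm I_{[S_k(\phi_k^{\mathrm T}t)=L_k]}.$$ The two-step weighted least absolute deviation (TSWLAD) algorithm computes, for $k\ge 0$, $$\bar\theta_{k+1}=\Pi_{\bar P_{k+1}^{-1}}\{\bar\theta_k+\bar a_kb_k\bar P_k\phi_kv_{k+1}(\bar\theta_k)\},\quad \bar P_{k+1}=\bar P_k-\bar a_k\bar\beta_kb_k^2\bar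 P_k\phi_k\phi_k^{\mathrm T}\bar P_k,\quad \bar a_k=\frac1{\bar\mu_k+\bar\beta_kb_k^2\phi_k^{\mathrm T}\bar P_k\phi_k},$$ $$\theta_{k+1}=\Pi_{P_{k+1}^{-1}}\{\theta_k+a_kb_kP_k\phi_kv_{k+1}(\theta_k)\},\quad P_{k+1}=P_k-a_k\beta_kb_k^2P_k\phi_k\phi_k^{\mathrm T}P_k,\quad a_k=\frac1{\mu_k+\beta_kb_k^2\phi_k^{\mathrm T}P_k\phi_k},$$ where $\bar\beta_k=\inf\{f_{k+1}(x):|x|\le\max\{2C_k,C_k+l_k,C_k-u_k\}\}$ and, with $d_k=\phi_k^{\mathrm T}(\bar\theta_k-\theta_k)$, if $d_k\ne0$ then $$\beta_k=\begin{cases}\big[F_{k+1}(l_k-\phi_k^{\mathrm T}\theta_k)-F_{k+1}(l_k-\phi_k^{\mathrm T}\bar\theta_k)\big]/d_k,& S_k(\phi_k^{\mathrm T}\theta_k)=L_k,\\ \big[1-2F_{k+1}(\phi_k^{\mathrm T}\theta_k-\phi_k^{\mathrm T}\bar\theta_k)\big]/d_k,& L_k<S_k(\phi_k^{\mathrm T}\theta_k)<U_k,\\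 \big[F_{k+1}(u_k-\phi_k^{\mathrm T}\theta_k)-F_{k+1}(u_k-\phi_k^{\mathrm T}\bar\theta_k)\big]/d_k,& S_k(\phi_k^{\mathrm T}\theta_k)=U_k,\end{cases}$$ while if $d_k=0$ then $\beta_k$ is, in the three cases respectively, $f_{k+1}(l_k-\phi_k^{\mathrm T}\theta_k)$, $2f_{k+1}(0)$, $f_{k+1}(u_k-\phi_k^{\mathrm T}\theta_k)$. Here $\bar\mu_k,\mu_k$ are any positive $\mathcal F_k$-measurable sequences that are a.s. bounded and bounded away from $0$, and the initial values $\bar\theta_0,\theta_0\in D$ and $\bar P_0,P_0$ positive definite are arbitrary ($\mathcal F_0$-measurable). Let $\lambda_{\min}(k)$ be the smallest eigenvalue of $P_0^{-1}+\sum_{i=0}^k\phi_i\phi_i^{\mathrm T}$. If $k=O(\lambda_{\min}(k))$ a.s., then $$\|\theta-\theta_{k+1}\|^2=O\left(\frac{\log\log k}{k}\right)\quad\text{a.s.}\quad(k\to\infty).$$ -/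

import Mathlib

open MeasureTheory ProbabilityTheory Filter Asymptotics Matrix

namespace TSWLAD

noncomputable section

/-- The saturation function with observable range `[l, u]` and the outer values `L` and `U`. -/
def sat (L l u U x : ℝ) : ℝ :=
  if x < l then L else if x ≤ u then x else U

/-- The Euclidean norm on `ℝ ^ d`. -/
def euclNorm {d : ℕ} (x : Fin d → ℝ) : ℝ := ‖WithLp.toLp 2 x‖

/-- The norm `‖x‖_Q`, with `‖x‖_Q ^ 2 = xᵀ Q x`, of a positive definite matrix `Q`. -/
def normQ {d : ℕ} (Q : Matrix (Fin d) (Fin d) ℝ) (x : Fin d → ℝ) : ℝ :=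
  Real.sqrt (x ⬝ᵥ (Q *ᵥ x))

/-- `p` is a minimizer over `y ∈ D` of `‖x - y‖_Q`. -/
def IsProj {d : ℕ} (D : Set (Fin d → ℝ)) (Q : Matrix (Fin d) (Fin d) ℝ)
    (x p : Fin d → ℝ) : Prop :=
  p ∈ D ∧ ∀ y ∈ D, normQ Q (x - p) ≤ normQ Q (x - y)

/-- The projection operator `Π_Q(x) = argmin_{y ∈ D} ‖x - y‖_Q`. The minimizer exists and is
unique when `D` is nonempty, convex and compact and `Q` is positive definite. -/
def proj {d : ℕ} (D : Set (Fin d → ℝ)) (Q : Matrix (Fin d) (Fin d) ℝ)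
    (x : Fin d → ℝ) : Fin d → ℝ :=
  Classical.epsilon (IsProj D Q x)

/-- The smallest eigenvalue of a real symmetric matrix. -/
def lambdaMin {d : ℕ} (A : Matrix (Fin d) (Fin d) ℝ) : ℝ := sInf (spectrum ℝ A)

/-- The data of the saturated stochastic model and of the algorithm. The values at index `k` of
all sequences other than the noise are the quantities with index `k`; the function `f k ω` is the
conditional density of the noise `ε (k + 1)` given the information up to time `k`. -/
structure Setup (Ω : Type*) (d : ℕ) where
  /-- the true parameter -/
  θ : Fin d → ℝ
  /-- the known set that contains the parameter -/
  D : Set (Fin d → ℝ)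
  /-- the regressors -/
  φ : ℕ → Ω → Fin d → ℝ
  /-- the noise -/
  ε : ℕ → Ω → ℝ
  /-- the lower end of the observable range -/
  l : ℕ → Ω → ℝ
  /-- the upper end of the observable range -/
  u : ℕ → Ω → ℝ
  /-- the value observed below the range -/
  L : ℕ → Ω → ℝ
  /-- the value observed above the range -/
  U : ℕ → Ω → ℝ
  /-- the weights -/
  b : ℕ → Ω → ℝ
  /-- the conditional densities of the noise -/
  f : ℕ → Ω → ℝ → ℝ
  /-- the bounds for `|φ_kᵀ x|`, `x ∈ D` -/
  C : ℕ → Ω → ℝ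
  /-- the step-size factors of the first step -/
  μbar : ℕ → Ω → ℝ
  /-- the step-size factors of the second step -/
  μ : ℕ → Ω → ℝ
  /-- the initial estimate of the first step -/
  θbar0 : Ω → Fin d → ℝ
  /-- the initial matrix of the first step -/
  Pbar0 : Ω → Matrix (Fin d) (Fin d) ℝ
  /-- the initial estimate of the second step -/
  θ0 : Ω → Fin d → ℝ
  /-- the initial matrix of the second step -/
  P0 : Ω → Matrix (Fin d) (Fin d) ℝ

namespace Setup

variable {Ω : Type*} {d : ℕ} (S : Setup Ω d)

/-- The saturation function `S_k`. -/
def satAt (k : ℕ) (ω : Ω) (x : ℝ) : ℝ := sat (S.L k ω) (S.l k ω) (S.u k ω) (S.U k ω) x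

/-- The observation `y_{k+1} = S_k(φ_kᵀ θ + ε_{k+1})`. -/
def obs (k : ℕ) (ω : Ω) : ℝ := S.satAt k ω (S.φ k ω ⬝ᵥ S.θ + S.ε (k + 1) ω)

/-- The conditional distribution function `F_{k+1}` with density `f_{k+1}`. -/
def cdf (k : ℕ) (ω : Ω) (x : ℝ) : ℝ := ∫ t in Set.Iic x, S.f k ω t

/-- The innovation computed at time `k + 1` with the current estimate `t`: it is `v̄_{k+1}` for
`t = θ̄_k` and `v_{k+1}` for `t = θ_k`. -/
def innov (k : ℕ) (ω : Ω) (t : Fin d → ℝ) : ℝ :=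
  Real.sign (S.obs k ω - S.satAt k ω (S.φ k ω ⬝ᵥ t))
    + (if S.satAt k ω (S.φ k ω ⬝ᵥ t) = S.U k ω
        then S.cdf k ω (S.u k ω - S.φ k ω ⬝ᵥ t) else 0)
    - (if S.satAt k ω (S.φ k ω ⬝ᵥ t) = S.L k ω
        then 1 - S.cdf k ω (S.l k ω - S.φ k ω ⬝ᵥ t) else 0)

/-- The adaptation gain `β̄_k` of the first step. -/
def betaBar (k : ℕ) (ω : Ω) : ℝ :=
  sInf (S.f k ω '' {x : ℝ |
    |x| ≤ max (2 * S.C k ω) (max (S.C k ω + S.l k ω) (S.C k ω - S.u k ω))})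

/-- The adaptation gain `β_k` of the second step, computed from the estimates `tb = θ̄_k` and
`t = θ_k`. -/
def beta (k : ℕ) (ω : Ω) (tb t : Fin d → ℝ) : ℝ :=
  let z := S.φ k ω ⬝ᵥ t
  let zb := S.φ k ω ⬝ᵥ tb
  let δ := S.φ k ω ⬝ᵥ (tb - t)
  if S.satAt k ω z = S.L k ω then
    if δ ≠ 0 then (S.cdf k ω (S.l k ω - z) - S.cdf k ω (S.l k ω - zb)) / δ
    else S.f k ω (S.l k ω - z)
  else if S.satAt k ω z = S.U k ω then
    if δ ≠ 0 then (S.cdf k ω (S.u k ω - z) - S.cdf k ω (S.u k ω - zb)) / δ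
    else S.f k ω (S.u k ω - z)
  else
    if δ ≠ 0 then (1 - 2 * S.cdf k ω (z - zb)) / δ
    else 2 * S.f k ω 0

/-- The gain `1 / (m + β b_k ^ 2 φ_kᵀ P φ_k)`. -/
def gain (k : ℕ) (ω : Ω) (m β : ℝ) (P : Matrix (Fin d) (Fin d) ℝ) : ℝ :=
  1 / (m + β * S.b k ω ^ 2 * (S.φ k ω ⬝ᵥ (P *ᵥ S.φ k ω)))

/-- The updated matrix `P - a β b_k ^ 2 P φ_k φ_kᵀ P`, where `a` is the gain. -/
def nextP (k : ℕ) (ω : Ω) (m β : ℝ) (P : Matrix (Fin d) (Fin d) ℝ) :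
    Matrix (Fin d) (Fin d) ℝ :=
  P - (S.gain k ω m β P * β * S.b k ω ^ 2) • (P * vecMulVec (S.φ k ω) (S.φ k ω) * P)

/-- The updated estimate `Π_{P'⁻¹}(t + a b_k P φ_k v)`, where `P'` is the updated matrix, `a` the
gain and `v` the innovation at `t`. -/
def nextθ (k : ℕ) (ω : Ω) (m β : ℝ) (P : Matrix (Fin d) (Fin d) ℝ) (t : Fin d → ℝ) :
    Fin d → ℝ :=
  proj S.D (S.nextP k ω m β P)⁻¹
    (t + (S.gain k ω m β P * S.b k ω * S.innov k ω t) • (P *ᵥ S.φ k ω))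

/-- The first step of the algorithm: the pairs `(θ̄_k, P̄_k)`. -/
def step1 (ω : Ω) : ℕ → (Fin d → ℝ) × Matrix (Fin d) (Fin d) ℝ
  | 0 => (S.θbar0 ω, S.Pbar0 ω)
  | k + 1 =>
    (S.nextθ k ω (S.μbar k ω) (S.betaBar k ω) (step1 ω k).2 (step1 ω k).1,
      S.nextP k ω (S.μbar k ω) (S.betaBar k ω) (step1 ω k).2)

/-- The preliminary estimate `θ̄_k`. -/
def thetaBar (k : ℕ) (ω : Ω) : Fin d → ℝ := (S.step1 ω k).1

/-- The second step of the algorithm: the pairs `(θ_k, P_k)`. -/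
def step2 (ω : Ω) : ℕ → (Fin d → ℝ) × Matrix (Fin d) (Fin d) ℝ
  | 0 => (S.θ0 ω, S.P0 ω)
  | k + 1 =>
    (S.nextθ k ω (S.μ k ω) (S.beta k ω (S.thetaBar k ω) (step2 ω k).1)
        (step2 ω k).2 (step2 ω k).1,
      S.nextP k ω (S.μ k ω) (S.beta k ω (S.thetaBar k ω) (step2 ω k).1) (step2 ω k).2)

/-- The estimate `θ_k` produced by the TSWLAD algorithm. -/
def estimate (k : ℕ) (ω : Ω) : Fin d → ℝ := (S.step2 ω k).1

/-- The information matrix `P_0⁻¹ + ∑_{i=0}^k φ_i φ_iᵀ`. -/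
def info (k : ℕ) (ω : Ω) : Matrix (Fin d) (Fin d) ℝ :=
  (S.P0 ω)⁻¹ + ∑ i ∈ Finset.range (k + 1), vecMulVec (S.φ i ω) (S.φ i ω)

variable [mΩ : MeasurableSpace Ω]

/-- The assumption on the regressors and the parameter set. -/
structure RegressorAssumption (P : Measure Ω) (ℱ : Filtration ℕ mΩ) : Prop where
  meas_φ : ∀ k, Measurable[ℱ k] (S.φ k)
  bdd_φ : ∀ᵐ ω ∂P, ∃ K : ℝ, ∀ k, euclNorm (S.φ k ω) ≤ K
  convex_D : Convex ℝ S.D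
  compact_D : IsCompact S.D
  θ_mem : S.θ ∈ interior S.D

/-- The assumption on the thresholds and the weights. -/
structure ThresholdAssumption (P : Measure Ω) (ℱ : Filtration ℕ mΩ) (M : ℝ) : Prop where
  meas_l : ∀ k, Measurable[ℱ k] (S.l k)
  meas_u : ∀ k, Measurable[ℱ k] (S.u k)
  meas_L : ∀ k, Measurable[ℱ k] (S.L k)
  meas_U : ∀ k, Measurable[ℱ k] (S.U k)
  ordered : ∀ᵐ ω ∂P, ∀ k, S.L k ω ≤ S.l k ω ∧ S.l k ω ≤ S.u k ω ∧ S.u k ω ≤ S.U k ω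
  M_pos : 0 < M
  bounded : ∀ᵐ ω ∂P, ∀ k, max (S.l k ω) (-S.u k ω) ≤ M
  nondegenerate : ∀ᵐ ω ∂P, ∀ k,
    ¬ (S.L k ω = S.l k ω ∧ S.l k ω = S.u k ω ∧ S.u k ω = S.U k ω)
  meas_b : ∀ k, Measurable[ℱ k] (S.b k)
  bounds_b : ∀ᵐ ω ∂P, (∃ c : ℝ, 0 < c ∧ ∀ k, c ≤ S.b k ω) ∧ ∀ k, S.b k ω ≤ 1

/-- The assumption on the noise: `f k ω` is a continuous probability density with median `0`, it is
the conditional density of `ε_{k+1}` given `ℱ_k`, and the densities are bounded and bounded away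
from zero, uniformly in `k`, on the interval `|x| ≤ max {2 Cmax, Cmax + M}`. The random bounds
`C_k` of the regression terms, which the algorithm uses, are at most `Cmax`. -/
structure NoiseAssumption (P : Measure Ω) (ℱ : Filtration ℕ mΩ) (M Cmax : ℝ) : Prop where
  meas_ε : ∀ k, Measurable (S.ε (k + 1))
  meas_y : ∀ k, Measurable[ℱ (k + 1)] (S.obs k)
  meas_f : ∀ k x, Measurable[ℱ k] (fun ω => S.f k ω x)
  continuous_f : ∀ k ω, Continuous (S.f k ω)
  nonneg_f : ∀ k ω x, 0 ≤ S.f k ω x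
  integrable_f : ∀ k ω, Integrable (S.f k ω)
  integral_f : ∀ k ω, ∫ x, S.f k ω x = 1
  cond_law : ∀ k x, (fun ω => S.cdf k ω x) =ᵐ[P] P⟦{ω | S.ε (k + 1) ω ≤ x} | ℱ k⟧
  median : ∀ k ω, S.cdf k ω 0 = 1 / 2
  meas_C : ∀ k, Measurable[ℱ k] (S.C k)
  le_C : ∀ᵐ ω ∂P, ∀ k, ∀ x ∈ S.D, |S.φ k ω ⬝ᵥ x| ≤ S.C k ω
  C_le : ∀ᵐ ω ∂P, ∀ k, S.C k ω ≤ Cmax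
  bounds_f : ∀ᵐ ω ∂P, ∃ c K : ℝ, 0 < c ∧
    ∀ k, ∀ x : ℝ, |x| ≤ max (2 * Cmax) (Cmax + M) → c ≤ S.f k ω x ∧ S.f k ω x ≤ K

/-- The admissible choices of the parameters and the initial values of the algorithm. -/
structure Admissible (P : Measure Ω) (ℱ : Filtration ℕ mΩ) : Prop where
  meas_μbar : ∀ k, Measurable[ℱ k] (S.μbar k)
  μbar_pos : ∀ k ω, 0 < S.μbar k ω
  bounds_μbar : ∀ᵐ ω ∂P, ∃ c K : ℝ, 0 < c ∧ ∀ k, c ≤ S.μbar k ω ∧ S.μbar k ω ≤ K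
  meas_μ : ∀ k, Measurable[ℱ k] (S.μ k)
  μ_pos : ∀ k ω, 0 < S.μ k ω
  bounds_μ : ∀ᵐ ω ∂P, ∃ c K : ℝ, 0 < c ∧ ∀ k, c ≤ S.μ k ω ∧ S.μ k ω ≤ K
  meas_θbar0 : Measurable[ℱ 0] S.θbar0
  θbar0_mem : ∀ ω, S.θbar0 ω ∈ S.D
  meas_Pbar0 : ∀ i j, Measurable[ℱ 0] (fun ω => S.Pbar0 ω i j)
  Pbar0_posDef : ∀ ω, (S.Pbar0 ω).PosDef
  meas_θ0 : Measurable[ℱ 0] S.θ0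
  θ0_mem : ∀ ω, S.θ0 ω ∈ S.D
  meas_P0 : ∀ i j, Measurable[ℱ 0] (fun ω => S.P0 ω i j)
  P0_posDef : ∀ ω, (S.P0 ω).PosDef

end Setup

end

end TSWLAD

/-! Evaluated at an `ℱ k`-measurable estimate, the innovation is almost surely a centred threshold
indicator of `ε (k + 1)` (`innov_eq`). It splits into a drift, which vanishes when the predictor is
exact and is bounded above and below by multiples of the prediction error, and a bounded noise
orthogonal to the past (`isNoise_noise`).

Let `V_k = (θ - θ_k)ᵀ P_k⁻¹ (θ - θ_k)` and `x_k = φ_kᵀ (θ - θ_k)`. The projection in the `P_{k+1}⁻¹`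
norm brings the iterate no farther from `θ`, and `P_{k+1}⁻¹` exceeds `P_k⁻¹` by a rank-one term.
That growth costs `β x_k²` once while the drift gains it twice, so `V_{k+1} ≤ V_k - c x_k² + (noise
weighted by x_k) + O(log log k / k)` (`lyapunov_step`). Linear growth of the smallest eigenvalue
makes `V_k` comparable with `k ‖θ - θ_k‖²`.

Summing this inequality from the start would only bound `V_k` by a multiple of `log k * log log k`.
Instead, times `2^j` and `2^(j+J)` are compared. Over such a block the regressors are exciting, so
`V (2^j)` is at most a constant times `∑ x_i² + log j`. Hence the descent contracts `V` by a fixed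
factor up to `O(log j)`, and `V (2^j) = O(log j)`, which is the claimed rate
(`isBigO_log_log_div_of_lyapunov`). That the noise contributes only `O(log j)`, beyond a part
absorbed by the descent, follows from an exponential supermartingale, its maximal inequality at
level `2 log j`, and Borel–Cantelli over the blocks (`ae_eventually_sum_Ico_lt`).

The argument is run twice, through `ae_isBigO_of_recursion`. In the first step `β̄_k` bounds the
slope of the drift from below, and no error term appears. In the second step `β_k` is the secant
slope of the drift with `θ̄_k` in place of `θ`; the resulting error is `O(|φ_kᵀ (θ - θ̄_k)|)`, and
its square is `O(log log k / k)` by the first step. -/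

namespace TSWLAD

/-! ### Dyadic recursions and iterated logarithms -/

/-- A nonnegative-rate contraction along a stride, perturbed by a logarithm, grows at most
logarithmically. -/
theorem exists_le_mul_log_of_stride (u : ℕ → ℝ) {J : ℕ} (hJ : 0 < J) {ρ C : ℝ} (hρ0 : 0 ≤ ρ)
    (hρ1 : ρ < 1) {j₀ : ℕ} (h : ∀ j ≥ j₀, u (j + J) ≤ ρ * u j + C * Real.log j) :
    ∃ B, 0 ≤ B ∧ ∀ j ≥ max j₀ 3, u j ≤ B * Real.log j := by
  set j₁ := max j₀ 3
  have hlog : ∀ j ≥ j₁, 1 ≤ Real.log j := by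
    intro j hj
    rw [Real.le_log_iff_exp_le (by have : 3 ≤ j := le_trans (le_max_right _ _) hj
                                   positivity)]
    have h3 : (3 : ℝ) ≤ j := by exact_mod_cast le_trans (le_max_right _ _) hj
    linarith [Real.exp_one_lt_d9]
  -- The first summand makes `ρ B + |C| ≤ B`, which closes the induction; the second covers the `J`
  -- starting values.
  set B := |C| / (1 - ρ) + ∑ i ∈ Finset.range J, |u (j₁ + i)|
  have h1ρ : 0 < 1 - ρ := by linarith
  have hs : 0 ≤ ∑ i ∈ Finset.range J, |u (j₁ + i)| := Finset.sum_nonneg fun _ _ => abs_nonneg _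
  have hB : 0 ≤ B := by positivity
  refine ⟨B, hB, fun j => ?_⟩
  induction j using Nat.strong_induction_on with
  | _ j ih =>
    intro hj
    by_cases hjJ : j < j₁ + J
    · have h1 : |u j| ≤ ∑ i ∈ Finset.range J, |u (j₁ + i)| := by
        have := Finset.single_le_sum (f := fun i => |u (j₁ + i)|) (s := Finset.range J)
          (fun _ _ => abs_nonneg _) (Finset.mem_range.2 (show j - j₁ < J by omega))
        simpa [Nat.add_sub_cancel' hj] using this
      have h2 : 0 ≤ |C| / (1 - ρ) := by positivity
      have h3 : u j ≤ B := by linarith [le_abs_self (u j)]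
      nlinarith [hlog j hj]
    · obtain ⟨i, rfl⟩ : ∃ i, j = i + J := ⟨j - J, by omega⟩
      have hi : i ≥ j₁ := by omega
      have h1 := ih i (by omega) hi
      have h2 := h i (le_trans (le_max_left _ _) hi)
      have h3 : |C| ≤ (1 - ρ) * B := by
        have : (1 - ρ) * (|C| / (1 - ρ)) = |C| := by field_simp
        have h4 := mul_nonneg h1ρ.le hs
        rw [show (1 - ρ) * B = (1 - ρ) * (|C| / (1 - ρ)) +
          (1 - ρ) * ∑ i ∈ Finset.range J, |u (j₁ + i)| from mul_add _ _ _]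
        linarith
      have hl := hlog i hi
      have h5 : Real.log i ≤ Real.log ((i + J : ℕ) : ℝ) := by
        apply Real.log_le_log
        · have : 3 ≤ i := le_trans (le_max_right _ _) hi
          positivity
        · push_cast; linarith [Nat.cast_nonneg (α := ℝ) J]
      have h6 : u (i + J) ≤ B * Real.log i := by
        nlinarith [mul_le_mul_of_nonneg_left h1 hρ0, le_abs_self C]
      exact h6.trans (mul_le_mul_of_nonneg_left h5 hB)

/-- Bound of the iterated logarithm on a dyadic block. -/
theorem log_log_le_of_le_two_pow {j J k : ℕ} (hj : J + 2 ≤ j) (hk : 2 ^ j ≤ k)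
    (hk' : k ≤ 2 ^ (j + J)) : Real.log (Real.log k) ≤ 2 * Real.log j := by
  have hj0 : (2 : ℝ) ≤ j := by exact_mod_cast (by omega : 2 ≤ j)
  have hJ : (J : ℝ) + 2 ≤ j := by exact_mod_cast hj
  have hkpos : (4 : ℝ) ≤ k := by
    have : 2 ^ 2 ≤ 2 ^ j := Nat.pow_le_pow_right (by norm_num) (by omega)
    exact_mod_cast this.trans hk
  have h1 : Real.log k ≤ (j + J) * Real.log 2 := by
    have : Real.log k ≤ Real.log ((2 : ℝ) ^ (j + J)) :=
      Real.log_le_log (by linarith) (by exact_mod_cast hk')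
    simpa [Real.log_pow] using this
  have hl2 := Real.log_two_lt_d9
  have hl2' := Real.log_two_gt_d9
  have h2 : Real.log k ≤ (j : ℝ) ^ 2 := by
    have hJ0 : (0 : ℝ) ≤ J := Nat.cast_nonneg _
    nlinarith
  have h3 : 0 < Real.log k := Real.log_pos (by linarith)
  calc Real.log (Real.log k) ≤ Real.log ((j : ℝ) ^ 2) := Real.log_le_log h3 h2
    _ = 2 * Real.log j := by rw [Real.log_pow]; norm_num

/-- For `j ≥ 4` one has `j log 2 ≥ 2`, so `j ≤ (j log 2)² ≤ (log k)²`. This converts bounds in the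
block index back to bounds in time. -/
theorem log_le_two_mul_log_log {j k : ℕ} (hj : 4 ≤ j) (hk : 2 ^ j ≤ k) :
    Real.log j ≤ 2 * Real.log (Real.log k) := by
  have hj0 : (4 : ℝ) ≤ j := by exact_mod_cast hj
  have h1 : j * Real.log 2 ≤ Real.log k := by
    have : Real.log ((2 : ℝ) ^ j) ≤ Real.log k :=
      Real.log_le_log (by positivity) (by exact_mod_cast hk)
    simpa [Real.log_pow] using this
  have hl2' := Real.log_two_gt_d9
  have h2 : (j : ℝ) ≤ (Real.log k) ^ 2 := by
    have h0 : (2 : ℝ) ≤ j * Real.log 2 := by nlinarith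
    nlinarith
  have h3 : Real.log j ≤ Real.log ((Real.log k) ^ 2) := Real.log_le_log (by linarith) h2
  rwa [Real.log_pow] at h3

theorem tendsto_log_log_atTop : Tendsto (fun k : ℕ => Real.log (Real.log k)) atTop atTop :=
  Real.tendsto_log_atTop.comp (Real.tendsto_log_atTop.comp tendsto_natCast_atTop_atTop)

theorem tendsto_log_log_div_atTop :
    Tendsto (fun k : ℕ => Real.log (Real.log k) / k) atTop (nhds 0) := by
  have h1 : Tendsto (fun k : ℕ => Real.log k / k) atTop (nhds 0) := by
    have := (Real.isLittleO_log_id_atTop.tendsto_div_nhds_zero).comp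
      (tendsto_natCast_atTop_atTop (R := ℝ))
    exact this
  refine squeeze_zero' ?_ ?_ h1
  · filter_upwards [tendsto_log_log_atTop.eventually_ge_atTop 0] with k hk
    positivity
  · filter_upwards [(Real.tendsto_log_atTop.comp
      (tendsto_natCast_atTop_atTop (R := ℝ))).eventually_ge_atTop 1] with k hk
    have : Real.log (Real.log k) ≤ Real.log k := by
      have := Real.log_le_sub_one_of_pos (x := Real.log k) (by simp at hk; linarith)
      linarith
    gcongr

/-! ### The deterministic Lyapunov argument -/

section Rate

variable {E : Type*} [NormedAddCommGroup E] [InnerProductSpace ℝ E]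

/-- Over a long dyadic block, linearly growing information of bounded regressors is exciting. -/
theorem exists_block_excitation {φ : ℕ → E} {c C : ℝ} (hc : 0 < c) {k₀ : ℕ}
    (hφ : ∀ k, ‖φ k‖ ≤ C)
    (hPE : ∀ k ≥ k₀, ∀ v, c * k * ‖v‖ ^ 2 ≤ ∑ i ∈ Finset.range k, (inner ℝ (φ i) v) ^ 2) :
    ∃ J : ℕ, 0 < J ∧ ∀ m ≥ k₀, ∀ v,
      m * ‖v‖ ^ 2 ≤ ∑ i ∈ Finset.Ico m (2 ^ J * m), (inner ℝ (φ i) v) ^ 2 := by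
  -- The terms up to `2 ^ (J + 1) * m` carry at least `(C² + 1) m ‖v‖²`, of which the first `m` take
  -- at most `C² m ‖v‖²`.
  obtain ⟨J, hJ⟩ := pow_unbounded_of_one_lt ((C ^ 2 + 1) / c) (one_lt_two (α := ℝ))
  have hJ' : C ^ 2 + 1 ≤ c * 2 ^ (J + 1) := by
    rw [div_lt_iff₀ hc] at hJ
    rw [pow_succ (2 : ℝ) J]; nlinarith [sq_nonneg C]
  refine ⟨J + 1, Nat.succ_pos _, fun m hm v => ?_⟩
  have hle : m ≤ 2 ^ (J + 1) * m := Nat.le_mul_of_pos_left _ (by positivity)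
  have h1 := hPE (2 ^ (J + 1) * m) (hm.le.trans hle) v
  rw [← Finset.sum_range_add_sum_Ico _ hle] at h1
  have h2 : ∑ i ∈ Finset.range m, (inner ℝ (φ i) v) ^ 2 ≤ m * (C ^ 2 * ‖v‖ ^ 2) := by
    have : ∀ i ∈ Finset.range m, (inner ℝ (φ i) v) ^ 2 ≤ C ^ 2 * ‖v‖ ^ 2 := by
      intro i _
      rw [← mul_pow, ← sq_abs]
      have := abs_real_inner_le_norm (φ i) v
      gcongr
      exact this.trans (by gcongr; exact hφ i)
    simpa using Finset.sum_le_sum this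
  push_cast at h1
  have h3 := mul_le_mul_of_nonneg_right hJ' (mul_nonneg (Nat.cast_nonneg (α := ℝ) m)
    (sq_nonneg ‖v‖))
  nlinarith

/-- Telescoping the Lyapunov inequality over a block. -/
theorem le_of_step {V x h q : ℕ → ℝ} {c : ℝ} {m : ℕ}
    (hstep : ∀ k ≥ m, V (k + 1) ≤ V k - c * x k ^ 2 + h k + q k) (n : ℕ) (hn : m ≤ n) :
    V n ≤ V m - c * ∑ k ∈ Finset.Ico m n, x k ^ 2 + ∑ k ∈ Finset.Ico m n, h k
      + ∑ k ∈ Finset.Ico m n, q k := by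
  induction n, hn using Nat.le_induction with
  | base => simp
  | succ n hn ih =>
    rw [Finset.sum_Ico_succ_top hn, Finset.sum_Ico_succ_top hn, Finset.sum_Ico_succ_top hn]
    have := hstep n hn
    linarith

/-- Consistency from the Lyapunov inequality. -/
theorem tendsto_zero_of_lyapunov {F : Type*} [NormedAddCommGroup F] {θt : ℕ → F}
    {V x h : ℕ → ℝ} {c C : ℝ} (hc : 0 < c) {k₀ : ℕ}
    (hVlow : ∀ k ≥ k₀, c * k * ‖θt k‖ ^ 2 ≤ V k)
    (hstep : ∀ k ≥ k₀,
      V (k + 1) ≤ V k - c * x k ^ 2 + h k + C * (Real.log (Real.log k) / k))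
    (hh : ∃ C' : ℝ, ∃ j₀ : ℕ, ∀ j ≥ j₀, ∀ n ≥ 2 ^ j, ∑ i ∈ Finset.Ico (2 ^ j) n, h i ≤
      c / 2 * ∑ i ∈ Finset.Ico (2 ^ j) n, x i ^ 2 + C' * Real.log j) :
    Tendsto θt atTop (nhds 0) := by
  obtain ⟨C', j₀, hh⟩ := hh
  obtain ⟨j, hj₀, hjk⟩ : ∃ j ≥ j₀, k₀ ≤ 2 ^ j :=
    ⟨max j₀ k₀, le_max_left _ _, (le_max_right _ _).trans Nat.lt_two_pow_self.le⟩
  set m := 2 ^ j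
  set q : ℕ → ℝ := fun k => C * (Real.log (Real.log k) / k)
  have hq : Tendsto q atTop (nhds 0) := by simpa using tendsto_log_log_div_atTop.const_mul C
  set A := V m + C' * Real.log j - ∑ k ∈ Finset.range m, q k
  have hV : ∀ n ≥ m, V n ≤ A + ∑ k ∈ Finset.range n, q k := by
    intro n hn
    have h1 := le_of_step (fun k hk => hstep k (hjk.trans hk)) n hn
    have h2 := hh j hj₀ n hn
    have h3 : 0 ≤ ∑ k ∈ Finset.Ico m n, x k ^ 2 := Finset.sum_nonneg fun _ _ => sq_nonneg _
    rw [← Finset.sum_range_add_sum_Ico q hn]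
    have h4 : 0 ≤ c / 2 * ∑ k ∈ Finset.Ico m n, x k ^ 2 := by positivity
    simp only [A]
    change V n ≤ V m - c * ∑ k ∈ Finset.Ico m n, x k ^ 2 + ∑ k ∈ Finset.Ico m n, h k
      + ∑ k ∈ Finset.Ico m n, q k at h1
    linarith
  -- The perturbations need not be summable. Since they tend to zero their Cesàro means do too, and
  -- `V n / n` is all that bounds the error.
  have h5 : Tendsto (fun n : ℕ => c⁻¹ * (A * (n : ℝ)⁻¹ + (n : ℝ)⁻¹ * ∑ k ∈ Finset.range n, q k))
      atTop (nhds 0) := by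
    have := ((tendsto_inv_atTop_nhds_zero_nat (𝕜 := ℝ)).const_mul A).add hq.cesaro
    simpa using this.const_mul c⁻¹
  have h6 : Tendsto (fun n => ‖θt n‖ ^ 2) atTop (nhds 0) := by
    refine squeeze_zero' (Eventually.of_forall fun _ => sq_nonneg _) ?_ h5
    filter_upwards [eventually_ge_atTop m, eventually_gt_atTop 0] with n hn hn0
    have h7 := (hVlow n (hjk.trans hn)).trans (hV n hn)
    have hn0' : (0 : ℝ) < n := by exact_mod_cast hn0
    rw [← mul_le_mul_iff_right₀ (show 0 < c * n by positivity)]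
    refine h7.trans (le_of_eq ?_)
    field_simp
  rw [tendsto_zero_iff_norm_tendsto_zero]
  have := h6.sqrt
  simpa using this

/-- Over a block the movement of the error is controlled by the excitation and the noise. -/
theorem norm_sub_sq_le_of_move {φ θt r : ℕ → E} {g w : ℕ → ℝ} {C B : ℝ} {m N : ℕ}
    (hC : 0 ≤ C) (hm : 0 < m)
    (hmove : ∀ k ≥ m, θt (k + 1) = θt k - (g k + w k) • r k)
    (hr : ∀ k ≥ m, ‖r k‖ ≤ C / k) (hg : ∀ k ≥ m, |g k| ≤ C * |inner ℝ (φ k) (θt k)|)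
    (hw : ∀ n, m ≤ n → n ≤ N → ‖∑ i ∈ Finset.Ico m n, w i • r i‖ ^ 2 ≤ B)
    (n : ℕ) (hn : m ≤ n) (hnN : n ≤ N) :
    ‖θt n - θt m‖ ^ 2 ≤ 2 * (C ^ 4 * N / m ^ 2 *
      ∑ i ∈ Finset.Ico m N, inner ℝ (φ i) (θt i) ^ 2) + 2 * B := by
  have hm' : (0 : ℝ) < m := by exact_mod_cast hm
  have h1 : ∀ n ≥ m, θt n - θt m = -(∑ i ∈ Finset.Ico m n, g i • r i) -
      ∑ i ∈ Finset.Ico m n, w i • r i := by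
    intro n hn
    induction n, hn using Nat.le_induction with
    | base => simp
    | succ n hn ih =>
      rw [Finset.sum_Ico_succ_top hn, Finset.sum_Ico_succ_top hn, hmove n hn,
        sub_right_comm, ih, add_smul]
      abel
  have h2 : ‖∑ i ∈ Finset.Ico m n, g i • r i‖ ≤
      ∑ i ∈ Finset.Ico m n, C ^ 2 / m * |inner ℝ (φ i) (θt i)| := by
    refine norm_sum_le_of_le _ fun i hi => ?_
    have hi' := (Finset.mem_Ico.1 hi).1
    have him : (m : ℝ) ≤ i := by exact_mod_cast hi'
    rw [norm_smul, Real.norm_eq_abs]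
    calc |g i| * ‖r i‖ ≤ (C * |inner ℝ (φ i) (θt i)|) * (C / m) := by
          gcongr
          · exact hg i hi'
          · exact (hr i hi').trans (by gcongr)
      _ = _ := by ring
  -- Cauchy–Schwarz over at most `N` steps. On a block `N` is a fixed multiple of `m`, so the factor
  -- is of order `1 / m`.
  have h3 : ‖∑ i ∈ Finset.Ico m n, g i • r i‖ ^ 2 ≤ C ^ 4 * N / m ^ 2 *
      ∑ i ∈ Finset.Ico m N, inner ℝ (φ i) (θt i) ^ 2 := by
    calc ‖∑ i ∈ Finset.Ico m n, g i • r i‖ ^ 2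
        ≤ (∑ i ∈ Finset.Ico m n, C ^ 2 / m * |inner ℝ (φ i) (θt i)|) ^ 2 := by gcongr
      _ ≤ (Finset.Ico m n).card * ∑ i ∈ Finset.Ico m n, (C ^ 2 / m * |inner ℝ (φ i) (θt i)|) ^ 2 :=
          sq_sum_le_card_mul_sum_sq
      _ = C ^ 4 * (Finset.Ico m n).card / m ^ 2 *
          ∑ i ∈ Finset.Ico m n, inner ℝ (φ i) (θt i) ^ 2 := by
          simp_rw [mul_pow, sq_abs]
          rw [← Finset.mul_sum]; ring
      _ ≤ _ := by
          have hcard : ((Finset.Ico m n).card : ℝ) ≤ N := by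
            rw [Nat.card_Ico]; exact_mod_cast (Nat.sub_le _ _).trans hnN
          have hsub : ∑ i ∈ Finset.Ico m n, inner ℝ (φ i) (θt i) ^ 2 ≤
              ∑ i ∈ Finset.Ico m N, inner ℝ (φ i) (θt i) ^ 2 :=
            Finset.sum_le_sum_of_subset_of_nonneg (Finset.Ico_subset_Ico_right hnN)
              fun _ _ _ => sq_nonneg _
          have : 0 ≤ ∑ i ∈ Finset.Ico m n, inner ℝ (φ i) (θt i) ^ 2 :=
            Finset.sum_nonneg fun _ _ => sq_nonneg _
          gcongr
  have h4 := hw n hn hnN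
  have h5 : ‖θt n - θt m‖ ≤ ‖∑ i ∈ Finset.Ico m n, g i • r i‖ +
      ‖∑ i ∈ Finset.Ico m n, w i • r i‖ := by
    rw [h1 n hn]
    simpa using norm_sub_le (-(∑ i ∈ Finset.Ico m n, g i • r i)) (∑ i ∈ Finset.Ico m n, w i • r i)
  have h6 : ‖θt n - θt m‖ ^ 2 ≤ (‖∑ i ∈ Finset.Ico m n, g i • r i‖ +
      ‖∑ i ∈ Finset.Ico m n, w i • r i‖) ^ 2 := by gcongr
  nlinarith [sq_nonneg (‖∑ i ∈ Finset.Ico m n, g i • r i‖ - ‖∑ i ∈ Finset.Ico m n, w i • r i‖)]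

/-- The Lyapunov argument: linear excitation, a Lyapunov function with negative drift and noise
that obeys dyadic iterated-logarithm bounds give the iterated-logarithm rate. -/
theorem isBigO_log_log_div_of_lyapunov {φ θt r : ℕ → E} {V g w h : ℕ → ℝ} {c C : ℝ} (hc : 0 < c)
    (hC : 0 ≤ C) {k₀ : ℕ} (hφ : ∀ k, ‖φ k‖ ≤ C)
    (hPE : ∀ k ≥ k₀, ∀ v, c * k * ‖v‖ ^ 2 ≤ ∑ i ∈ Finset.range k, (inner ℝ (φ i) v) ^ 2)
    (hVlow : ∀ k ≥ k₀, c * k * ‖θt k‖ ^ 2 ≤ V k)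
    (hVup : ∀ k ≥ k₀, V k ≤ C * k * ‖θt k‖ ^ 2)
    (hstep : ∀ k ≥ k₀, V (k + 1) ≤
      V k - c * inner ℝ (φ k) (θt k) ^ 2 + h k + C * (Real.log (Real.log k) / k))
    (hh : ∃ C' : ℝ, ∃ j₀ : ℕ, ∀ j ≥ j₀, ∀ n ≥ 2 ^ j, ∑ i ∈ Finset.Ico (2 ^ j) n, h i ≤
      c / 2 * ∑ i ∈ Finset.Ico (2 ^ j) n, inner ℝ (φ i) (θt i) ^ 2 + C' * Real.log j)
    (hr : ∀ k ≥ k₀, ‖r k‖ ≤ C / k) (hg : ∀ k ≥ k₀, |g k| ≤ C * |inner ℝ (φ k) (θt k)|)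
    (hw : ∀ J : ℕ, ∃ C' : ℝ, ∃ j₀ : ℕ, ∀ j ≥ j₀, ∀ n, 2 ^ j ≤ n → n ≤ 2 ^ (j + J) →
      ‖∑ i ∈ Finset.Ico (2 ^ j) n, w i • r i‖ ^ 2 ≤ C' * (Real.log j / 2 ^ j))
    (hmove : Tendsto θt atTop (nhds 0) →
      ∀ᶠ k in atTop, θt (k + 1) = θt k - (g k + w k) • r k) :
    (fun k => ‖θt k‖ ^ 2) =O[atTop] fun k : ℕ => Real.log (Real.log k) / k := by
  -- Consistency has to come first: the unprojected form of the recursion is only available near the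
  -- true parameter.
  obtain ⟨k₁, hmove⟩ := eventually_atTop.1 (hmove (tendsto_zero_of_lyapunov hc hVlow hstep hh))
  obtain ⟨J, hJ0, hJ⟩ := exists_block_excitation hc hφ hPE
  obtain ⟨C₁, j₁, hh⟩ := hh
  obtain ⟨C₂, j₂, hw⟩ := hw J
  set x : ℕ → ℝ := fun k => inner ℝ (φ k) (θt k)
  set j₀ := max (max j₁ j₂) (max (max k₀ k₁) (J + 4))
  have hj : ∀ j ≥ j₀, j₁ ≤ j ∧ j₂ ≤ j ∧ k₀ ≤ 2 ^ j ∧ k₁ ≤ 2 ^ j ∧ J + 4 ≤ j := by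
    intro j hj
    have : j < 2 ^ j := Nat.lt_two_pow_self
    simp only [j₀, ge_iff_le, max_le_iff] at hj
    omega
  have hlog : ∀ j ≥ j₀, 1 ≤ Real.log j := by
    intro j hjj
    have h4 : (4 : ℝ) ≤ j := by exact_mod_cast (by have := hj j hjj; omega : 4 ≤ j)
    rw [Real.le_log_iff_exp_le (by linarith)]
    linarith [Real.exp_one_lt_d9]
  -- growth within a block
  set G := C₁ + C * (2 * 2 ^ J)
  have hgrow : ∀ j ≥ j₀, ∀ n, 2 ^ j ≤ n → n ≤ 2 ^ (j + J) →
      V n ≤ V (2 ^ j) - c / 2 * ∑ i ∈ Finset.Ico (2 ^ j) n, x i ^ 2 + G * Real.log j := by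
    intro j hjj n hn hnN
    obtain ⟨a1, a2, a3, a4, a5⟩ := hj j hjj
    have h1 := le_of_step (fun k hk => hstep k (a3.trans hk)) n hn
    have h2 := hh j a1 n hn
    have h3 : ∑ k ∈ Finset.Ico (2 ^ j) n, C * (Real.log (Real.log k) / k) ≤
        C * (2 * 2 ^ J) * Real.log j := by
      -- At most `2^j * 2^J` terms, each of order `log j / 2^j`, so a whole block contributes only
      -- `O(log j)`.
      have h4 : ∀ k ∈ Finset.Ico (2 ^ j) n, C * (Real.log (Real.log k) / k) ≤
          C * (2 * Real.log j / 2 ^ j) := by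
        intro k hk
        rw [Finset.mem_Ico] at hk
        have h5 := log_log_le_of_le_two_pow (J := J) (by omega) hk.1 (hk.2.le.trans hnN)
        have h6 : (2 : ℝ) ^ j ≤ k := by exact_mod_cast hk.1
        have := hlog j hjj
        gcongr
      refine (Finset.sum_le_sum h4).trans ?_
      rw [Finset.sum_const, nsmul_eq_mul, Nat.card_Ico]
      have h7 : ((n - 2 ^ j : ℕ) : ℝ) ≤ 2 ^ j * 2 ^ J := by
        rw [← pow_add]; exact_mod_cast (Nat.sub_le _ _).trans hnN
      have := hlog j hjj
      calc ((n - 2 ^ j : ℕ) : ℝ) * (C * (2 * Real.log j / 2 ^ j))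
          ≤ (2 ^ j * 2 ^ J) * (C * (2 * Real.log j / 2 ^ j)) := by gcongr
        _ = _ := by field_simp
    simp only [G, add_mul]
    simp only [x]
    linarith
  -- contraction over a block
  set D := C * (2 + 4 * C ^ 6 * (2 ^ J) ^ 2 + 4 * C ^ 2 * 2 ^ J * |C₂| + 1)
  have hD : 0 ≤ D := by positivity
  have hcontr : ∀ j ≥ j₀, V (2 ^ j) ≤
      D * (∑ i ∈ Finset.Ico (2 ^ j) (2 ^ (j + J)), x i ^ 2 + Real.log j) := by
    intro j hjj
    obtain ⟨a1, a2, a3, a4, a5⟩ := hj j hjj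
    have hlj := hlog j hjj
    have e1 : 2 ^ J * 2 ^ j = 2 ^ (j + J) := by rw [add_comm, pow_add]
    have h1 := hJ (2 ^ j) a3 (θt (2 ^ j))
    rw [e1] at h1
    set X := ∑ i ∈ Finset.Ico (2 ^ j) (2 ^ (j + J)), x i ^ 2
    have hX : 0 ≤ X := Finset.sum_nonneg fun _ _ => sq_nonneg _
    set B := |C₂| * (Real.log j / 2 ^ j)
    have hB : 0 ≤ B := by positivity
    set Mv := 2 * (C ^ 4 * (2 ^ (j + J) : ℕ) / (2 ^ j : ℕ) ^ 2 * X) + 2 * B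
    have hMv : 0 ≤ Mv := by positivity
    have h2 : ∀ n, 2 ^ j ≤ n → n ≤ 2 ^ (j + J) → ‖θt n - θt (2 ^ j)‖ ^ 2 ≤ Mv := by
      intro n hn hnN
      refine norm_sub_sq_le_of_move (φ := φ) hC (by positivity)
        (fun k hk => hmove k (a4.trans hk)) (fun k hk => hr k (a3.trans hk))
        (fun k hk => hg k (a3.trans hk)) (fun n hn hnN => ?_) n hn hnN
      refine (hw j a2 n hn hnN).trans ?_
      exact mul_le_mul_of_nonneg_right (le_abs_self _) (by positivity)
    -- Excitation concerns the error frozen at `2 ^ j`, the descent the running error `x i`; their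
    -- difference is bounded by the movement `Mv`.
    have h3 : ∀ i ∈ Finset.Ico (2 ^ j) (2 ^ (j + J)),
        inner ℝ (φ i) (θt (2 ^ j)) ^ 2 ≤ 2 * x i ^ 2 + 2 * C ^ 2 * Mv := by
      intro i hi
      rw [Finset.mem_Ico] at hi
      have h4 : inner ℝ (φ i) (θt (2 ^ j)) = x i - inner ℝ (φ i) (θt i - θt (2 ^ j)) := by
        simp only [x, inner_sub_right]; ring
      have h5 : inner ℝ (φ i) (θt i - θt (2 ^ j)) ^ 2 ≤ C ^ 2 * Mv := by
        calc inner ℝ (φ i) (θt i - θt (2 ^ j)) ^ 2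
            ≤ (‖φ i‖ * ‖θt i - θt (2 ^ j)‖) ^ 2 := by
              rw [← sq_abs]; gcongr; exact abs_real_inner_le_norm _ _
          _ = ‖φ i‖ ^ 2 * ‖θt i - θt (2 ^ j)‖ ^ 2 := by ring
          _ ≤ _ := by
              gcongr
              · exact hφ i
              · exact h2 i hi.1 hi.2.le
      rw [h4]
      nlinarith [sq_nonneg (x i + inner ℝ (φ i) (θt i - θt (2 ^ j)))]
    have h6 := h1.trans (Finset.sum_le_sum h3)
    rw [Finset.sum_add_distrib, ← Finset.mul_sum, Finset.sum_const, nsmul_eq_mul,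
      Nat.card_Ico] at h6
    have h7 : ((2 ^ (j + J) - 2 ^ j : ℕ) : ℝ) * (2 * C ^ 2 * Mv) ≤
        (2 ^ j * 2 ^ J) * (2 * C ^ 2 * Mv) := by
      gcongr
      rw [← pow_add]; exact_mod_cast Nat.sub_le _ _
    have h8 : (2 ^ j * 2 ^ J) * (2 * C ^ 2 * Mv) =
        4 * C ^ 6 * (2 ^ J) ^ 2 * X + 4 * C ^ 2 * 2 ^ J * |C₂| * Real.log j := by
      simp only [Mv, B]
      push_cast
      rw [pow_add]
      field_simp
      ring
    have h9 := hVup (2 ^ j) a3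
    have h10 : V (2 ^ j) ≤ C * (2 * X + (4 * C ^ 6 * (2 ^ J) ^ 2 * X +
        4 * C ^ 2 * 2 ^ J * |C₂| * Real.log j)) := by
      refine h9.trans ?_
      rw [mul_assoc]
      gcongr
      linarith
    refine h10.trans ?_
    simp only [D]
    rw [mul_assoc C (2 + _ + _ + 1)]
    refine mul_le_mul_of_nonneg_left ?_ hC
    have p1 : 0 ≤ 4 * C ^ 6 * (2 ^ J) ^ 2 := by positivity
    have p2 : 0 ≤ 4 * C ^ 2 * 2 ^ J * |C₂| := by positivity
    nlinarith
  -- recurrence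
  set D' := D + c
  have hD' : 0 < D' := by positivity
  -- Adding `c` to `D` keeps the rate `1 - c / (2 * D')` in `[0, 1)`. The descent `c / 2 * X` is
  -- traded for `c / 2 * (V / D')` at the price `c / 2 * log j`, whence the constant `G + c / 2`.
  obtain ⟨B, hB, hrec⟩ := exists_le_mul_log_of_stride (fun j => V (2 ^ j)) hJ0
    (ρ := 1 - c / (2 * D')) (C := G + c / 2) (j₀ := j₀)
    (by rw [sub_nonneg, div_le_one (by positivity)]; simp only [D']; linarith)
    (by rw [sub_lt_self_iff]; positivity) (by
      intro j hjj
      have h1 := hgrow j hjj (2 ^ (j + J)) (Nat.pow_le_pow_right (by norm_num) (by omega)) le_rfl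
      have h2 := hcontr j hjj
      set X := ∑ i ∈ Finset.Ico (2 ^ j) (2 ^ (j + J)), x i ^ 2
      have hX : 0 ≤ X := Finset.sum_nonneg fun _ _ => sq_nonneg _
      have hlj := hlog j hjj
      have h3 : V (2 ^ j) / D' ≤ X + Real.log j := by
        rw [div_le_iff₀ hD']
        refine h2.trans ?_
        rw [mul_comm]
        gcongr
        simp only [D']; linarith
      have h4 : (1 - c / (2 * D')) * V (2 ^ j) = V (2 ^ j) - c / 2 * (V (2 ^ j) / D') := by
        field_simp
      rw [h4]
      have h5 := mul_le_mul_of_nonneg_left h3 (by positivity : 0 ≤ c / 2)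
      nlinarith)
  refine IsBigO.of_bound (2 * (B + |G|) / c) ?_
  filter_upwards [eventually_ge_atTop (2 ^ (max j₀ 4))] with n hn
  have hn0 : n ≠ 0 := by have : 0 < 2 ^ (max j₀ 4) := by positivity
                         omega
  -- A general time lies in `[2^j, 2^(j+1))`, which the growth bound covers because `J > 0`.
  set j := Nat.log 2 n
  have hjn : 2 ^ j ≤ n := Nat.pow_log_le_self 2 hn0
  have hjn' : n < 2 ^ (j + 1) := Nat.lt_pow_succ_log_self (by norm_num) n
  have hjge : max j₀ 4 ≤ j := by
    by_contra hcon
    have : 2 ^ (j + 1) ≤ 2 ^ (max j₀ 4) := Nat.pow_le_pow_right (by norm_num) (by omega)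
    omega
  have hjj : j ≥ j₀ := (le_max_left _ _).trans hjge
  have hj4 : 4 ≤ j := (le_max_right _ _).trans hjge
  have h1 := hgrow j hjj n hjn (hjn'.le.trans (Nat.pow_le_pow_right (by norm_num) (by omega)))
  have h2 := hrec j (by simp only [ge_iff_le, max_le_iff]; omega)
  have h3 := log_le_two_mul_log_log hj4 hjn
  have hX : 0 ≤ c / 2 * ∑ i ∈ Finset.Ico (2 ^ j) n, x i ^ 2 :=
    mul_nonneg (by positivity) (Finset.sum_nonneg fun _ _ => sq_nonneg _)
  have h4 := hVlow n ((hj j hjj).2.2.1.trans hjn)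
  have hlj := hlog j hjj
  have hnpos : (0 : ℝ) < n := by positivity
  have h5 : c * n * ‖θt n‖ ^ 2 ≤ (B + |G|) * (2 * Real.log (Real.log n)) := by
    calc c * n * ‖θt n‖ ^ 2 ≤ (B + |G|) * Real.log j := by
          nlinarith [le_abs_self G]
      _ ≤ _ := by gcongr
  have hll : 0 ≤ Real.log (Real.log n) := by linarith
  rw [Real.norm_of_nonneg (by positivity), Real.norm_of_nonneg (by positivity)]
  rw [← mul_le_mul_iff_right₀ (show 0 < c * n by positivity)]
  refine h5.trans (le_of_eq ?_)
  field_simp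

end Rate

/-! ### Exponential bounds and the maximal inequality for weighted noise -/

/-- Second-order Taylor for `|x| ≤ 1`, monotonicity of `exp` for `x ≥ 1`, and `exp x ≤ 1 ≤ x + 1 +
x²` for `x ≤ -1`. The point is the purely linear first term, which a centred variable integrates to
zero. -/
theorem exp_le_add_exp_sq (x : ℝ) : Real.exp x ≤ x + Real.exp (x ^ 2) := by
  have h2 := Real.add_one_le_exp (x ^ 2)
  rcases le_total |x| 1 with h | h
  · have := (abs_le.1 (Real.abs_exp_sub_one_sub_id_le h)).2
    linarith
  · rcases le_total 0 x with hx | hx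
    · rw [abs_of_nonneg hx] at h
      have : Real.exp x ≤ Real.exp (x ^ 2) := Real.exp_le_exp.2 (by nlinarith)
      linarith
    · rw [abs_of_nonpos hx] at h
      have : Real.exp x ≤ 1 := Real.exp_le_one_iff.2 hx
      nlinarith

/-- Sub-Gaussian compensation of a bounded variable by the square of its coefficient. -/
theorem exp_mul_sub_sq_le (c : ℝ) {w W : ℝ} (hw : |w| ≤ W) :
    Real.exp (c * w - c ^ 2 * W ^ 2) ≤ 1 + c * Real.exp (-(c ^ 2 * W ^ 2)) * w := by
  have h1 := exp_le_add_exp_sq (c * w)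
  have h2 : Real.exp ((c * w) ^ 2) ≤ Real.exp (c ^ 2 * W ^ 2) := by
    rw [mul_pow]
    have : w ^ 2 ≤ W ^ 2 := sq_le_sq' (neg_le_of_abs_le hw) (le_of_abs_le hw)
    gcongr
  have h3 : Real.exp (c ^ 2 * W ^ 2) * Real.exp (-(c ^ 2 * W ^ 2)) = 1 := by
    rw [← Real.exp_add]; simp
  have h4 := Real.exp_pos (-(c ^ 2 * W ^ 2))
  rw [sub_eq_add_neg, Real.exp_add]
  nlinarith

/-- Completing the square bounds each factor of the exponential process without any bound on the
coefficient, so integrability is automatic. -/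
theorem exp_mul_sub_sq_le_exp_one (c : ℝ) {w W : ℝ} (hw : |w| ≤ W) :
    Real.exp (c * w - c ^ 2 * W ^ 2) ≤ Real.exp 1 := by
  refine Real.exp_le_exp.2 ?_
  have h1 : c * w ≤ |c| * W := by
    calc c * w ≤ |c * w| := le_abs_self _
      _ = |c| * |w| := abs_mul _ _
      _ ≤ _ := by gcongr
  nlinarith [sq_nonneg (|c| * W - 1), sq_abs c]

/-- The compensated coefficient is bounded even if `c` is not, which makes it an admissible test
function in `IsNoise.orth`. -/
theorem abs_mul_exp_neg_sq_le (c : ℝ) {W : ℝ} (hW : 0 < W) :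
    |c * Real.exp (-(c ^ 2 * W ^ 2))| ≤ 1 / W := by
  have h1 : |c| * W ≤ Real.exp (c ^ 2 * W ^ 2) := by
    have := Real.add_one_le_exp (c ^ 2 * W ^ 2)
    nlinarith [sq_nonneg (|c| * W - 1), sq_abs c]
  rw [abs_mul, abs_of_pos (Real.exp_pos _), Real.exp_neg, le_div_iff₀ hW]
  have h2 := Real.exp_pos (c ^ 2 * W ^ 2)
  calc |c| * (Real.exp (c ^ 2 * W ^ 2))⁻¹ * W = (|c| * W) / Real.exp (c ^ 2 * W ^ 2) := by
        field_simp
    _ ≤ 1 := (div_le_one h2).2 h1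

section Noise

variable {Ω : Type*} [mΩ : MeasurableSpace Ω]

/-- A bounded adapted noise that is orthogonal to the bounded functions of the past. -/
structure IsNoise (P : Measure Ω) (ℱ : Filtration ℕ mΩ) (W : ℝ) (w : ℕ → Ω → ℝ) : Prop where
  pos : 0 < W
  meas : ∀ k, Measurable[ℱ (k + 1)] (w k)
  bdd : ∀ k ω, |w k ω| ≤ W
  orth : ∀ k (H : Ω → ℝ), Measurable[ℱ k] H → (∃ B, ∀ ω, |H ω| ≤ B) → ∫ ω, H ω * w k ω ∂P = 0

/-- The compensated sum of a weighted noise. -/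
def tiltSum (c w : ℕ → Ω → ℝ) (W : ℝ) (n : ℕ) (ω : Ω) : ℝ :=
  ∑ i ∈ Finset.range n, (c i ω * w i ω - c i ω ^ 2 * W ^ 2)

variable {P : Measure Ω} {ℱ : Filtration ℕ mΩ} {W : ℝ} {w : ℕ → Ω → ℝ}
  {c : ℕ → Ω → ℝ}

theorem measurable_tiltSum (hw : IsNoise P ℱ W w) (hc : ∀ k, Measurable[ℱ k] (c k)) (n : ℕ) :
    Measurable[ℱ n] (tiltSum c w W n) := by
  unfold tiltSum
  refine Finset.measurable_sum _ fun i hi => ?_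
  rw [Finset.mem_range] at hi
  have h1 : Measurable[ℱ n] (c i) := (hc i).mono (ℱ.mono hi.le) le_rfl
  have h2 : Measurable[ℱ n] (w i) := (hw.meas i).mono (ℱ.mono hi) le_rfl
  exact (h1.mul h2).sub ((h1.pow_const 2).mul_const _)

theorem exp_tiltSum_le (hw : IsNoise P ℱ W w) (n : ℕ) (ω : Ω) :
    Real.exp (tiltSum c w W n ω) ≤ Real.exp 1 ^ n := by
  unfold tiltSum
  rw [Real.exp_sum]
  calc _ ≤ ∏ _i ∈ Finset.range n, Real.exp 1 :=
        Finset.prod_le_prod (fun _ _ => (Real.exp_pos _).le)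
          fun i _ => exp_mul_sub_sq_le_exp_one _ (hw.bdd i ω)
    _ = _ := by simp

variable [IsProbabilityMeasure P]

theorem integrable_exp_tiltSum (hw : IsNoise P ℱ W w) (hc : ∀ k, Measurable[ℱ k] (c k)) (n : ℕ) :
    Integrable (fun ω => Real.exp (tiltSum c w W n ω)) P := by
  refine Integrable.of_bound (C := Real.exp 1 ^ n) ?_ (ae_of_all _ fun ω => ?_)
  · exact (((measurable_tiltSum hw hc n).mono (ℱ.le n) le_rfl).exp).aestronglyMeasurable
  · rw [Real.norm_of_nonneg (Real.exp_pos _).le]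
    exact exp_tiltSum_le hw n ω

theorem integral_exp_tiltSum_le_one (hw : IsNoise P ℱ W w) (hc : ∀ k, Measurable[ℱ k] (c k))
    (n : ℕ) : ∫ ω, Real.exp (tiltSum c w W n ω) ∂P ≤ 1 := by
  induction n with
  | zero => simp [tiltSum]
  | succ n ih =>
    -- The factor multiplying `w n` after the linear bound on the exponential; it is bounded and
    -- depends only on the past, so its product with `w n` has mean zero.
    set H : Ω → ℝ := fun ω => Real.exp (tiltSum c w W n ω) *
      (c n ω * Real.exp (-(c n ω ^ 2 * W ^ 2)))
    have hH : Measurable[ℱ n] H :=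
      (Measurable.exp (measurable_tiltSum hw hc n)).mul
        ((hc n).mul (Measurable.exp (((hc n).pow_const 2).mul_const _).neg))
    have hHb : ∀ ω, |H ω| ≤ Real.exp 1 ^ n * (1 / W) := by
      intro ω
      simp only [H]
      rw [abs_mul, abs_of_pos (Real.exp_pos _)]
      gcongr
      · exact exp_tiltSum_le hw n ω
      · exact abs_mul_exp_neg_sq_le _ hw.pos
    have hHw : Integrable (fun ω => H ω * w n ω) P := by
      refine Integrable.of_bound (C := Real.exp 1 ^ n * (1 / W) * W) ?_ (ae_of_all _ fun ω => ?_)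
      · exact ((hH.mono (ℱ.le n) le_rfl).mul
          ((hw.meas n).mono (ℱ.le _) le_rfl)).aestronglyMeasurable
      · rw [Real.norm_eq_abs, abs_mul]
        gcongr
        · exact (abs_nonneg _).trans (hHb ω)
        · exact hHb ω
        · exact hw.bdd n ω
    calc ∫ ω, Real.exp (tiltSum c w W (n + 1) ω) ∂P
        ≤ ∫ ω, (Real.exp (tiltSum c w W n ω) + H ω * w n ω) ∂P := by
          refine integral_mono (integrable_exp_tiltSum hw hc _)
            ((integrable_exp_tiltSum hw hc n).add hHw) fun ω => ?_
          have h1 : tiltSum c w W (n + 1) ω = tiltSum c w W n ω +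
              (c n ω * w n ω - c n ω ^ 2 * W ^ 2) := Finset.sum_range_succ _ _
          have h2 := exp_mul_sub_sq_le (c n ω) (hw.bdd n ω)
          have h3 := Real.exp_pos (tiltSum c w W n ω)
          simp only [h1, Real.exp_add, H]
          nlinarith
      _ = ∫ ω, Real.exp (tiltSum c w W n ω) ∂P := by
          rw [integral_add (integrable_exp_tiltSum hw hc n) hHw, hw.orth n H hH ⟨_, hHb⟩, add_zero]
      _ ≤ 1 := ih

open Classical in
/-- The maximal inequality for the exponential supermartingale of a weighted noise. -/
theorem measure_exists_tiltSum_ge_le (hw : IsNoise P ℱ W w) (hc : ∀ k, Measurable[ℱ k] (c k))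
    (a : ℝ) : P {ω | ∃ n, a ≤ tiltSum c w W n ω} ≤ ENNReal.ofReal (Real.exp (-a)) := by
  -- Stopping at the first passage above `a` is done by switching the coefficients off. The stopped
  -- sum is again a `tiltSum` with adapted coefficients, so the moment bound and Markov's inequality
  -- apply to it.
  set c' : ℕ → Ω → ℝ := fun i ω => if ∀ l ≤ i, tiltSum c w W l ω < a then c i ω else 0
  have hc' : ∀ k, Measurable[ℱ k] (c' k) := by
    intro k
    refine Measurable.ite ?_ (hc k) measurable_const
    have : {ω | ∀ l ≤ k, tiltSum c w W l ω < a} = ⋂ l ∈ Set.Iic k, {ω | tiltSum c w W l ω < a} := by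
      ext; simp
    rw [this]
    refine MeasurableSet.biInter (Set.to_countable _) fun l hl => ?_
    exact measurableSet_lt ((measurable_tiltSum hw hc l).mono (ℱ.mono hl) le_rfl) measurable_const
  have hhalt : ∀ ω n, (∀ l ≤ n, tiltSum c w W l ω < a) ∧ tiltSum c' w W n ω = tiltSum c w W n ω ∨
      (∃ l ≤ n, a ≤ tiltSum c w W l ω) ∧ a ≤ tiltSum c' w W n ω := by
    intro ω n
    induction n with
    | zero =>
      rcases lt_or_ge (tiltSum c w W 0 ω) a with h | h
      · left
        refine ⟨fun l hl => ?_, by simp [tiltSum]⟩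
        rwa [Nat.le_zero.1 hl]
      · right
        exact ⟨⟨0, le_rfl, h⟩, by simpa [tiltSum] using h⟩
    | succ n ih =>
      have h1 : tiltSum c' w W (n + 1) ω = tiltSum c' w W n ω +
          (c' n ω * w n ω - c' n ω ^ 2 * W ^ 2) := Finset.sum_range_succ _ _
      have h2 : tiltSum c w W (n + 1) ω = tiltSum c w W n ω +
          (c n ω * w n ω - c n ω ^ 2 * W ^ 2) := Finset.sum_range_succ _ _
      rcases ih with ⟨hl, he⟩ | ⟨⟨l, hl, hla⟩, he⟩
      · have h3 : c' n ω = c n ω := if_pos hl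
        have h4 : tiltSum c' w W (n + 1) ω = tiltSum c w W (n + 1) ω := by rw [h1, h2, h3, he]
        rcases lt_or_ge (tiltSum c w W (n + 1) ω) a with h | h
        · left
          refine ⟨fun l hl' => ?_, h4⟩
          rcases Nat.le_succ_iff.1 hl' with h5 | h5
          · exact hl l h5
          · rwa [h5]
        · right
          exact ⟨⟨n + 1, le_rfl, h⟩, h4 ▸ h⟩
      · right
        refine ⟨⟨l, hl.trans (Nat.le_succ _), hla⟩, ?_⟩
        have h3 : c' n ω = 0 := if_neg fun h => absurd (h l hl) (not_lt.2 hla)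
        rw [h1, h3]
        simpa using he
  have hbound : ∀ N, P {ω | ∃ n ≤ N, a ≤ tiltSum c w W n ω} ≤
      ENNReal.ofReal (Real.exp (-a)) := by
    intro N
    have h1 : {ω | ∃ n ≤ N, a ≤ tiltSum c w W n ω} ⊆
        {ω | Real.exp a ≤ Real.exp (tiltSum c' w W N ω)} := by
      intro ω hω
      obtain ⟨n, hn, hna⟩ := hω
      rcases hhalt ω N with h | h
      · exact absurd (h.1 n hn) (not_lt.2 hna)
      · exact Real.exp_le_exp.2 h.2
    refine (measure_mono h1).trans ?_
    have h2 := mul_meas_ge_le_integral_of_nonneg (μ := P)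
      (ae_of_all _ fun ω => (Real.exp_pos (tiltSum c' w W N ω)).le)
      (integrable_exp_tiltSum hw hc' N) (Real.exp a)
    have h3 := h2.trans (integral_exp_tiltSum_le_one hw hc' N)
    rw [← ENNReal.ofReal_toReal (measure_ne_top P _)]
    refine ENNReal.ofReal_le_ofReal ?_
    rw [Real.exp_neg, ← one_div, le_div_iff₀' (Real.exp_pos _)]
    exact h3
  have hU : {ω | ∃ n, a ≤ tiltSum c w W n ω} = ⋃ N, {ω | ∃ n ≤ N, a ≤ tiltSum c w W n ω} := by
    ext ω
    simp only [Set.mem_ofPred_eq, Set.mem_iUnion]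
    exact ⟨fun ⟨n, h⟩ => ⟨n, n, le_rfl, h⟩, fun ⟨_, n, _, h⟩ => ⟨n, h⟩⟩
  rw [hU, Monotone.measure_iUnion]
  · exact iSup_le hbound
  · intro N N' hN ω ⟨n, hn, h⟩
    exact ⟨n, hn.trans hN, h⟩

/-- The terms are `j⁻²`, except at `j = 0`, where `Real.log 0 = 0` gives a harmless `1`; the shift
by one removes it. -/
theorem tsum_exp_neg_two_log_ne_top :
    ∑' j : ℕ, ENNReal.ofReal (Real.exp (-(2 * Real.log j))) ≠ ⊤ := by
  have hs : Summable fun j : ℕ => Real.exp (-(2 * Real.log j)) := by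
    rw [← summable_nat_add_iff 1]
    have h := (summable_nat_add_iff 1).2 (Real.summable_one_div_nat_pow.2 (one_lt_two))
    refine h.congr fun j => ?_
    have hj : (0 : ℝ) < (j + 1 : ℕ) := by positivity
    rw [Real.exp_neg, mul_comm, Real.exp_mul, Real.exp_log hj, one_div]
    norm_num
  exact hs.tsum_ofReal_ne_top

/-- Dyadic iterated-logarithm bound for the compensated sums of weighted noise. -/
theorem ae_eventually_sum_Ico_lt (hw : IsNoise P ℱ W w) {c : ℕ → ℕ → Ω → ℝ}
    (hc : ∀ j k, Measurable[ℱ k] (c j k)) :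
    ∀ᵐ ω ∂P, ∀ᶠ j in atTop, ∀ n ≥ 2 ^ j,
      ∑ i ∈ Finset.Ico (2 ^ j) n, c j i ω * w i ω <
        W ^ 2 * ∑ i ∈ Finset.Ico (2 ^ j) n, c j i ω ^ 2 + 2 * Real.log j := by
  -- Each block has its own weights, zeroed before the block starts, so the maximal inequality
  -- started at time zero controls the sums from `2 ^ j`.
  set c' : ℕ → ℕ → Ω → ℝ := fun j i ω => if 2 ^ j ≤ i then c j i ω else 0
  have hc' : ∀ j k, Measurable[ℱ k] (c' j k) := by
    intro j k
    by_cases h : 2 ^ j ≤ k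
    · simpa only [c', h, if_true] using hc j k
    · simp only [c', h, if_false]; exact measurable_const
  have hBC := ae_eventually_notMem (μ := P)
    (s := fun j : ℕ => {ω | ∃ n, 2 * Real.log j ≤ tiltSum (c' j) w W n ω})
    (ne_top_of_le_ne_top tsum_exp_neg_two_log_ne_top
      (ENNReal.tsum_le_tsum fun j => measure_exists_tiltSum_ge_le hw (hc' j) _))
  filter_upwards [hBC] with ω hω
  filter_upwards [hω] with j hj n hn
  simp only [not_exists, not_le] at hj
  have h1 := hj n
  have h2 : tiltSum (c' j) w W n ω =
      ∑ i ∈ Finset.Ico (2 ^ j) n, (c j i ω * w i ω - c j i ω ^ 2 * W ^ 2) := by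
    unfold tiltSum
    rw [← Finset.sum_range_add_sum_Ico _ hn, Finset.sum_eq_zero, zero_add]
    · refine Finset.sum_congr rfl fun i hi => ?_
      simp only [c', if_pos (Finset.mem_Ico.1 hi).1]
    · intro i hi
      simp only [c', if_neg (not_le.2 (Finset.mem_range.1 hi))]
      ring
  rw [h2, Finset.sum_sub_distrib, ← Finset.sum_mul] at h1
  linarith

end Noise

/-! ### Projection onto a convex compact set in a weighted norm -/

section Proj

variable {d : ℕ} {D : Set (Fin d → ℝ)} {Q : Matrix (Fin d) (Fin d) ℝ}

theorem dotProduct_mulVec_comm (hQ : Q.IsHermitian) (u v : Fin d → ℝ) :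
    u ⬝ᵥ (Q *ᵥ v) = v ⬝ᵥ (Q *ᵥ u) := by
  have hT : Qᵀ = Q := by simpa [Matrix.IsHermitian] using hQ
  rw [dotProduct_mulVec, ← mulVec_transpose, hT, dotProduct_comm]

theorem quad_add_smul (hQ : Q.IsHermitian) (u v : Fin d → ℝ) (s : ℝ) :
    (u + s • v) ⬝ᵥ (Q *ᵥ (u + s • v)) =
      u ⬝ᵥ (Q *ᵥ u) + 2 * s * (u ⬝ᵥ (Q *ᵥ v)) + s ^ 2 * (v ⬝ᵥ (Q *ᵥ v)) := by
  simp only [mulVec_add, mulVec_smul, add_dotProduct, dotProduct_add, smul_dotProduct,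
    dotProduct_smul, smul_eq_mul, dotProduct_mulVec_comm hQ v u]
  ring

theorem quad_nonneg (hQ : Q.PosSemidef) (u : Fin d → ℝ) : 0 ≤ u ⬝ᵥ (Q *ᵥ u) := by
  simpa using hQ.dotProduct_mulVec_nonneg u

theorem normQ_le_normQ_iff (hQ : Q.PosSemidef) (u v : Fin d → ℝ) :
    normQ Q u ≤ normQ Q v ↔ u ⬝ᵥ (Q *ᵥ u) ≤ v ⬝ᵥ (Q *ᵥ v) :=
  Real.sqrt_le_sqrt_iff (quad_nonneg hQ v)

/-- The obtuse angle property of the projection, in integrated form. -/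
theorem IsProj.quad_add_quad_le (hQ : Q.PosDef) (hD : Convex ℝ D) {x p : Fin d → ℝ}
    (h : IsProj D Q x p) {y : Fin d → ℝ} (hy : y ∈ D) :
    (y - p) ⬝ᵥ (Q *ᵥ (y - p)) + (x - p) ⬝ᵥ (Q *ᵥ (x - p)) ≤ (y - x) ⬝ᵥ (Q *ᵥ (y - x)) := by
  obtain ⟨hp, hmin⟩ := h
  have key : ∀ s : ℝ, 0 < s → s ≤ 1 →
      2 * ((x - p) ⬝ᵥ (Q *ᵥ (y - p))) ≤ s * ((y - p) ⬝ᵥ (Q *ᵥ (y - p))) := by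
    intro s hs0 hs1
    have hmem : p + s • (y - p) ∈ D := hD.add_smul_sub_mem hp hy ⟨hs0.le, hs1⟩
    have h1 := (normQ_le_normQ_iff hQ.posSemidef _ _).1 (hmin _ hmem)
    rw [show x - (p + s • (y - p)) = (x - p) + (-s) • (y - p) by rw [neg_smul]; abel,
      quad_add_smul hQ.isHermitian] at h1
    have h2 : s * (2 * ((x - p) ⬝ᵥ (Q *ᵥ (y - p)))) ≤
        s * (s * ((y - p) ⬝ᵥ (Q *ᵥ (y - p)))) := by nlinarith
    exact le_of_mul_le_mul_left h2 hs0
  have h0 : (x - p) ⬝ᵥ (Q *ᵥ (y - p)) ≤ 0 := by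
    by_contra hpos
    push Not at hpos
    set a := (x - p) ⬝ᵥ (Q *ᵥ (y - p))
    set q := (y - p) ⬝ᵥ (Q *ᵥ (y - p))
    have hq : 0 ≤ q := quad_nonneg hQ.posSemidef _
    -- For a displacement this short `s * q ≤ a`, against `2 * a ≤ s * q` and `a > 0`. The `+ 1`
    -- allows `q = 0`.
    have h3 := key (min 1 (a / (q + 1))) (by positivity) (min_le_left _ _)
    have h4 : min 1 (a / (q + 1)) * q ≤ a / (q + 1) * q := by
      gcongr; exact min_le_right _ _
    have h5 : a / (q + 1) * q ≤ a := by
      rw [div_mul_eq_mul_div, div_le_iff₀ (by linarith)]; nlinarith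
    linarith
  have h6 := quad_add_smul hQ.isHermitian (x - p) (y - p) (-1)
  rw [show (x - p) + (-1 : ℝ) • (y - p) = (-1 : ℝ) • (y - x) by simp] at h6
  simp only [mulVec_smul, smul_dotProduct, dotProduct_smul, smul_eq_mul] at h6
  nlinarith

/-- The obtuse angle inequality at `p` and the minimality of `p'` leave no room for a positive
distance between them. -/
theorem IsProj.eq (hQ : Q.PosDef) (hD : Convex ℝ D) {x p p' : Fin d → ℝ}
    (h : IsProj D Q x p) (h' : IsProj D Q x p') : p' = p := by
  have h1 := h.quad_add_quad_le hQ hD h'.1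
  have h2 := (normQ_le_normQ_iff hQ.posSemidef _ _).1 (h'.2 p h.1)
  have h3 : (p' - x) ⬝ᵥ (Q *ᵥ (p' - x)) = (x - p') ⬝ᵥ (Q *ᵥ (x - p')) := by
    rw [← neg_sub x p', mulVec_neg, neg_dotProduct, dotProduct_neg, neg_neg]
  by_contra hne
  have h4 := hQ.dotProduct_mulVec_pos (sub_ne_zero.2 hne)
  simp only [star_trivial] at h4
  linarith

theorem continuous_normQ : Continuous (normQ Q) := by
  unfold normQ
  fun_prop

theorem isProj_proj (hD : IsCompact D) (hne : D.Nonempty) (x : Fin d → ℝ) :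
    IsProj D Q x (proj D Q x) := by
  obtain ⟨p, hp, hmin⟩ := hD.exists_isMinOn hne
    (f := fun y => normQ Q (x - y)) (continuous_normQ.comp (by fun_prop)).continuousOn
  exact Classical.epsilon_spec (p := IsProj D Q x) ⟨p, hp, fun y hy => hmin hy⟩

theorem proj_eq_self (hQ : Q.PosDef) (hD : Convex ℝ D) (hDc : IsCompact D) {x : Fin d → ℝ}
    (hx : x ∈ D) : proj D Q x = x := by
  refine IsProj.eq hQ hD ⟨hx, fun y _ => ?_⟩ (isProj_proj hDc ⟨x, hx⟩ x)
  rw [normQ_le_normQ_iff hQ.posSemidef]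
  simpa using quad_nonneg hQ.posSemidef (x - y)

end Proj

/-! ### One update: rank-one inversion and the Lyapunov inequality -/

namespace Setup

variable {Ω : Type*} {d : ℕ} (S : Setup Ω d) {k : ℕ} {ω : Ω} {m β : ℝ}
  {A : Matrix (Fin d) (Fin d) ℝ}

theorem posDef_inv_add (hA : A.PosDef) {s : ℝ} (hs : 0 ≤ s) (u : Fin d → ℝ) :
    (A⁻¹ + s • vecMulVec u u).PosDef := by
  refine hA.inv.add_posSemidef (PosSemidef.smul ?_ hs)
  simpa using posSemidef_vecMulVec_self_star u

/-- The Sherman–Morrison identity. It yields both the inverse of the updated matrix and, since that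
inverse is positive definite plus positive semidefinite, its positive definiteness. -/
theorem inv_add_mul_nextP (hm : 0 < m) (hβ : 0 ≤ β) (hA : A.PosDef) :
    (A⁻¹ + (β * S.b k ω ^ 2 / m) • vecMulVec (S.φ k ω) (S.φ k ω)) * S.nextP k ω m β A = 1 := by
  have hp : 0 ≤ S.φ k ω ⬝ᵥ (A *ᵥ S.φ k ω) := quad_nonneg hA.posSemidef _
  have hinv : A⁻¹ * A = 1 := nonsing_inv_mul _ (A.isUnit_iff_isUnit_det.1 hA.isUnit)
  have h1 : vecMulVec (S.φ k ω) (S.φ k ω) * (A * vecMulVec (S.φ k ω) (S.φ k ω) * A) =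
      (S.φ k ω ⬝ᵥ (A *ᵥ S.φ k ω)) • (vecMulVec (S.φ k ω) (S.φ k ω) * A) := by
    rw [← Matrix.mul_assoc, mul_vecMulVec, vecMulVec_mul_vecMulVec, vecMulVec_smul, smul_mul_assoc]
  unfold nextP gain
  rw [mul_sub, add_mul, add_mul, hinv, mul_smul_comm, mul_smul_comm, smul_mul_assoc,
    smul_mul_assoc, h1, ← Matrix.mul_assoc A⁻¹, ← Matrix.mul_assoc A⁻¹, hinv, Matrix.one_mul]
  set p := S.φ k ω ⬝ᵥ (A *ᵥ S.φ k ω)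
  have hden : 0 < m + β * S.b k ω ^ 2 * p := by positivity
  set Z := vecMulVec (S.φ k ω) (S.φ k ω) * A
  have hden' := hden.ne'
  have h2 : β * S.b k ω ^ 2 / m = 1 / (m + β * S.b k ω ^ 2 * p) * β * S.b k ω ^ 2 +
      1 / (m + β * S.b k ω ^ 2 * p) * β * S.b k ω ^ 2 * (β * S.b k ω ^ 2 / m * p) := by
    field_simp
  rw [smul_smul, smul_smul]
  nth_rewrite 1 [h2]
  rw [add_smul]
  module

theorem inv_nextP (hm : 0 < m) (hβ : 0 ≤ β) (hA : A.PosDef) :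
    (S.nextP k ω m β A)⁻¹ =
      A⁻¹ + (β * S.b k ω ^ 2 / m) • vecMulVec (S.φ k ω) (S.φ k ω) :=
  inv_eq_left_inv (S.inv_add_mul_nextP hm hβ hA)

theorem posDef_nextP (hm : 0 < m) (hβ : 0 ≤ β) (hA : A.PosDef) :
    (S.nextP k ω m β A).PosDef := by
  have h1 : S.nextP k ω m β A =
      (A⁻¹ + (β * S.b k ω ^ 2 / m) • vecMulVec (S.φ k ω) (S.φ k ω))⁻¹ :=
    (inv_eq_right_inv (S.inv_add_mul_nextP hm hβ hA)).symm
  rw [h1]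
  exact (posDef_inv_add hA (by positivity) _).inv

/-- Rewrites the correction through the updated matrix, so that in the updated norm its cross term
collapses to `φ_kᵀ (θ - t)`. -/
theorem gain_smul_mulVec (hm : 0 < m) (hβ : 0 ≤ β) (hA : A.PosDef) :
    S.gain k ω m β A • (A *ᵥ S.φ k ω) = (1 / m) • (S.nextP k ω m β A *ᵥ S.φ k ω) := by
  have hp : 0 ≤ S.φ k ω ⬝ᵥ (A *ᵥ S.φ k ω) := quad_nonneg hA.posSemidef _
  unfold nextP gain
  set p := S.φ k ω ⬝ᵥ (A *ᵥ S.φ k ω) with hpdef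
  have hden : 0 < m + β * S.b k ω ^ 2 * p := by positivity
  have h1 : (A * vecMulVec (S.φ k ω) (S.φ k ω) * A) *ᵥ S.φ k ω = p • (A *ᵥ S.φ k ω) := by
    rw [← mulVec_mulVec, mul_vecMulVec, vecMulVec_mulVec, ← hpdef]
    simp
  rw [sub_mulVec, smul_mulVec, h1, smul_smul, smul_sub, smul_smul, ← sub_smul]
  congr 1
  field_simp
  ring

theorem inv_nextP_mulVec (hm : 0 < m) (hβ : 0 ≤ β) (hA : A.PosDef) :
    (S.nextP k ω m β A)⁻¹ *ᵥ (S.nextP k ω m β A *ᵥ S.φ k ω) = S.φ k ω := by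
  have h := S.posDef_nextP (k := k) (ω := ω) hm hβ hA
  rw [mulVec_mulVec, nonsing_inv_mul _ ((isUnit_iff_isUnit_det _).1 h.isUnit), one_mulVec]

/-- The quadratic form of the inverse grows by the weighted squared regression term. -/
theorem quad_inv_nextP (hm : 0 < m) (hβ : 0 ≤ β) (hA : A.PosDef) (u : Fin d → ℝ) :
    u ⬝ᵥ ((S.nextP k ω m β A)⁻¹ *ᵥ u) =
      u ⬝ᵥ (A⁻¹ *ᵥ u) + β * S.b k ω ^ 2 / m * (S.φ k ω ⬝ᵥ u) ^ 2 := by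
  rw [S.inv_nextP hm hβ hA, add_mulVec, dotProduct_add, smul_mulVec, dotProduct_smul,
    vecMulVec_mulVec, op_smul_eq_smul, dotProduct_smul, dotProduct_comm u (S.φ k ω), smul_eq_mul,
    smul_eq_mul, sq (S.φ k ω ⬝ᵥ u)]

/-- The Lyapunov inequality for one projected update. -/
theorem quad_sub_nextθ_le (hDc : Convex ℝ S.D) (hD : IsCompact S.D) (hθ : S.θ ∈ S.D)
    (hm : 0 < m) (hβ : 0 ≤ β) (hA : A.PosDef) (t : Fin d → ℝ) :
    (S.θ - S.nextθ k ω m β A t) ⬝ᵥ ((S.nextP k ω m β A)⁻¹ *ᵥ (S.θ - S.nextθ k ω m β A t)) ≤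
      (S.θ - t) ⬝ᵥ (A⁻¹ *ᵥ (S.θ - t)) + β * S.b k ω ^ 2 / m * (S.φ k ω ⬝ᵥ (S.θ - t)) ^ 2
      - 2 * (S.b k ω / m * S.innov k ω t) * (S.φ k ω ⬝ᵥ (S.θ - t))
      + (S.b k ω / m * S.innov k ω t) ^ 2 * (S.φ k ω ⬝ᵥ (S.nextP k ω m β A *ᵥ S.φ k ω)) := by
  have hP := S.posDef_nextP (k := k) (ω := ω) hm hβ hA
  unfold nextθ
  rw [mul_assoc (S.gain k ω m β A), mul_comm (S.gain k ω m β A), mul_smul,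
    S.gain_smul_mulVec hm hβ hA, smul_smul]
  set P' := S.nextP k ω m β A
  set v := S.innov k ω t
  have hproj := isProj_proj (Q := P'⁻¹) hD ⟨_, hθ⟩
    (t + (S.b k ω * v * (1 / m)) • (P' *ᵥ S.φ k ω))
  have h1 := hproj.quad_add_quad_le hP.inv hDc hθ
  set t' := t + (S.b k ω * v * (1 / m)) • (P' *ᵥ S.φ k ω)
  -- The squared distance moved by the projection is a gain and is discarded.
  have h2 := quad_nonneg hP.inv.posSemidef (t' - proj S.D P'⁻¹ t')
  have h3 : S.θ - t' = (S.θ - t) + (-(S.b k ω * v * (1 / m))) • (P' *ᵥ S.φ k ω) := by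
    simp only [t', neg_smul]; abel
  rw [h3, quad_add_smul hP.inv.isHermitian, S.inv_nextP_mulVec hm hβ hA,
    S.quad_inv_nextP hm hβ hA (S.θ - t), dotProduct_comm _ (S.φ k ω),
    dotProduct_comm _ (S.φ k ω)] at h1
  have h4 : S.b k ω / m * v = S.b k ω * v * (1 / m) := by ring
  rw [h4]
  linarith

end Setup

/-! ### Measurability of inverses, projections, distribution functions and infima -/

section Measurability

variable {Ω : Type*} [MeasurableSpace Ω] {d : ℕ}

theorem measurable_dotProduct {u v : Ω → Fin d → ℝ} (hu : Measurable u) (hv : Measurable v) :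
    Measurable fun ω => u ω ⬝ᵥ v ω := by
  unfold dotProduct
  exact Finset.measurable_sum _ fun i _ =>
    ((measurable_pi_apply i).comp hu).mul ((measurable_pi_apply i).comp hv)

theorem measurable_mulVec {A : Ω → Matrix (Fin d) (Fin d) ℝ} {v : Ω → Fin d → ℝ}
    (hA : ∀ i j, Measurable fun ω => A ω i j) (hv : Measurable v) :
    Measurable fun ω => A ω *ᵥ v ω :=
  measurable_pi_lambda _ fun i => measurable_dotProduct (measurable_pi_lambda _ (hA i)) hv

theorem measurable_matrix_mul {A B : Ω → Matrix (Fin d) (Fin d) ℝ}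
    (hA : ∀ i j, Measurable fun ω => A ω i j) (hB : ∀ i j, Measurable fun ω => B ω i j) (i j) :
    Measurable fun ω => (A ω * B ω) i j := by
  simp only [Matrix.mul_apply]
  exact Finset.measurable_sum _ fun l _ => (hA i l).mul (hB l j)

theorem measurable_det {A : Ω → Matrix (Fin d) (Fin d) ℝ}
    (hA : ∀ i j, Measurable fun ω => A ω i j) : Measurable fun ω => (A ω).det := by
  simp only [Matrix.det_apply']
  exact Finset.measurable_sum _ fun σ _ =>
    measurable_const.mul (Finset.measurable_prod _ fun i _ => hA _ _)

/-- Cofactor formula: the entries are determinants of measurable matrices times the inverse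
determinant. -/
theorem measurable_matrix_inv {A : Ω → Matrix (Fin d) (Fin d) ℝ}
    (hA : ∀ i j, Measurable fun ω => A ω i j) (i j) : Measurable fun ω => (A ω)⁻¹ i j := by
  simp only [Matrix.inv_def, Ring.inverse_eq_inv', Matrix.smul_apply, Matrix.adjugate_apply,
    smul_eq_mul]
  refine (measurable_det hA).inv.mul (measurable_det fun a b => ?_)
  by_cases h : a = j
  · subst h; simp
  · simpa [Matrix.updateRow_ne h] using hA a b

/-- Pairs of a positive definite matrix, given by its entries, and a point. -/
abbrev PosDefPoint (d : ℕ) : Type :=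
  {p : (Fin d → Fin d → ℝ) × (Fin d → ℝ) // (Matrix.of p.1).PosDef}

/-- The projection depends continuously on the positive definite matrix and the point. -/
theorem continuous_proj {D : Set (Fin d → ℝ)} (hDc : Convex ℝ D) (hD : IsCompact D)
    (hne : D.Nonempty) :
    Continuous fun p : PosDefPoint d => proj D (Matrix.of p.1.1) p.1.2 := by
  have : CompactSpace D := isCompact_iff_compactSpace.1 hD
  set f : PosDefPoint d → D := fun p => ⟨proj D (Matrix.of p.1.1) p.1.2, (isProj_proj hD hne _).1⟩
  have hgraph : IsClosed {q : PosDefPoint d × D | ∀ y ∈ D,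
      normQ (Matrix.of q.1.1.1) (q.1.1.2 - q.2.1) ≤ normQ (Matrix.of q.1.1.1) (q.1.1.2 - y)} := by
    have h1 : ∀ g : PosDefPoint d × D → Fin d → ℝ, Continuous g →
        Continuous fun q : PosDefPoint d × D => normQ (Matrix.of q.1.1.1) (g q) := by
      intro g hg
      unfold normQ
      refine Real.continuous_sqrt.comp (hg.dotProduct (Continuous.matrix_mulVec ?_ hg))
      change Continuous fun q : PosDefPoint d × D => (q.1.1.1 : Fin d → Fin d → ℝ)
      fun_prop
    simp only [Set.ofPred_forall]
    refine isClosed_iInter fun y => isClosed_iInter fun _ => isClosed_le (h1 _ ?_) (h1 _ ?_)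
    · fun_prop
    · fun_prop
  have hf : Continuous f := by
    -- Closed graph argument: `D` is compact, so projecting the closed graph along `D` is a closed
    -- map. Uniqueness of the minimizer identifies the image with the preimage of `K`.
    refine continuous_iff_isClosed.2 fun K hK => ?_
    have h2 := (isClosedMap_fst_of_compactSpace (X := PosDefPoint d) (Y := D)) _
      (hgraph.inter (hK.preimage continuous_snd))
    convert h2 using 1
    ext p
    simp only [Set.mem_preimage, Set.mem_image, Set.mem_inter_iff, Prod.exists]
    constructor
    · intro hp
      exact ⟨p, f p, ⟨(isProj_proj hD hne _).2, hp⟩, rfl⟩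
    · rintro ⟨p', y, ⟨hy, hyK⟩, rfl⟩
      have : y = f p' := Subtype.ext
        (IsProj.eq p'.2 hDc (isProj_proj hD hne _) ⟨y.2, hy⟩)
      rwa [← this]
  exact continuous_subtype_val.comp hf

theorem measurable_proj {D : Set (Fin d → ℝ)} (hDc : Convex ℝ D) (hD : IsCompact D)
    (hne : D.Nonempty) {A : Ω → Matrix (Fin d) (Fin d) ℝ} {x : Ω → Fin d → ℝ}
    (hA : ∀ i j, Measurable fun ω => A ω i j) (hpos : ∀ ω, (A ω).PosDef) (hx : Measurable x) :
    Measurable fun ω => proj D (A ω) (x ω) := by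
  have hof : ∀ ω, Matrix.of (fun i j => A ω i j) = A ω := fun _ => rfl
  have hpos' : ∀ ω, (Matrix.of (fun i j => A ω i j)).PosDef := fun ω => (hof ω).symm ▸ hpos ω
  have h0 : Measurable fun ω => ((fun i j => A ω i j : Fin d → Fin d → ℝ), x ω) :=
    (measurable_pi_lambda _ fun i => measurable_pi_lambda _ fun j => hA i j).prodMk hx
  have h1 : Measurable fun ω => (⟨(fun i j => A ω i j, x ω), hpos' ω⟩ : PosDefPoint d) :=
    h0.subtype_mk
  have h2 := (continuous_proj hDc hD hne).measurable.comp h1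
  simp only [Function.comp_def, hof] at h2
  exact h2

theorem measurable_uncurry_density {f : Ω → ℝ → ℝ} (hf : ∀ x, Measurable fun ω => f ω x)
    (hc : ∀ ω, Continuous (f ω)) : Measurable fun p : Ω × ℝ => f p.1 p.2 := by
  have := measurable_uncurry_of_continuous_of_measurable (u := fun x ω => f ω x) hc hf
  exact this.comp measurable_swap

theorem measurable_integral_Iic {f : Ω → ℝ → ℝ} (hf : Measurable fun p : Ω × ℝ => f p.1 p.2)
    {τ : Ω → ℝ} (hτ : Measurable τ) : Measurable fun ω => ∫ t in Set.Iic (τ ω), f ω t := by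
  have h1 : ∀ ω, ∫ t in Set.Iic (τ ω), f ω t = ∫ t, if t ≤ τ ω then f ω t else 0 := by
    intro ω
    rw [← integral_indicator measurableSet_Iic]
    rfl
  simp only [h1]
  have h2 : Measurable fun p : Ω × ℝ => if p.2 ≤ τ p.1 then f p.1 p.2 else 0 :=
    Measurable.ite (measurableSet_le measurable_snd (hτ.comp measurable_fst)) hf measurable_const
  exact (h2.stronglyMeasurable.integral_prod_right (ν := volume)).measurable

/-- The infimum of a nonnegative random continuous function over a random interval. -/
theorem measurable_sInf_image {f : Ω → ℝ → ℝ} (hf : ∀ x, Measurable fun ω => f ω x)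
    (hc : ∀ ω, Continuous (f ω)) (h0 : ∀ ω x, 0 ≤ f ω x) {r : Ω → ℝ} (hr : Measurable r) :
    Measurable fun ω => sInf (f ω '' {x | |x| ≤ r ω}) := by
  have hfm := measurable_uncurry_density hf hc
  refine measurable_of_Iio fun a => ?_
  -- By continuity, rational points clamped to `[-r, r]` suffice to detect an infimum below `a`. If
  -- `r < 0` the set is empty and the infimum is the default value `0`.
  have h1 : (fun ω => sInf (f ω '' {x | |x| ≤ r ω})) ⁻¹' Set.Iio a =
      ({ω | 0 ≤ r ω} ∩ ⋃ q : ℚ, {ω | f ω (max (-r ω) (min (r ω) q)) < a}) ∪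
        ({ω | r ω < 0} ∩ {_ω | 0 < a}) := by
    ext ω
    simp only [Set.mem_preimage, Set.mem_Iio, Set.mem_union, Set.mem_inter_iff, Set.mem_iUnion,
      Set.mem_ofPred_eq]
    rcases lt_or_ge (r ω) 0 with h | h
    · have : {x : ℝ | |x| ≤ r ω} = ∅ := by
        ext x
        simp only [Set.mem_ofPred_eq, Set.mem_empty_iff_false, iff_false, not_le]
        exact h.trans_le (abs_nonneg x)
      simp [this, h, not_le.2 h]
    · have hne : (f ω '' {x | |x| ≤ r ω}).Nonempty := ⟨_, 0, by simpa using h, rfl⟩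
      have hbd : BddBelow (f ω '' {x | |x| ≤ r ω}) :=
        ⟨0, by rintro _ ⟨x, _, rfl⟩; exact h0 ω x⟩
      rw [csInf_lt_iff hbd hne]
      simp only [h, not_lt.2 h, true_and, false_and, or_false]
      constructor
      · rintro ⟨_, ⟨x, hx, rfl⟩, hxa⟩
        have hopen : IsOpen {y : ℝ | f ω (max (-r ω) (min (r ω) y)) < a} :=
          isOpen_lt ((hc ω).comp (by fun_prop)) continuous_const
        have hx' := abs_le.1 (show |x| ≤ r ω from hx)
        have hxm : x ∈ {y : ℝ | f ω (max (-r ω) (min (r ω) y)) < a} := by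
          simp only [Set.mem_ofPred_eq]
          rwa [min_eq_right hx'.2, max_eq_right hx'.1]
        obtain ⟨q, hq⟩ := Rat.denseRange_cast.exists_mem_open hopen ⟨x, hxm⟩
        exact ⟨q, hq⟩
      · rintro ⟨q, hq⟩
        refine ⟨_, ⟨max (-r ω) (min (r ω) q), ?_, rfl⟩, hq⟩
        exact abs_le.2 ⟨le_max_left _ _, max_le (neg_le_self h) (min_le_left _ _)⟩
  rw [h1]
  refine MeasurableSet.union (MeasurableSet.inter (measurableSet_le measurable_const hr)
    (MeasurableSet.iUnion fun q => measurableSet_lt (hfm.comp (measurable_id.prodMk ?_))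
      measurable_const)) (MeasurableSet.inter (measurableSet_lt hr measurable_const)
      (measurableSet_lt measurable_const measurable_const))
  exact hr.neg.max (hr.min measurable_const)

end Measurability

/-! ### Measurability of the quantities in one update -/

namespace Setup

section

variable {Ω : Type*} {d : ℕ} (S : Setup Ω d)

/-- Measurability, with respect to the current information, of the data that enter one update. -/
structure MeasData [MeasurableSpace Ω] (k : ℕ) : Prop where
  φ : Measurable (S.φ k)
  l : Measurable (S.l k)
  u : Measurable (S.u k)
  L : Measurable (S.L k)
  U : Measurable (S.U k)
  b : Measurable (S.b k)
  C : Measurable (S.C k)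
  f : ∀ x, Measurable fun ω => S.f k ω x
  cont : ∀ ω, Continuous (S.f k ω)
  nonneg : ∀ ω x, 0 ≤ S.f k ω x

variable [MeasurableSpace Ω] {S} {k : ℕ}

theorem MeasData.satAt (h : S.MeasData k) {x : Ω → ℝ} (hx : Measurable x) :
    Measurable fun ω => S.satAt k ω (x ω) := by
  unfold Setup.satAt sat
  exact Measurable.ite (measurableSet_lt hx h.l) h.L
    (Measurable.ite (measurableSet_le hx h.u) hx h.U)

theorem MeasData.cdf (h : S.MeasData k) {x : Ω → ℝ} (hx : Measurable x) :
    Measurable fun ω => S.cdf k ω (x ω) :=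
  measurable_integral_Iic (measurable_uncurry_density h.f h.cont) hx

theorem MeasData.density (h : S.MeasData k) {x : Ω → ℝ} (hx : Measurable x) :
    Measurable fun ω => S.f k ω (x ω) :=
  (measurable_uncurry_density h.f h.cont).comp (measurable_id.prodMk hx)

theorem MeasData.betaBar (h : S.MeasData k) : Measurable (S.betaBar k) :=
  measurable_sInf_image h.f h.cont h.nonneg
    ((h.C.const_mul 2).max ((h.C.add h.l).max (h.C.sub h.u)))

theorem MeasData.beta (h : S.MeasData k) {tb t : Ω → Fin d → ℝ} (htb : Measurable tb)
    (ht : Measurable t) : Measurable fun ω => S.beta k ω (tb ω) (t ω) := by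
  have hz := measurable_dotProduct h.φ ht
  have hzb := measurable_dotProduct h.φ htb
  have hδ := measurable_dotProduct h.φ (htb.sub ht)
  have hs := h.satAt hz
  have hδs : MeasurableSet {ω | S.φ k ω ⬝ᵥ (tb ω - t ω) ≠ 0} :=
    (measurableSet_eq_fun hδ measurable_const).compl
  unfold Setup.beta
  refine Measurable.ite (measurableSet_eq_fun hs h.L) ?_
    (Measurable.ite (measurableSet_eq_fun hs h.U) ?_ ?_)
  · exact Measurable.ite hδs (((h.cdf (h.l.sub hz)).sub (h.cdf (h.l.sub hzb))).div hδ)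
      (h.density (h.l.sub hz))
  · exact Measurable.ite hδs (((h.cdf (h.u.sub hz)).sub (h.cdf (h.u.sub hzb))).div hδ)
      (h.density (h.u.sub hz))
  · exact Measurable.ite hδs ((measurable_const.sub ((h.cdf (hz.sub hzb)).const_mul 2)).div hδ)
      ((h.f 0).const_mul 2)

theorem MeasData.innov (h : S.MeasData k) (hy : Measurable (S.obs k)) {t : Ω → Fin d → ℝ}
    (ht : Measurable t) : Measurable fun ω => S.innov k ω (t ω) := by
  have hz := measurable_dotProduct h.φ ht
  have hs := h.satAt hz
  have hsign : Measurable Real.sign := by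
    unfold Real.sign
    exact Measurable.ite measurableSet_Iio measurable_const
      (Measurable.ite measurableSet_Ioi measurable_const measurable_const)
  unfold Setup.innov
  exact ((hsign.comp (hy.sub hs)).add (Measurable.ite (measurableSet_eq_fun hs h.U)
    (h.cdf (h.u.sub hz)) measurable_const)).sub (Measurable.ite (measurableSet_eq_fun hs h.L)
    (measurable_const.sub (h.cdf (h.l.sub hz))) measurable_const)

variable {m β : Ω → ℝ} {A : Ω → Matrix (Fin d) (Fin d) ℝ}

theorem MeasData.gain (h : S.MeasData k) (hm : Measurable m) (hβ : Measurable β)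
    (hA : ∀ i j, Measurable fun ω => A ω i j) :
    Measurable fun ω => S.gain k ω (m ω) (β ω) (A ω) := by
  unfold Setup.gain
  exact measurable_const.div (hm.add ((hβ.mul (h.b.pow_const 2)).mul
    (measurable_dotProduct h.φ (measurable_mulVec hA h.φ))))

theorem MeasData.nextP (h : S.MeasData k) (hm : Measurable m) (hβ : Measurable β)
    (hA : ∀ i j, Measurable fun ω => A ω i j) (i j) :
    Measurable fun ω => S.nextP k ω (m ω) (β ω) (A ω) i j := by
  unfold Setup.nextP
  simp only [Matrix.sub_apply, Matrix.smul_apply, smul_eq_mul]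
  refine (hA i j).sub ((((h.gain hm hβ hA).mul hβ).mul (h.b.pow_const 2)).mul
    (measurable_matrix_mul (measurable_matrix_mul hA fun i j => ?_) hA i j))
  simp only [vecMulVec_apply]
  exact ((measurable_pi_apply i).comp h.φ).mul ((measurable_pi_apply j).comp h.φ)

theorem MeasData.nextθ (h : S.MeasData k) (hy : Measurable (S.obs k)) (hDc : Convex ℝ S.D)
    (hD : IsCompact S.D) (hne : S.D.Nonempty) (hm : Measurable m) (hβ : Measurable β)
    (hA : ∀ i j, Measurable fun ω => A ω i j) (hm0 : ∀ ω, 0 < m ω) (hβ0 : ∀ ω, 0 ≤ β ω)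
    (hApos : ∀ ω, (A ω).PosDef) {t : Ω → Fin d → ℝ} (ht : Measurable t) :
    Measurable fun ω => S.nextθ k ω (m ω) (β ω) (A ω) (t ω) := by
  unfold Setup.nextθ
  refine measurable_proj hDc hD hne (measurable_matrix_inv (h.nextP hm hβ hA))
    (fun ω => (S.posDef_nextP (hm0 ω) (hβ0 ω) (hApos ω)).inv) (ht.add ?_)
  exact (((h.gain hm hβ hA).mul h.b).mul (h.innov hy ht)).smul (measurable_mulVec hA h.φ)

end

end Setup

/-! ### Conditional law of the noise at random thresholds -/

section Disintegration

variable {Ω Ω' : Type*} [MeasurableSpace Ω] [MeasurableSpace Ω'] {P : Measure Ω}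
  [IsProbabilityMeasure P] {X : Ω → Ω'} {Y : Ω → ℝ} {f : Ω' → ℝ → ℝ}

/-- The kernel with the given Lebesgue densities. -/
noncomputable def densityKernel (f : Ω' → ℝ → ℝ) : Kernel Ω' ℝ :=
  Kernel.withDensity (Kernel.const Ω' volume) fun x y => ENNReal.ofReal (f x y)

theorem densityKernel_apply (hf : Measurable fun p : Ω' × ℝ => f p.1 p.2) (x : Ω') (s : Set ℝ) :
    densityKernel f x s = ∫⁻ y in s, ENNReal.ofReal (f x y) := by
  unfold densityKernel
  rw [Kernel.withDensity_apply' _ hf.ennreal_ofReal, Kernel.const_apply]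

theorem densityKernel_real_Iic (hf : Measurable fun p : Ω' × ℝ => f p.1 p.2)
    (h0 : ∀ x y, 0 ≤ f x y) (hi : ∀ x, Integrable (f x)) (x : Ω') (a : ℝ) :
    (densityKernel f x).real (Set.Iic a) = ∫ y in Set.Iic a, f x y := by
  rw [Measure.real, densityKernel_apply hf, ← ofReal_integral_eq_lintegral_ofReal
    (hi x).integrableOn (ae_of_all _ (h0 x)), ENNReal.toReal_ofReal]
  exact integral_nonneg (h0 x)

theorem isMarkovKernel_densityKernel (hf : Measurable fun p : Ω' × ℝ => f p.1 p.2)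
    (h0 : ∀ x y, 0 ≤ f x y) (hi : ∀ x, Integrable (f x)) (h1 : ∀ x, ∫ y, f x y = 1) :
    IsMarkovKernel (densityKernel f) := by
  refine ⟨fun x => ⟨?_⟩⟩
  rw [densityKernel_apply hf, Measure.restrict_univ, ← ofReal_integral_eq_lintegral_ofReal
    (hi x) (ae_of_all _ (h0 x)), h1, ENNReal.ofReal_one]

/-- The hypothesis `hlaw` treats fixed levels `a` only. For each `A` it identifies two finite
measures of the second coordinate on half-lines, hence everywhere; the joint law then allows levels
that depend on `X`. -/
theorem map_prodMk_eq_compProd (hX : Measurable X) (hY : Measurable Y)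
    (hf : Measurable fun p : Ω' × ℝ => f p.1 p.2)
    (h0 : ∀ x y, 0 ≤ f x y) (hi : ∀ x, Integrable (f x)) (h1 : ∀ x, ∫ y, f x y = 1)
    (hlaw : ∀ A, MeasurableSet A → ∀ a, P.real (X ⁻¹' A ∩ {ω | Y ω ≤ a}) =
      ∫ ω in X ⁻¹' A, (∫ y in Set.Iic a, f (X ω) y) ∂P) :
    P.map (fun ω => (X ω, Y ω)) = (P.map X) ⊗ₘ (densityKernel f) := by
  have hM := isMarkovKernel_densityKernel hf h0 hi h1
  have hPX : IsProbabilityMeasure (P.map X) := Measure.isProbabilityMeasure_map hX.aemeasurable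
  have hPXY : IsProbabilityMeasure (P.map fun ω => (X ω, Y ω)) :=
    Measure.isProbabilityMeasure_map (hX.prodMk hY).aemeasurable
  refine Measure.ext_prod fun {A} {B} hA hB => ?_
  have h2 : ((P.map fun ω => (X ω, Y ω)).restrict (A ×ˢ Set.univ)).map Prod.snd =
      (((P.map X) ⊗ₘ (densityKernel f)).restrict (A ×ˢ Set.univ)).map Prod.snd := by
    refine Measure.ext_of_Iic _ _ fun a => ?_
    rw [Measure.map_apply measurable_snd measurableSet_Iic,
      Measure.map_apply measurable_snd measurableSet_Iic,
      Measure.restrict_apply (measurable_snd measurableSet_Iic),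
      Measure.restrict_apply (measurable_snd measurableSet_Iic)]
    have h3 : Prod.snd ⁻¹' Set.Iic a ∩ A ×ˢ Set.univ = A ×ˢ Set.Iic a := by
      ext p; simp [and_comm]
    rw [h3, Measure.map_apply (hX.prodMk hY) (hA.prod measurableSet_Iic),
      Measure.compProd_apply_prod hA measurableSet_Iic]
    have h4 : (fun ω => (X ω, Y ω)) ⁻¹' A ×ˢ Set.Iic a = X ⁻¹' A ∩ {ω | Y ω ≤ a} := by
      ext ω; simp
    have h5 : ∀ x, densityKernel f x (Set.Iic a) =
        ENNReal.ofReal (∫ y in Set.Iic a, f x y) := by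
      intro x
      rw [← densityKernel_real_Iic hf h0 hi, ofReal_measureReal]
    have hFm : Measurable fun x => ∫ y in Set.Iic a, f x y :=
      measurable_integral_Iic hf measurable_const
    rw [h4, ← ofReal_measureReal, hlaw A hA a]
    simp only [h5]
    rw [setLIntegral_map hA hFm.ennreal_ofReal hX, ofReal_integral_eq_lintegral_ofReal]
    · refine Integrable.of_bound (C := 1) (hFm.comp hX).aestronglyMeasurable
        (ae_of_all _ fun ω => ?_)
      rw [← densityKernel_real_Iic hf h0 hi, Real.norm_of_nonneg measureReal_nonneg]
      exact measureReal_le_one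
    · exact ae_of_all _ fun ω => integral_nonneg (h0 _)
  have h3 : Prod.snd ⁻¹' B ∩ A ×ˢ Set.univ = A ×ˢ B := by
    ext p; simp [and_comm]
  have h4 := congrArg (fun μ => μ B) h2
  simp only [Measure.map_apply measurable_snd hB,
      Measure.restrict_apply (measurable_snd hB), h3] at h4
  exact h4

/-- The conditional law evaluated at a random threshold of the conditioning variable. -/
theorem integral_mul_indicator_le (hX : Measurable X) (hY : Measurable Y)
    (hf : Measurable fun p : Ω' × ℝ => f p.1 p.2)
    (h0 : ∀ x y, 0 ≤ f x y) (hi : ∀ x, Integrable (f x)) (h1 : ∀ x, ∫ y, f x y = 1)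
    (hlaw : ∀ A, MeasurableSet A → ∀ a, P.real (X ⁻¹' A ∩ {ω | Y ω ≤ a}) =
      ∫ ω in X ⁻¹' A, (∫ y in Set.Iic a, f (X ω) y) ∂P)
    {τ H : Ω' → ℝ} (hτ : Measurable τ) (hH : Measurable H) {B : ℝ} (hB : ∀ x, |H x| ≤ B) :
    ∫ ω, H (X ω) * (if Y ω ≤ τ (X ω) then 1 else 0) ∂P =
      ∫ ω, H (X ω) * (∫ y in Set.Iic (τ (X ω)), f (X ω) y) ∂P := by
  have hM := isMarkovKernel_densityKernel hf h0 hi h1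
  have hPX : IsProbabilityMeasure (P.map X) := Measure.isProbabilityMeasure_map hX.aemeasurable
  set g : Ω' × ℝ → ℝ := fun p => H p.1 * (if p.2 ≤ τ p.1 then 1 else 0)
  have hg : Measurable g := (hH.comp measurable_fst).mul (Measurable.ite
    (measurableSet_le measurable_snd (hτ.comp measurable_fst)) measurable_const measurable_const)
  have hgi : Integrable g ((P.map X) ⊗ₘ (densityKernel f)) := by
    refine Integrable.of_bound (C := B) hg.aestronglyMeasurable (ae_of_all _ fun p => ?_)
    simp only [g, Real.norm_eq_abs, abs_mul]
    refine (mul_le_of_le_one_right (abs_nonneg _) ?_).trans (hB p.1)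
    split_ifs <;> simp
  calc ∫ ω, H (X ω) * (if Y ω ≤ τ (X ω) then 1 else 0) ∂P
      = ∫ p, g p ∂(P.map fun ω => (X ω, Y ω)) :=
        (integral_map (hX.prodMk hY).aemeasurable hg.aestronglyMeasurable).symm
    _ = ∫ x, ∫ y, g (x, y) ∂(densityKernel f x) ∂(P.map X) := by
        rw [map_prodMk_eq_compProd hX hY hf h0 hi h1 hlaw, Measure.integral_compProd hgi]
    _ = ∫ x, H x * (∫ y in Set.Iic (τ x), f x y) ∂(P.map X) := by
        refine integral_congr_ae (ae_of_all _ fun x => ?_)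
        simp only [g]
        rw [integral_const_mul, ← densityKernel_real_Iic hf h0 hi,
          ← integral_indicator_one measurableSet_Iic]
        rfl
    _ = _ := integral_map hX.aemeasurable
        (hH.mul (measurable_integral_Iic hf hτ)).aestronglyMeasurable

/-- The conditional law has a Lebesgue density, so single points are null. This excludes the ties at
which the indicator form of the innovation fails. -/
theorem ae_ne_threshold (hX : Measurable X) (hY : Measurable Y)
    (hf : Measurable fun p : Ω' × ℝ => f p.1 p.2)
    (h0 : ∀ x y, 0 ≤ f x y) (hi : ∀ x, Integrable (f x)) (h1 : ∀ x, ∫ y, f x y = 1)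
    (hlaw : ∀ A, MeasurableSet A → ∀ a, P.real (X ⁻¹' A ∩ {ω | Y ω ≤ a}) =
      ∫ ω in X ⁻¹' A, (∫ y in Set.Iic a, f (X ω) y) ∂P)
    {τ : Ω' → ℝ} (hτ : Measurable τ) : ∀ᵐ ω ∂P, Y ω ≠ τ (X ω) := by
  have hM := isMarkovKernel_densityKernel hf h0 hi h1
  have hPX : IsProbabilityMeasure (P.map X) := Measure.isProbabilityMeasure_map hX.aemeasurable
  have hs : MeasurableSet {p : Ω' × ℝ | p.2 = τ p.1} :=
    measurableSet_eq_fun measurable_snd (hτ.comp measurable_fst)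
  have h2 : P.map (fun ω => (X ω, Y ω)) {p | p.2 = τ p.1} = 0 := by
    rw [map_prodMk_eq_compProd hX hY hf h0 hi h1 hlaw, Measure.compProd_apply hs]
    refine (lintegral_congr fun x => ?_).trans lintegral_zero
    rw [densityKernel_apply hf]
    refine setLIntegral_measure_zero _ _ ?_
    have : Prod.mk x ⁻¹' {p : Ω' × ℝ | p.2 = τ p.1} = {τ x} := by ext y; simp
    rw [this]
    simp
  rw [Measure.map_apply (hX.prodMk hY) hs] at h2
  exact measure_eq_zero_iff_ae_notMem.1 h2

end Disintegration

/-! ### Innovation, drift and adaptation gains -/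

namespace Setup

noncomputable section

variable {Ω : Type*} {d : ℕ} (S : Setup Ω d) {k : ℕ} {ω : Ω}

/-- The observable level that decides the sign of the innovation at the predictor `z`. -/
def thr (k : ℕ) (ω : Ω) (z : ℝ) : ℝ :=
  if S.satAt k ω z = S.L k ω then S.l k ω else if S.satAt k ω z = S.U k ω then S.u k ω else z

/-- The size of the jump of the innovation at its threshold. -/
def jump (k : ℕ) (ω : Ω) (z : ℝ) : ℝ :=
  if S.satAt k ω z = S.L k ω then 1 else if S.satAt k ω z = S.U k ω then 1 else 2

/-- The conditional mean of the innovation at the predictor `z` when the true one is `z'`. -/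
def drift (k : ℕ) (ω : Ω) (z z' : ℝ) : ℝ :=
  S.jump k ω z * (S.cdf k ω (S.thr k ω z - z) - S.cdf k ω (S.thr k ω z - z'))

/-- The centred innovation at the estimate `t`. -/
def noise (k : ℕ) (ω : Ω) (t : Fin d → ℝ) : ℝ :=
  S.innov k ω t - S.drift k ω (S.φ k ω ⬝ᵥ t) (S.φ k ω ⬝ᵥ S.θ)

/-- The thresholds are ordered and not all equal. -/
def Ordered (k : ℕ) (ω : Ω) : Prop :=
  (S.L k ω ≤ S.l k ω ∧ S.l k ω ≤ S.u k ω ∧ S.u k ω ≤ S.U k ω) ∧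
    ¬ (S.L k ω = S.l k ω ∧ S.l k ω = S.u k ω ∧ S.u k ω = S.U k ω)

variable {S}

/-- Otherwise the ordering would squeeze all four thresholds together. As a consequence the lower
and upper saturated cases exclude each other. -/
theorem Ordered.lt (h : S.Ordered k ω) : S.L k ω < S.U k ω := by
  obtain ⟨⟨h1, h2, h3⟩, h4⟩ := h
  by_contra hle
  exact h4 ⟨by linarith, by linarith, by linarith⟩

/-- The case is slightly larger than `z < l`: when `L = l` it also contains `z = l`. -/
theorem Ordered.le_of_sat_eq_L (h : S.Ordered k ω) {z : ℝ} (hz : S.satAt k ω z = S.L k ω) :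
    z ≤ S.l k ω := by
  have hlt := h.lt
  obtain ⟨⟨h1, h2, h3⟩, -⟩ := h
  unfold satAt sat at hz
  split_ifs at hz with h5 h6 <;> linarith

theorem Ordered.le_of_sat_eq_U (h : S.Ordered k ω) {z : ℝ} (hz : S.satAt k ω z = S.U k ω) :
    S.u k ω ≤ z := by
  have hlt := h.lt
  obtain ⟨⟨h1, h2, h3⟩, -⟩ := h
  unfold satAt sat at hz
  split_ifs at hz with h5 h6 <;> linarith

theorem jump_nonneg (z : ℝ) : 0 ≤ S.jump k ω z := by
  unfold jump; split_ifs <;> norm_num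

theorem one_le_jump (z : ℝ) : 1 ≤ S.jump k ω z := by
  unfold jump; split_ifs <;> norm_num

theorem jump_le_two (z : ℝ) : S.jump k ω z ≤ 2 := by
  unfold jump; split_ifs <;> norm_num

/-- The gain is the secant slope of the drift in its second argument, between the two predictors,
with the derivative as its value when they coincide. The median condition puts the unsaturated case
into this common form. -/
theorem beta_eq (hmed : S.cdf k ω 0 = 1 / 2) (tb t : Fin d → ℝ) :
    S.beta k ω tb t = if S.φ k ω ⬝ᵥ tb - S.φ k ω ⬝ᵥ t ≠ 0 then
      S.drift k ω (S.φ k ω ⬝ᵥ t) (S.φ k ω ⬝ᵥ tb) / (S.φ k ω ⬝ᵥ tb - S.φ k ω ⬝ᵥ t)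
      else S.jump k ω (S.φ k ω ⬝ᵥ t) *
        S.f k ω (S.thr k ω (S.φ k ω ⬝ᵥ t) - S.φ k ω ⬝ᵥ t) := by
  unfold beta drift jump thr
  simp only [dotProduct_sub]
  split_ifs
  all_goals try simp
  simp only [hmed]
  ring_nf

/-- The innovation at `t` is, off a null event, a centred threshold indicator of the noise. -/
theorem innov_eq (h : S.Ordered k ω) (hmed : S.cdf k ω 0 = 1 / 2) (t : Fin d → ℝ)
    (hne : S.ε (k + 1) ω ≠ S.thr k ω (S.φ k ω ⬝ᵥ t) - S.φ k ω ⬝ᵥ S.θ) :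
    S.innov k ω t = S.jump k ω (S.φ k ω ⬝ᵥ t) *
      (S.cdf k ω (S.thr k ω (S.φ k ω ⬝ᵥ t) - S.φ k ω ⬝ᵥ t) -
        if S.ε (k + 1) ω ≤ S.thr k ω (S.φ k ω ⬝ᵥ t) - S.φ k ω ⬝ᵥ S.θ then 1 else 0) := by
  have hLU := h.lt
  obtain ⟨⟨h1, h2, h3⟩, -⟩ := h
  unfold innov obs
  set z := S.φ k ω ⬝ᵥ t
  set z0 := S.φ k ω ⬝ᵥ S.θ
  set e := S.ε (k + 1) ω
  -- In each regime the sign takes two values off the tie, and the correction terms of `innov`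
  -- recentre it. At the tie itself the identity can fail: without saturation the sign is then `0`.
  by_cases hL : S.satAt k ω z = S.L k ω
  · have hthr : S.thr k ω z = S.l k ω := if_pos hL
    have hj : S.jump k ω z = 1 := if_pos hL
    rw [hthr] at hne ⊢
    rw [hj, if_pos hL, if_neg (by rw [hL]; exact hLU.ne), hL]
    rcases lt_or_gt_of_ne hne with hlt | hgt
    · rw [if_pos hlt.le]
      have hs : S.satAt k ω (z0 + e) = S.L k ω := by
        unfold satAt sat; rw [if_pos (by linarith)]
      rw [hs, sub_self, Real.sign_zero]
      ring
    · rw [if_neg (not_le.2 hgt)]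
      have hs : S.L k ω < S.satAt k ω (z0 + e) := by
        unfold satAt sat; split_ifs <;> linarith
      rw [Real.sign_of_pos (by linarith)]
      ring
  by_cases hU : S.satAt k ω z = S.U k ω
  · have hthr : S.thr k ω z = S.u k ω := by unfold thr; rw [if_neg hL, if_pos hU]
    have hj : S.jump k ω z = 1 := by unfold jump; rw [if_neg hL, if_pos hU]
    rw [hthr] at hne ⊢
    rw [hj, if_neg hL, if_pos hU, hU]
    rcases lt_or_gt_of_ne hne with hlt | hgt
    · rw [if_pos hlt.le]
      have hs : S.satAt k ω (z0 + e) < S.U k ω := by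
        unfold satAt sat; split_ifs <;> linarith
      rw [Real.sign_of_neg (by linarith)]
      ring
    · rw [if_neg (not_le.2 hgt)]
      have hs : S.satAt k ω (z0 + e) = S.U k ω := by
        unfold satAt sat; rw [if_neg (by linarith), if_neg (by linarith)]
      rw [hs, sub_self, Real.sign_zero]
      ring
  · have hthr : S.thr k ω z = z := by unfold thr; rw [if_neg hL, if_neg hU]
    have hj : S.jump k ω z = 2 := by unfold jump; rw [if_neg hL, if_neg hU]
    rw [hthr] at hne ⊢
    rw [hj, if_neg hL, if_neg hU, sub_self, hmed]
    have hlz : S.l k ω ≤ z := by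
      by_contra hcon
      exact hL (by unfold satAt sat; rw [if_pos (not_le.1 hcon)])
    have huz : z ≤ S.u k ω := by
      by_contra hcon
      exact hU (by unfold satAt sat; rw [if_neg (not_lt.2 hlz), if_neg hcon])
    have hsz : S.satAt k ω z = z := by
      unfold satAt sat; rw [if_neg (not_lt.2 hlz), if_pos huz]
    rw [hsz] at hL hU ⊢
    have hLz : S.L k ω < z := lt_of_le_of_ne (by linarith) (Ne.symm hL)
    have hzU : z < S.U k ω := lt_of_le_of_ne (by linarith) hU
    rcases lt_or_gt_of_ne hne with hlt | hgt
    · rw [if_pos hlt.le]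
      have hs : S.satAt k ω (z0 + e) < z := by
        unfold satAt sat; split_ifs <;> linarith
      rw [Real.sign_of_neg (by linarith)]
      norm_num
    · rw [if_neg (not_le.2 hgt)]
      have hs : z < S.satAt k ω (z0 + e) := by
        unfold satAt sat; split_ifs <;> linarith
      rw [Real.sign_of_pos (by linarith)]
      norm_num

section Cdf

theorem cdf_nonneg
    (h0 : ∀ x, 0 ≤ S.f k ω x) (x : ℝ) : 0 ≤ S.cdf k ω x := integral_nonneg h0

theorem cdf_le_one
    (h0 : ∀ x, 0 ≤ S.f k ω x) (hi : Integrable (S.f k ω)) (h1 : ∫ x, S.f k ω x = 1) (x : ℝ) :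
    S.cdf k ω x ≤ 1 := by
  rw [← h1]
  exact setIntegral_le_integral hi (ae_of_all _ h0)

theorem cdf_sub_cdf
    (hi : Integrable (S.f k ω)) {a b : ℝ} : S.cdf k ω b - S.cdf k ω a = ∫ x in a..b, S.f k ω x :=
  (intervalIntegral.integral_Iic_sub_Iic hi.integrableOn hi.integrableOn)

theorem le_cdf_sub_cdf
    (hi : Integrable (S.f k ω)) {a b c r : ℝ} (hab : a ≤ b) (hc : ∀ x, |x| ≤ r → c ≤ S.f k ω x)
    (ha : |a| ≤ r) (hb : |b| ≤ r) : c * (b - a) ≤ S.cdf k ω b - S.cdf k ω a := by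
  rw [cdf_sub_cdf hi]
  have := intervalIntegral.integral_mono_on hab (intervalIntegrable_const (c := c))
    hi.intervalIntegrable (fun x hx => hc x (abs_le.2 ⟨(neg_le_of_abs_le ha).trans hx.1,
      hx.2.trans (le_of_abs_le hb)⟩))
  simpa [mul_comm] using this

theorem cdf_sub_cdf_le
    (hi : Integrable (S.f k ω)) {a b K r : ℝ} (hab : a ≤ b) (hK : ∀ x, |x| ≤ r → S.f k ω x ≤ K)
    (ha : |a| ≤ r) (hb : |b| ≤ r) : S.cdf k ω b - S.cdf k ω a ≤ K * (b - a) := by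
  rw [cdf_sub_cdf hi]
  have := intervalIntegral.integral_mono_on hab hi.intervalIntegrable
    (intervalIntegrable_const (c := K)) (fun x hx => hK x (abs_le.2
      ⟨(neg_le_of_abs_le ha).trans hx.1, hx.2.trans (le_of_abs_le hb)⟩))
  simpa [mul_comm] using this

/-- The half-length of the interval on which the noise density matters. -/
def radius (S : Setup Ω d) (k : ℕ) (ω : Ω) : ℝ :=
  max (2 * S.C k ω) (max (S.C k ω + S.l k ω) (S.C k ω - S.u k ω))

theorem Ordered.abs_thr_sub_le (h : S.Ordered k ω) {z z' : ℝ} (hz : |z| ≤ S.C k ω)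
    (hz' : |z'| ≤ S.C k ω) : |S.thr k ω z - z'| ≤ S.radius k ω := by
  rw [abs_le] at hz hz'
  have m1 : 2 * S.C k ω ≤ S.radius k ω := le_max_left _ _
  have m2 : S.C k ω + S.l k ω ≤ S.radius k ω := (le_max_left _ _).trans (le_max_right _ _)
  have m3 : S.C k ω - S.u k ω ≤ S.radius k ω := (le_max_right _ _).trans (le_max_right _ _)
  unfold thr
  split_ifs with h1 h2
  · have := h.le_of_sat_eq_L h1
    rw [abs_le]; constructor <;> linarith
  · have := h.le_of_sat_eq_U h2
    rw [abs_le]; constructor <;> linarith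
  · rw [abs_le]; constructor <;> linarith

/-- The conditional mean of the innovation has slope at least the lower bound of the density. -/
theorem mul_sq_le_drift_mul
    (hi : Integrable (S.f k ω)) (h : S.Ordered k ω) {c : ℝ} (hc0 : 0 ≤ c)
    (hc : ∀ x, |x| ≤ S.radius k ω → c ≤ S.f k ω x) {z z' : ℝ} (hz : |z| ≤ S.C k ω)
    (hz' : |z'| ≤ S.C k ω) : c * (z' - z) ^ 2 ≤ S.drift k ω z z' * (z' - z) := by
  have a1 := h.abs_thr_sub_le hz hz
  have a2 := h.abs_thr_sub_le hz hz'
  have hj := one_le_jump (S := S) (k := k) (ω := ω) z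
  unfold drift
  set τ := S.thr k ω z
  rcases le_total z z' with hzz | hzz
  · have h1 := le_cdf_sub_cdf hi (by linarith : τ - z' ≤ τ - z) hc a2 a1
    have h2 : 0 ≤ c * (z' - z) := mul_nonneg hc0 (by linarith)
    have h3 : c * (z' - z) ≤
        S.jump k ω z * (S.cdf k ω (τ - z) - S.cdf k ω (τ - z')) := by nlinarith
    nlinarith
  · have h1 := le_cdf_sub_cdf hi (by linarith : τ - z ≤ τ - z') hc a1 a2
    have h2 : 0 ≤ c * (z - z') := mul_nonneg hc0 (by linarith)
    have h3 : c * (z - z') ≤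
        S.jump k ω z * (S.cdf k ω (τ - z') - S.cdf k ω (τ - z)) := by nlinarith
    nlinarith

/-- The conditional mean of the innovation is Lipschitz in the true predictor. -/
theorem abs_drift_sub_drift_le
    (h0 : ∀ x, 0 ≤ S.f k ω x) (hi : Integrable (S.f k ω)) (h : S.Ordered k ω) {K : ℝ}
    (hK : ∀ x, |x| ≤ S.radius k ω → S.f k ω x ≤ K) {z z' z'' : ℝ} (hz : |z| ≤ S.C k ω)
    (hz' : |z'| ≤ S.C k ω) (hz'' : |z''| ≤ S.C k ω) :
    |S.drift k ω z z' - S.drift k ω z z''| ≤ 2 * K * |z' - z''| := by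
  have a1 := h.abs_thr_sub_le hz hz'
  have a2 := h.abs_thr_sub_le hz hz''
  have hj := jump_le_two (S := S) (k := k) (ω := ω) z
  have hj' := jump_nonneg (S := S) (k := k) (ω := ω) z
  unfold drift
  set τ := S.thr k ω z
  have h1 : |S.cdf k ω (τ - z'') - S.cdf k ω (τ - z')| ≤ K * |z' - z''| := by
    rcases le_total z' z'' with hzz | hzz
    · have h1 := cdf_sub_cdf_le hi (by linarith : τ - z'' ≤ τ - z') hK a2 a1
      have h2 := le_cdf_sub_cdf hi (by linarith : τ - z'' ≤ τ - z') (fun x _ => h0 x) a2 a1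
      rw [abs_of_nonpos (by linarith), abs_of_nonpos (by linarith)]
      linarith
    · have h1 := cdf_sub_cdf_le hi (by linarith : τ - z' ≤ τ - z'') hK a1 a2
      have h2 := le_cdf_sub_cdf hi (by linarith : τ - z' ≤ τ - z'') (fun x _ => h0 x) a1 a2
      rw [abs_of_nonneg (by linarith), abs_of_nonneg (by linarith)]
      linarith
  rw [← mul_sub, show S.cdf k ω (τ - z) - S.cdf k ω (τ - z') -
    (S.cdf k ω (τ - z) - S.cdf k ω (τ - z'')) = S.cdf k ω (τ - z'') - S.cdf k ω (τ - z') by ring,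
    abs_mul, abs_of_nonneg hj', mul_assoc]
  exact mul_le_mul hj h1 (abs_nonneg _) (by norm_num)

theorem drift_self (z : ℝ) : S.drift k ω z z = 0 := by simp [drift]

/-- The secant property in a form that needs no case split, since the drift vanishes at equal
predictors. -/
theorem beta_mul_sub (hmed : S.cdf k ω 0 = 1 / 2) (tb t : Fin d → ℝ) :
    S.beta k ω tb t * (S.φ k ω ⬝ᵥ tb - S.φ k ω ⬝ᵥ t) =
      S.drift k ω (S.φ k ω ⬝ᵥ t) (S.φ k ω ⬝ᵥ tb) := by
  rw [beta_eq hmed]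
  split_ifs with h
  · field_simp
  · rw [not_not] at h
    rw [h, sub_eq_zero.1 h, drift_self, mul_zero]

/-- Only monotonicity of the distribution function enters, so this holds at every `ω` and not just
where the density bounds hold. It keeps the matrices positive definite everywhere, as the
measurability of the projection requires. -/
theorem beta_nonneg
    (h0 : ∀ x, 0 ≤ S.f k ω x) (hi : Integrable (S.f k ω)) (hmed : S.cdf k ω 0 = 1 / 2)
    (tb t : Fin d → ℝ) : 0 ≤ S.beta k ω tb t := by
  rw [beta_eq hmed]
  have hj := jump_nonneg (S := S) (k := k) (ω := ω) (S.φ k ω ⬝ᵥ t)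
  split_ifs with h
  · unfold drift
    set z := S.φ k ω ⬝ᵥ t
    set zb := S.φ k ω ⬝ᵥ tb
    set τ := S.thr k ω z
    have hmono : ∀ a b, a ≤ b → 0 ≤ S.cdf k ω b - S.cdf k ω a := by
      intro a b hab
      rw [cdf_sub_cdf hi]
      exact intervalIntegral.integral_nonneg hab fun x _ => h0 x
    rcases le_total z zb with hzz | hzz
    · exact div_nonneg (mul_nonneg hj (hmono _ _ (by linarith))) (by linarith)
    · refine div_nonneg_of_nonpos (mul_nonpos_of_nonneg_of_nonpos hj ?_) (by linarith)
      have := hmono (τ - z) (τ - zb) (by linarith)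
      linarith
  · exact mul_nonneg hj (h0 _)

theorem beta_mem_Icc
    (h0 : ∀ x, 0 ≤ S.f k ω x) (hi : Integrable (S.f k ω)) (h : S.Ordered k ω)
    (hmed : S.cdf k ω 0 = 1 / 2) {c K : ℝ} (hc0 : 0 ≤ c)
    (hc : ∀ x, |x| ≤ S.radius k ω → c ≤ S.f k ω x)
    (hK : ∀ x, |x| ≤ S.radius k ω → S.f k ω x ≤ K) {tb t : Fin d → ℝ}
    (htb : |S.φ k ω ⬝ᵥ tb| ≤ S.C k ω) (ht : |S.φ k ω ⬝ᵥ t| ≤ S.C k ω) :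
    c ≤ S.beta k ω tb t ∧ S.beta k ω tb t ≤ 2 * K := by
  have hb := beta_mul_sub hmed tb t
  by_cases hδ : S.φ k ω ⬝ᵥ tb - S.φ k ω ⬝ᵥ t = 0
  · rw [beta_eq hmed, if_neg (not_not.2 hδ)]
    have a1 := h.abs_thr_sub_le ht ht
    have hj := one_le_jump (S := S) (k := k) (ω := ω) (S.φ k ω ⬝ᵥ t)
    have hj' := jump_le_two (S := S) (k := k) (ω := ω) (S.φ k ω ⬝ᵥ t)
    have b1 := hc _ a1
    have b2 := hK _ a1
    constructor <;> nlinarith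
  · set δ := S.φ k ω ⬝ᵥ tb - S.φ k ω ⬝ᵥ t
    have h1 := mul_sq_le_drift_mul hi h hc0 hc ht htb
    have h2 := abs_drift_sub_drift_le h0 hi h hK ht htb ht
    rw [drift_self, sub_zero, ← hb, abs_mul, abs_of_nonneg (beta_nonneg h0 hi hmed tb t)] at h2
    rw [← hb] at h1
    have hpos : 0 < |δ| := abs_pos.2 hδ
    refine ⟨?_, le_of_mul_le_mul_right h2 hpos⟩
    have hpos2 : 0 < δ ^ 2 := by positivity
    refine le_of_mul_le_mul_right (h1.trans (le_of_eq ?_)) hpos2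
    ring

theorem betaBar_nonneg
    (h0 : ∀ x, 0 ≤ S.f k ω x) : 0 ≤ S.betaBar k ω := by
  unfold betaBar
  refine Real.sInf_nonneg ?_
  rintro _ ⟨x, _, rfl⟩
  exact h0 x

theorem betaBar_le
    (h0 : ∀ x, 0 ≤ S.f k ω x) {x : ℝ} (hx : |x| ≤ S.radius k ω) : S.betaBar k ω ≤ S.f k ω x :=
  csInf_le ⟨0, by rintro _ ⟨y, _, rfl⟩; exact h0 y⟩ ⟨x, hx, rfl⟩

theorem le_betaBar (hr : 0 ≤ S.radius k ω) {c : ℝ}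
    (hc : ∀ x, |x| ≤ S.radius k ω → c ≤ S.f k ω x) : c ≤ S.betaBar k ω := by
  refine le_csInf ⟨_, 0, show |(0 : ℝ)| ≤ S.radius k ω by rwa [abs_zero], rfl⟩ ?_
  rintro _ ⟨x, hx, rfl⟩
  exact hc x hx

/-- One unit for the sign and at most one for each correction term. -/
theorem abs_innov_le
    (h0 : ∀ x, 0 ≤ S.f k ω x) (hi : Integrable (S.f k ω)) (h1 : ∫ x, S.f k ω x = 1)
    (t : Fin d → ℝ) : |S.innov k ω t| ≤ 3 := by
  have c0 := cdf_nonneg (S := S) h0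
  have c1 := cdf_le_one (S := S) h0 hi h1
  have hs : ∀ x : ℝ, |Real.sign x| ≤ 1 := by
    intro x
    rcases Real.sign_apply_eq x with h | h | h <;> simp [h]
  unfold innov
  have := abs_le.1 (hs (S.obs k ω - S.satAt k ω (S.φ k ω ⬝ᵥ t)))
  have u0 := c0 (S.u k ω - S.φ k ω ⬝ᵥ t)
  have u1 := c1 (S.u k ω - S.φ k ω ⬝ᵥ t)
  have l0 := c0 (S.l k ω - S.φ k ω ⬝ᵥ t)
  have l1 := c1 (S.l k ω - S.φ k ω ⬝ᵥ t)
  rw [abs_le]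
  split_ifs <;> constructor <;> linarith

theorem abs_noise_le
    (h0 : ∀ x, 0 ≤ S.f k ω x) (hi : Integrable (S.f k ω)) (h1 : ∫ x, S.f k ω x = 1)
    (t : Fin d → ℝ) : |S.noise k ω t| ≤ 5 := by
  have c0 := cdf_nonneg (S := S) h0
  have c1 := cdf_le_one (S := S) h0 hi h1
  have hd : |S.drift k ω (S.φ k ω ⬝ᵥ t) (S.φ k ω ⬝ᵥ S.θ)| ≤ 2 := by
    unfold drift
    rw [abs_mul, abs_of_nonneg (jump_nonneg _)]
    calc _ ≤ (2 : ℝ) * 1 := by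
          gcongr
          · exact jump_le_two _
          · rw [abs_le]
            constructor <;> linarith [c0 (S.thr k ω (S.φ k ω ⬝ᵥ t) - S.φ k ω ⬝ᵥ t),
              c1 (S.thr k ω (S.φ k ω ⬝ᵥ t) - S.φ k ω ⬝ᵥ t),
              c0 (S.thr k ω (S.φ k ω ⬝ᵥ t) - S.φ k ω ⬝ᵥ S.θ),
              c1 (S.thr k ω (S.φ k ω ⬝ᵥ t) - S.φ k ω ⬝ᵥ S.θ)]
      _ = 2 := by norm_num
  have hv := abs_innov_le h0 hi h1 t
  unfold noise
  rw [abs_le] at *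
  constructor <;> linarith

end Cdf

section Meas

variable [MeasurableSpace Ω]

theorem MeasData.thr (h : S.MeasData k) {z : Ω → ℝ} (hz : Measurable z) :
    Measurable fun ω => S.thr k ω (z ω) := by
  have hs := h.satAt hz
  exact Measurable.ite (measurableSet_eq_fun hs h.L) h.l
    (Measurable.ite (measurableSet_eq_fun hs h.U) h.u hz)

theorem MeasData.jump (h : S.MeasData k) {z : Ω → ℝ} (hz : Measurable z) :
    Measurable fun ω => S.jump k ω (z ω) := by
  have hs := h.satAt hz
  exact Measurable.ite (measurableSet_eq_fun hs h.L) measurable_const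
    (Measurable.ite (measurableSet_eq_fun hs h.U) measurable_const measurable_const)

theorem MeasData.drift (h : S.MeasData k) {z z' : Ω → ℝ} (hz : Measurable z)
    (hz' : Measurable z') : Measurable fun ω => S.drift k ω (z ω) (z' ω) :=
  (h.jump hz).mul ((h.cdf ((h.thr hz).sub hz)).sub (h.cdf ((h.thr hz).sub hz')))

theorem MeasData.noise (h : S.MeasData k) (hy : Measurable (S.obs k)) {t : Ω → Fin d → ℝ}
    (ht : Measurable t) : Measurable fun ω => S.noise k ω (t ω) :=
  (h.innov hy ht).sub (h.drift (measurable_dotProduct h.φ ht)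
    (measurable_dotProduct h.φ measurable_const))

end Meas

end

end Setup

/-! ### Consequences of the dyadic noise bounds -/

section Dyadic

/-- The dyadic iterated-logarithm bound for the sums of `c j i * w i`. -/
def DyadicBound (c : ℕ → ℕ → ℝ) (w : ℕ → ℝ) (W : ℝ) : Prop :=
  ∀ᶠ j in atTop, ∀ n ≥ 2 ^ j, ∑ i ∈ Finset.Ico (2 ^ j) n, c j i * w i <
    W ^ 2 * ∑ i ∈ Finset.Ico (2 ^ j) n, c j i ^ 2 + 2 * Real.log j

/-- Scaling the weights by `1 / (N + 1)` shrinks the quadratic compensator relative to the sum, so a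
large `N` absorbs it into `c ∑ x²` and costs only a larger multiple of `log j`. Integer scales keep
the family of bounds countable although `c` may depend on the path. -/
theorem exists_sum_le_of_dyadicBound {x y w : ℕ → ℝ} {W R c : ℝ} (hc : 0 < c)
    (hy : ∀ i, y i ^ 2 ≤ R * x i ^ 2)
    (h : ∀ n : ℕ, DyadicBound (fun _ i => 1 / ((n : ℝ) + 1) * y i) w W) :
    ∃ C' : ℝ, ∃ j₀ : ℕ, ∀ j ≥ j₀, ∀ n ≥ 2 ^ j, ∑ i ∈ Finset.Ico (2 ^ j) n, y i * w i ≤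
      c * ∑ i ∈ Finset.Ico (2 ^ j) n, x i ^ 2 + C' * Real.log j := by
  obtain ⟨N, hN⟩ := exists_nat_gt (W ^ 2 * R / c)
  obtain ⟨j₀, hj₀⟩ := eventually_atTop.1 (h N)
  refine ⟨2 * (N + 1), j₀, fun j hj n hn => ?_⟩
  have h1 := hj₀ j hj n hn
  have hN1 : (0 : ℝ) < N + 1 := by positivity
  simp only [mul_assoc, mul_pow] at h1
  rw [← Finset.mul_sum, ← Finset.mul_sum] at h1
  have h2 : ∑ i ∈ Finset.Ico (2 ^ j) n, y i ^ 2 ≤ R * ∑ i ∈ Finset.Ico (2 ^ j) n, x i ^ 2 := by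
    rw [Finset.mul_sum]; exact Finset.sum_le_sum fun i _ => hy i
  set Y := ∑ i ∈ Finset.Ico (2 ^ j) n, y i * w i
  set X := ∑ i ∈ Finset.Ico (2 ^ j) n, x i ^ 2
  have hX : 0 ≤ X := Finset.sum_nonneg fun _ _ => sq_nonneg _
  set Y2 := ∑ i ∈ Finset.Ico (2 ^ j) n, y i ^ 2
  have h3 : W ^ 2 * R ≤ c * (N + 1) := by
    rw [div_lt_iff₀ hc] at hN; nlinarith
  have h4 : Y < W ^ 2 * Y2 / (N + 1) + 2 * (N + 1) * Real.log j := by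
    have := mul_lt_mul_of_pos_left h1 hN1
    have e1 : ((N : ℝ) + 1) * (1 / (N + 1) * Y) = Y := by field_simp
    have e2 : ((N : ℝ) + 1) * (W ^ 2 * ((1 / (N + 1)) ^ 2 * Y2) + 2 * Real.log j) =
      W ^ 2 * Y2 / (N + 1) + 2 * (N + 1) * Real.log j := by field_simp
    rwa [e1, e2] at this
  have h5 : W ^ 2 * Y2 / (N + 1) ≤ c * X := by
    rw [div_le_iff₀ hN1]
    calc W ^ 2 * Y2 ≤ W ^ 2 * (R * X) := by gcongr
      _ = (W ^ 2 * R) * X := by ring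
      _ ≤ (c * (N + 1)) * X := by gcongr
      _ = _ := by ring
  linarith

/-- On a block `∑ r²` is of order `2^(-j)`, so the weight `√(2^j log j)` makes the compensator of
the same order `log j` as the deviation level. Both signs are needed for the square. -/
theorem exists_sq_sum_le_of_dyadicBound {r w : ℕ → ℝ} {W C : ℝ} {k₀ : ℕ} (hC : 0 ≤ C)
    (hr : ∀ k ≥ k₀, |r k| ≤ C / k)
    (h : DyadicBound (fun j i => √(2 ^ j * Real.log j) * r i) w W)
    (h' : DyadicBound (fun j i => √(2 ^ j * Real.log j) * -r i) w W) (J : ℕ) :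
    ∃ C' : ℝ, 0 ≤ C' ∧ ∃ j₀ : ℕ, ∀ j ≥ j₀, ∀ n, 2 ^ j ≤ n → n ≤ 2 ^ (j + J) →
      (∑ i ∈ Finset.Ico (2 ^ j) n, w i * r i) ^ 2 ≤ C' * (Real.log j / 2 ^ j) := by
  obtain ⟨j₁, hj₁⟩ := eventually_atTop.1 (h.and h')
  set B := W ^ 2 * (C ^ 2 * 2 ^ J) + 2
  refine ⟨B ^ 2, sq_nonneg _, max j₁ (max k₀ 2), fun j hj n hn hnJ => ?_⟩
  simp only [ge_iff_le, max_le_iff] at hj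
  obtain ⟨h1, h2⟩ := hj₁ j hj.1
  have h1 := h1 n hn
  have h2 := h2 n hn
  have hlog : 0 < Real.log j := Real.log_pos (by exact_mod_cast hj.2.2)
  set s := √(2 ^ j * Real.log j)
  have hs : s ^ 2 = 2 ^ j * Real.log j := Real.sq_sqrt (by positivity)
  simp only [mul_pow, neg_sq, mul_neg, neg_mul, Finset.sum_neg_distrib, mul_assoc] at h1 h2
  rw [← Finset.mul_sum, ← Finset.mul_sum, hs] at h1 h2
  have h3 : ∑ i ∈ Finset.Ico (2 ^ j) n, r i ^ 2 ≤ C ^ 2 * 2 ^ J / 2 ^ j := by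
    have h4 : ∀ i ∈ Finset.Ico (2 ^ j) n, r i ^ 2 ≤ (C / 2 ^ j) ^ 2 := by
      intro i hi
      have hi' := (Finset.mem_Ico.1 hi).1
      have hk : k₀ ≤ i := hj.2.1.trans (Nat.lt_two_pow_self.le.trans hi')
      have hij : (2 : ℝ) ^ j ≤ i := by exact_mod_cast hi'
      rw [← sq_abs (r i)]
      have := (hr i hk).trans (div_le_div_of_nonneg_left hC (by positivity) hij)
      gcongr
    refine (Finset.sum_le_sum h4).trans ?_
    rw [Finset.sum_const, nsmul_eq_mul, Nat.card_Ico]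
    have h7 : ((n - 2 ^ j : ℕ) : ℝ) ≤ 2 ^ j * 2 ^ J := by
      rw [← pow_add]; exact_mod_cast (Nat.sub_le _ _).trans hnJ
    calc ((n - 2 ^ j : ℕ) : ℝ) * (C / 2 ^ j) ^ 2 ≤ (2 ^ j * 2 ^ J) * (C / 2 ^ j) ^ 2 := by gcongr
      _ = _ := by field_simp
  have hcomm : ∑ i ∈ Finset.Ico (2 ^ j) n, r i * w i = ∑ i ∈ Finset.Ico (2 ^ j) n, w i * r i :=
    Finset.sum_congr rfl fun _ _ => mul_comm _ _
  rw [hcomm] at h1 h2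
  set Y := ∑ i ∈ Finset.Ico (2 ^ j) n, w i * r i
  set R2 := ∑ i ∈ Finset.Ico (2 ^ j) n, r i ^ 2
  have h5 : W ^ 2 * (2 ^ j * (Real.log j * R2)) + 2 * Real.log j ≤ B * Real.log j := by
    have : 2 ^ j * R2 ≤ C ^ 2 * 2 ^ J := by
      rw [le_div_iff₀ (by positivity)] at h3; linarith
    have h6 : W ^ 2 * (2 ^ j * (Real.log j * R2)) ≤ W ^ 2 * (C ^ 2 * 2 ^ J) * Real.log j := by
      calc W ^ 2 * (2 ^ j * (Real.log j * R2)) = W ^ 2 * (2 ^ j * R2) * Real.log j := by ring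
        _ ≤ _ := by gcongr
    simp only [B]; linarith
  have h7 : (s * Y) ^ 2 ≤ (B * Real.log j) ^ 2 := by
    refine sq_le_sq' ?_ ?_ <;> linarith
  rw [mul_pow, hs] at h7
  have h8 : 2 ^ j * Y ^ 2 ≤ B ^ 2 * Real.log j := by
    refine le_of_mul_le_mul_left ?_ hlog
    nlinarith
  rw [← mul_div_assoc, le_div_iff₀ (by positivity)]
  linarith

end Dyadic

/-! ### Euclidean norm, quadratic forms and the smallest eigenvalue -/

section Euclid

variable {d : ℕ}

theorem euclNorm_sq (u : Fin d → ℝ) : euclNorm u ^ 2 = u ⬝ᵥ u := by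
  unfold euclNorm
  rw [← real_inner_self_eq_norm_sq, EuclideanSpace.inner_toLp_toLp, star_trivial]

theorem inner_toLp (u v : Fin d → ℝ) : inner ℝ (WithLp.toLp 2 u) (WithLp.toLp 2 v) = u ⬝ᵥ v := by
  rw [EuclideanSpace.inner_toLp_toLp, star_trivial, dotProduct_comm]

theorem abs_dotProduct_le (u v : Fin d → ℝ) : |u ⬝ᵥ v| ≤ euclNorm u * euclNorm v := by
  rw [← inner_toLp]; exact abs_real_inner_le_norm _ _

theorem euclNorm_nonneg (u : Fin d → ℝ) : 0 ≤ euclNorm u := norm_nonneg _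

theorem euclNorm_smul (a : ℝ) (u : Fin d → ℝ) : euclNorm (a • u) = |a| * euclNorm u := by
  unfold euclNorm
  rw [WithLp.toLp_smul, norm_smul, Real.norm_eq_abs]

theorem abs_apply_le_euclNorm (u : Fin d → ℝ) (a : Fin d) : |u a| ≤ euclNorm u := by
  exact PiLp.norm_apply_le (WithLp.toLp 2 u) a

/-- Every quadratic form is bounded by a multiple of the squared norm. -/
theorem exists_quad_le (A : Matrix (Fin d) (Fin d) ℝ) :
    ∃ q : ℝ, 0 ≤ q ∧ ∀ u, u ⬝ᵥ (A *ᵥ u) ≤ q * euclNorm u ^ 2 := by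
  refine ⟨∑ i, ∑ j, |A i j|, Finset.sum_nonneg fun _ _ => Finset.sum_nonneg fun _ _ =>
    abs_nonneg _, fun u => ?_⟩
  simp only [dotProduct, mulVec, Finset.mul_sum, Finset.sum_mul]
  refine Finset.sum_le_sum fun i _ => Finset.sum_le_sum fun j _ => ?_
  have h1 := abs_apply_le_euclNorm u i
  have h2 := abs_apply_le_euclNorm u j
  have h3 := euclNorm_nonneg u
  calc u i * (A i j * u j) ≤ |u i * (A i j * u j)| := le_abs_self _
    _ = |A i j| * (|u i| * |u j|) := by rw [abs_mul, abs_mul]; ring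
    _ ≤ |A i j| * (euclNorm u * euclNorm u) := by gcongr
    _ = _ := by ring

/-- Subtracting `lambdaMin A` times the identity shifts the spectrum to nonnegative values. -/
theorem lambdaMin_mul_le {A : Matrix (Fin d) (Fin d) ℝ} (hA : A.IsHermitian)
    (u : Fin d → ℝ) : lambdaMin A * euclNorm u ^ 2 ≤ u ⬝ᵥ (A *ᵥ u) := by
  have hpos : (A - algebraMap ℝ _ (lambdaMin A)).PosSemidef := by
    rw [posSemidef_iff_isHermitian_and_spectrum_nonneg]
    refine ⟨hA.sub ?_, fun x hx => ?_⟩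
    · rw [Algebra.algebraMap_eq_smul_one]
      exact isHermitian_one.smul (IsSelfAdjoint.all _)
    · rw [← spectrum.sub_singleton_eq] at hx
      obtain ⟨y, hy, z, hz, rfl⟩ := hx
      rw [Set.mem_singleton_iff.1 hz]
      have hbdd : BddBelow (spectrum ℝ A) := by
        rw [hA.spectrum_real_eq_range_eigenvalues]
        exact (Set.finite_range _).bddBelow
      exact sub_nonneg.2 (csInf_le hbdd hy)
  have h := quad_nonneg hpos u
  rw [Algebra.algebraMap_eq_smul_one, sub_mulVec, dotProduct_sub, smul_mulVec, one_mulVec,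
    dotProduct_smul, smul_eq_mul, ← euclNorm_sq] at h
  linarith

theorem lambdaMin_nonneg {A : Matrix (Fin d) (Fin d) ℝ} (hA : A.PosSemidef) :
    0 ≤ lambdaMin A :=
  Real.sInf_nonneg fun _ hx => (posSemidef_iff_isHermitian_and_spectrum_nonneg.1 hA).2 hx

theorem quad_vecMulVec (u v : Fin d → ℝ) : u ⬝ᵥ (vecMulVec v v *ᵥ u) = (v ⬝ᵥ u) ^ 2 := by
  rw [vecMulVec_mulVec, op_smul_eq_smul, dotProduct_smul, dotProduct_comm u v, smul_eq_mul, sq]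

end Euclid

/-! ### Excitation from the eigenvalue condition -/

namespace Setup

variable {Ω : Type*} {d : ℕ} (S : Setup Ω d) {ω : Ω}

/-- Linear growth of the smallest eigenvalue makes the regressors exciting. -/
theorem exists_excitation (hP0 : (S.P0 ω).PosDef)
    (h : (fun k : ℕ => (k : ℝ)) =O[atTop] fun k : ℕ => lambdaMin (S.info k ω)) :
    ∃ c : ℝ, 0 < c ∧ ∃ k₀ : ℕ, ∀ k ≥ k₀, ∀ v : Fin d → ℝ,
      c * k * euclNorm v ^ 2 ≤ ∑ i ∈ Finset.range k, (S.φ i ω ⬝ᵥ v) ^ 2 := by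
  obtain ⟨K, hK, hO⟩ := h.exists_pos
  obtain ⟨k₁, hk₁⟩ := eventually_atTop.1 hO.bound
  obtain ⟨q, hq0, hq⟩ := exists_quad_le (S.P0 ω)⁻¹
  obtain ⟨N, hN⟩ := exists_nat_gt (2 + 2 * K * q)
  -- Half of the growth rate `1 / K` pays for the fixed contribution `q` of `P_0⁻¹` and for the
  -- index shift between `info n` and a sum of `n + 1` terms.
  refine ⟨1 / (2 * K), by positivity, max (k₁ + 1) N, fun k hk v => ?_⟩
  simp only [ge_iff_le, max_le_iff] at hk
  obtain ⟨n, rfl⟩ : ∃ n, k = n + 1 := ⟨k - 1, by omega⟩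
  have hinfo : (S.info n ω).PosSemidef := by
    refine hP0.inv.posSemidef.add (posSemidef_sum _ fun i _ => ?_)
    simpa using posSemidef_vecMulVec_self_star (S.φ i ω)
  have h1 := hk₁ n (by omega)
  rw [Real.norm_of_nonneg (Nat.cast_nonneg _), Real.norm_of_nonneg (lambdaMin_nonneg hinfo)] at h1
  have h2 := lambdaMin_mul_le hinfo.isHermitian v
  have h3 : v ⬝ᵥ (S.info n ω *ᵥ v) = v ⬝ᵥ ((S.P0 ω)⁻¹ *ᵥ v) +
      ∑ i ∈ Finset.range (n + 1), (S.φ i ω ⬝ᵥ v) ^ 2 := by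
    unfold info
    rw [add_mulVec, dotProduct_add, sum_mulVec, dotProduct_sum]
    simp only [quad_vecMulVec]
  rw [h3] at h2
  have h4 := hq v
  have hNk : (2 + 2 * K * q) < (n : ℝ) + 1 := by
    have : (N : ℝ) ≤ (n + 1 : ℕ) := by exact_mod_cast hk.2
    push_cast at this
    linarith
  have hv := sq_nonneg (euclNorm v)
  set G := ∑ i ∈ Finset.range (n + 1), (S.φ i ω ⬝ᵥ v) ^ 2
  set lam := lambdaMin (S.info n ω)
  have h5 : (n / K) * euclNorm v ^ 2 ≤ q * euclNorm v ^ 2 + G := by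
    have : n / K ≤ lam := by rw [div_le_iff₀ hK]; linarith
    nlinarith
  have h6 : 1 / (2 * K) * (n + 1) ≤ n / K - q := by
    rw [le_sub_iff_add_le, ← sub_nonneg]
    have : n / K - (1 / (2 * K) * (n + 1) + q) = (n - 1 - 2 * K * q) / (2 * K) := by
      field_simp; ring
    rw [this]
    apply div_nonneg <;> linarith
  push_cast
  nlinarith

end Setup

/-! ### Sample paths of one step of the algorithm -/

namespace Setup

variable {Ω : Type*} {d : ℕ}

/-- A sample path of one step of the algorithm, with its pathwise bounds. -/
structure Path (S : Setup Ω d) (ω : Ω) (t : ℕ → Fin d → ℝ) (A : ℕ → Matrix (Fin d) (Fin d) ℝ)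
    (m β : ℕ → ℝ) (c K : ℝ) : Prop where
  convex_D : Convex ℝ S.D
  compact_D : IsCompact S.D
  θ_mem : S.θ ∈ interior S.D
  posDef : ∀ k, (A k).PosDef
  next_t : ∀ k, t (k + 1) = S.nextθ k ω (m k) (β k) (A k) (t k)
  next_A : ∀ k, A (k + 1) = S.nextP k ω (m k) (β k) (A k)
  c_pos : 0 < c
  K_pos : 0 < K
  φ_le : ∀ k, euclNorm (S.φ k ω) ≤ K
  le_b : ∀ k, c ≤ S.b k ω
  b_le : ∀ k, S.b k ω ≤ 1
  le_m : ∀ k, c ≤ m k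
  m_le : ∀ k, m k ≤ K
  le_β : ∀ k, c ≤ β k
  β_le : ∀ k, β k ≤ K
  innov_le : ∀ k, |S.innov k ω (t k)| ≤ 3

namespace Path

variable {S : Setup Ω d} {ω : Ω} {t : ℕ → Fin d → ℝ} {A : ℕ → Matrix (Fin d) (Fin d) ℝ}
  {m β : ℕ → ℝ} {c K : ℝ}

theorem m_pos (h : S.Path ω t A m β c K) (k : ℕ) : 0 < m k := h.c_pos.trans_le (h.le_m k)

theorem β_pos (h : S.Path ω t A m β c K) (k : ℕ) : 0 < β k := h.c_pos.trans_le (h.le_β k)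

theorem b_pos (h : S.Path ω t A m β c K) (k : ℕ) : 0 < S.b k ω := h.c_pos.trans_le (h.le_b k)

theorem ratio_pos (h : S.Path ω t A m β c K) (k : ℕ) : 0 < S.b k ω / m k :=
  div_pos (h.b_pos k) (h.m_pos k)

theorem ratio_le (h : S.Path ω t A m β c K) (k : ℕ) : S.b k ω / m k ≤ 1 / c :=
  div_le_div₀ zero_le_one (h.b_le k) h.c_pos (h.le_m k)

theorem le_ratio (h : S.Path ω t A m β c K) (k : ℕ) : c / K ≤ S.b k ω / m k :=
  div_le_div₀ (h.b_pos k).le (h.le_b k) (h.m_pos k) (h.m_le k)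

theorem quad_eq (h : S.Path ω t A m β c K) (k : ℕ) (v : Fin d → ℝ) :
    v ⬝ᵥ ((A k)⁻¹ *ᵥ v) = v ⬝ᵥ ((A 0)⁻¹ *ᵥ v) +
    ∑ i ∈ Finset.range k, β i * S.b i ω ^ 2 / m i * (S.φ i ω ⬝ᵥ v) ^ 2 := by
  induction k with
  | zero => simp
  | succ k ih =>
    rw [h.next_A, S.quad_inv_nextP (h.m_pos k) (h.β_pos k).le (h.posDef k), ih,
      Finset.sum_range_succ]
    ring

theorem le_quad (h : S.Path ω t A m β c K) {c₁ : ℝ} {k₀ : ℕ} (hPE : ∀ k ≥ k₀, ∀ v : Fin d → ℝ,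
    c₁ * k * euclNorm v ^ 2 ≤ ∑ i ∈ Finset.range k, (S.φ i ω ⬝ᵥ v) ^ 2) (k : ℕ) (hk : k ≥ k₀)
    (v : Fin d → ℝ) : c ^ 3 / K * c₁ * k * euclNorm v ^ 2 ≤ v ⬝ᵥ ((A k)⁻¹ *ᵥ v) := by
  rw [h.quad_eq]
  have h1 := quad_nonneg (h.posDef 0).inv.posSemidef v
  have hc := h.c_pos
  have hK := h.K_pos
  have h2 : c ^ 3 / K * ∑ i ∈ Finset.range k, (S.φ i ω ⬝ᵥ v) ^ 2 ≤
      ∑ i ∈ Finset.range k, β i * S.b i ω ^ 2 / m i * (S.φ i ω ⬝ᵥ v) ^ 2 := by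
    rw [Finset.mul_sum]
    refine Finset.sum_le_sum fun i _ => mul_le_mul_of_nonneg_right ?_ (sq_nonneg _)
    have hb := h.b_pos i
    refine div_le_div₀ (mul_nonneg (h.β_pos i).le (sq_nonneg _)) ?_ (h.m_pos i) (h.m_le i)
    calc c ^ 3 = c * c ^ 2 := by ring
      _ ≤ _ := by
        have := h.le_β i
        have := h.le_b i
        have := h.c_pos.le
        have := (h.β_pos i).le
        gcongr
  have h3 := mul_le_mul_of_nonneg_left (hPE k hk v) (by positivity : 0 ≤ c ^ 3 / K)
  calc _ = c ^ 3 / K * (c₁ * k * euclNorm v ^ 2) := by ring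
    _ ≤ _ := by linarith

theorem exists_quad_le (h : S.Path ω t A m β c K) : ∃ C : ℝ, ∀ k ≥ 1, ∀ v : Fin d → ℝ,
    v ⬝ᵥ ((A k)⁻¹ *ᵥ v) ≤ C * k * euclNorm v ^ 2 := by
  obtain ⟨q, hq0, hq⟩ := TSWLAD.exists_quad_le (A 0)⁻¹
  have hc := h.c_pos
  have hK := h.K_pos
  refine ⟨q + K / c * K ^ 2, fun k hk v => ?_⟩
  rw [h.quad_eq]
  have hk1 : (1 : ℝ) ≤ k := by exact_mod_cast hk
  have hv := sq_nonneg (euclNorm v)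
  have h2 : ∑ i ∈ Finset.range k, β i * S.b i ω ^ 2 / m i * (S.φ i ω ⬝ᵥ v) ^ 2 ≤
      ∑ i ∈ Finset.range k, K / c * (K ^ 2 * euclNorm v ^ 2) := by
    refine Finset.sum_le_sum fun i _ => ?_
    have h3 : β i * S.b i ω ^ 2 / m i ≤ K / c := by
      refine div_le_div₀ hK.le ?_ hc (h.le_m i)
      have : S.b i ω ^ 2 ≤ 1 := pow_le_one₀ (h.b_pos i).le (h.b_le i)
      nlinarith [h.β_pos i, h.β_le i]
    have h4 : (S.φ i ω ⬝ᵥ v) ^ 2 ≤ K ^ 2 * euclNorm v ^ 2 := by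
      rw [← sq_abs, ← mul_pow]
      have := abs_dotProduct_le (S.φ i ω) v
      have h5 := mul_le_mul_of_nonneg_right (h.φ_le i) (euclNorm_nonneg v)
      have := this.trans h5
      gcongr
    gcongr
  rw [Finset.sum_const, Finset.card_range, nsmul_eq_mul] at h2
  have h5 := hq v
  have h6 : q * euclNorm v ^ 2 ≤ q * k * euclNorm v ^ 2 := by
    have : 0 ≤ q * euclNorm v ^ 2 := by positivity
    nlinarith
  calc _ ≤ q * k * euclNorm v ^ 2 + k * (K / c * (K ^ 2 * euclNorm v ^ 2)) := by linarith
    _ = _ := by ring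

/-- With `q = P_{k+1} φ_k` one has `P_{k+1}⁻¹ q = φ_k`, so coercivity tested at `q` itself gives `c₂
k ‖q‖² ≤ ‖φ_k‖ ‖q‖`. -/
theorem euclNorm_mulVec_le (h : S.Path ω t A m β c K) {c₂ : ℝ} (hc₂ : 0 < c₂) {k : ℕ} (hk : 1 ≤ k)
    (hlow : ∀ v : Fin d → ℝ,
      c₂ * (k + 1 : ℕ) * euclNorm v ^ 2 ≤ v ⬝ᵥ ((A (k + 1))⁻¹ *ᵥ v)) :
    euclNorm (A (k + 1) *ᵥ S.φ k ω) ≤ K / c₂ / k := by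
  set q := A (k + 1) *ᵥ S.φ k ω with hq
  have h1 := hlow q
  have h2 : (A (k + 1))⁻¹ *ᵥ q = S.φ k ω := by
    rw [hq, h.next_A, S.inv_nextP_mulVec (h.m_pos k) (h.β_pos k).le (h.posDef k)]
  rw [h2] at h1
  have h3 := (le_abs_self _).trans (abs_dotProduct_le q (S.φ k ω))
  have h4 := h.φ_le k
  have hq0 := euclNorm_nonneg q
  have hk0 : (0 : ℝ) < k := by exact_mod_cast hk
  have h5 : c₂ * k * euclNorm q ^ 2 ≤ K * euclNorm q := by
    push_cast at h1
    have : 0 ≤ c₂ * euclNorm q ^ 2 := by positivity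
    nlinarith
  rw [div_div, le_div_iff₀ (by positivity)]
  rcases hq0.eq_or_lt with h6 | h6
  · rw [← h6, zero_mul]; exact h.K_pos.le
  · refine le_of_mul_le_mul_right ?_ h6
    linarith

/-- The drift of the Lyapunov function along a sample path. -/
theorem lyapunov_step (h : S.Path ω t A m β c K) {e : ℕ → ℝ} {k : ℕ}
    (hdrift : β k * (S.φ k ω ⬝ᵥ (S.θ - t k)) ^ 2 - |e k| * |S.φ k ω ⬝ᵥ (S.θ - t k)| ≤
      S.drift k ω (S.φ k ω ⬝ᵥ t k) (S.φ k ω ⬝ᵥ S.θ) * (S.φ k ω ⬝ᵥ (S.θ - t k)))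
    {Q : ℝ} (hQ : euclNorm (A (k + 1) *ᵥ S.φ k ω) ≤ Q) :
    (S.θ - t (k + 1)) ⬝ᵥ ((A (k + 1))⁻¹ *ᵥ (S.θ - t (k + 1))) ≤
      (S.θ - t k) ⬝ᵥ ((A k)⁻¹ *ᵥ (S.θ - t k))
        - c ^ 2 / (2 * K) * (S.φ k ω ⬝ᵥ (S.θ - t k)) ^ 2
        + (-2 * (S.b k ω / m k) * (S.φ k ω ⬝ᵥ (S.θ - t k))) * S.noise k ω (t k)
        + (2 / c ^ 2 * e k ^ 2 + 9 / c ^ 2 * (K * Q)) := by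
  have h1 := S.quad_sub_nextθ_le (k := k) (ω := ω) h.convex_D h.compact_D
    (interior_subset h.θ_mem) (h.m_pos k) (h.β_pos k).le (h.posDef k) (t k)
  rw [← h.next_t, ← h.next_A] at h1
  have hc := h.c_pos
  have hK := h.K_pos
  have hv : S.innov k ω (t k) = S.drift k ω (S.φ k ω ⬝ᵥ t k) (S.φ k ω ⬝ᵥ S.θ) +
      S.noise k ω (t k) := by unfold noise; ring
  have hv3 := h.innov_le k
  set x := S.φ k ω ⬝ᵥ (S.θ - t k)
  set g := S.drift k ω (S.φ k ω ⬝ᵥ t k) (S.φ k ω ⬝ᵥ S.θ)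
  set w := S.noise k ω (t k)
  set v := S.innov k ω (t k)
  set q := A (k + 1) *ᵥ S.φ k ω
  set ρ := S.b k ω / m k with hρ
  have hρ0 : 0 < ρ := h.ratio_pos k
  have hρ1 : ρ ≤ 1 / c := h.ratio_le k
  have hρ2 : c / K ≤ ρ := h.le_ratio k
  -- Since `b ≤ 1`, the growth of the matrix costs at most `ρ β x²`, half of what the drift gives
  -- back.
  have e1 : β k * S.b k ω ^ 2 / m k * x ^ 2 ≤ ρ * (β k * x ^ 2) := by
    have : β k * S.b k ω ^ 2 / m k = ρ * β k * S.b k ω := by rw [hρ]; ring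
    rw [this]
    have h2 : 0 ≤ ρ * (β k * x ^ 2) := mul_nonneg hρ0.le (mul_nonneg (h.β_pos k).le (sq_nonneg _))
    calc _ = ρ * (β k * x ^ 2) * S.b k ω := by ring
      _ ≤ _ := mul_le_of_le_one_right h2 (h.b_le k)
  have e2 : (ρ * v) ^ 2 * (S.φ k ω ⬝ᵥ q) ≤ 9 / c ^ 2 * (K * Q) := by
    have h2 : S.φ k ω ⬝ᵥ q ≤ K * Q := (le_abs_self _).trans ((abs_dotProduct_le _ _).trans
      (mul_le_mul (h.φ_le k) hQ (euclNorm_nonneg _) hK.le))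
    have h3 : (ρ * v) ^ 2 ≤ 9 / c ^ 2 := by
      rw [← sq_abs, abs_mul, abs_of_pos hρ0]
      calc (ρ * |v|) ^ 2 ≤ (1 / c * 3) ^ 2 := by gcongr
        _ = 9 / c ^ 2 := by ring
    have hQ0 : 0 ≤ Q := (euclNorm_nonneg _).trans hQ
    calc (ρ * v) ^ 2 * (S.φ k ω ⬝ᵥ q) ≤ (ρ * v) ^ 2 * (K * Q) := by gcongr
      _ ≤ _ := by gcongr
  -- Young's inequality spends half of the remaining descent on the drift error.
  have e3 : 2 * (|e k| * |x|) ≤ β k / 2 * x ^ 2 + 2 / c * e k ^ 2 := by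
    have hβ := h.le_β k
    have h2 : 2 * (|e k| * |x|) ≤ c / 2 * x ^ 2 + 2 / c * e k ^ 2 := by
      have h4 : c / 2 * x ^ 2 + 2 / c * e k ^ 2 - 2 * (|e k| * |x|) =
          (c * |x| - 2 * |e k|) ^ 2 / (2 * c) := by
        rw [← sq_abs x, ← sq_abs (e k)]
        field_simp
        ring
      have : 0 ≤ (c * |x| - 2 * |e k|) ^ 2 / (2 * c) := by positivity
      linarith
    nlinarith [sq_nonneg x]
  have e4 : ρ * (β k * x ^ 2) - 2 * (ρ * v) * x ≤
      -(c ^ 2 / (2 * K) * x ^ 2) + (-2 * ρ * x) * w + 2 / c ^ 2 * e k ^ 2 := by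
    have h2 : β k * x ^ 2 - 2 * (g * x) ≤ -(c / 2 * x ^ 2) + 2 / c * e k ^ 2 := by
      have := h.le_β k
      nlinarith [sq_nonneg x]
    have h3 := mul_le_mul_of_nonneg_left h2 hρ0.le
    have h4 : ρ * (2 / c * e k ^ 2) ≤ 2 / c ^ 2 * e k ^ 2 := by
      calc ρ * (2 / c * e k ^ 2) ≤ 1 / c * (2 / c * e k ^ 2) := by gcongr
        _ = _ := by ring
    have h5 : c ^ 2 / (2 * K) * x ^ 2 ≤ ρ * (c / 2 * x ^ 2) := by
      calc c ^ 2 / (2 * K) * x ^ 2 = c / K * (c / 2 * x ^ 2) := by field_simp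
        _ ≤ _ := by gcongr
    rw [hv]
    linarith
  linarith

/-- While the unprojected update is feasible, the update is linear. -/
theorem eventually_linear (h : S.Path ω t A m β c K)
    (hlim : Tendsto (fun k => WithLp.toLp 2 (S.θ - t k)) atTop (nhds 0))
    {C : ℝ} {k₀ : ℕ} (hr : ∀ k ≥ k₀,
      euclNorm ((S.b k ω / m k) • (A (k + 1) *ᵥ S.φ k ω)) ≤ C / k) :
    ∀ᶠ k in atTop, S.θ - t (k + 1) =
      S.θ - t k - S.innov k ω (t k) • ((S.b k ω / m k) • (A (k + 1) *ᵥ S.φ k ω)) := by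
  set r : ℕ → Fin d → ℝ := fun k => (S.b k ω / m k) • (A (k + 1) *ᵥ S.φ k ω)
  have h1 : Tendsto (fun k => WithLp.toLp 2 (S.innov k ω (t k) • r k)) atTop (nhds 0) := by
    rw [tendsto_zero_iff_norm_tendsto_zero]
    have h2 : Tendsto (fun k : ℕ => 3 * (C / k)) atTop (nhds 0) := by
      simpa using (tendsto_const_div_atTop_nhds_zero_nat C).const_mul 3
    refine squeeze_zero' (Eventually.of_forall fun _ => norm_nonneg _) ?_ h2
    filter_upwards [eventually_ge_atTop k₀] with k hk
    change euclNorm (S.innov k ω (t k) • r k) ≤ _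
    rw [euclNorm_smul]
    exact mul_le_mul (h.innov_le k) (hr k hk) (euclNorm_nonneg _) (by norm_num)
  have h2 : Tendsto (fun k => S.θ - (S.θ - t k - S.innov k ω (t k) • r k)) atTop
      (nhds S.θ) := by
    have h3 := ((PiLp.continuous_ofLp 2 (fun _ : Fin d => ℝ)).tendsto 0).comp (hlim.sub h1 |>.trans
      (by simp))
    have h4 := (tendsto_const_nhds (x := S.θ)).sub h3
    simpa [Function.comp_def] using h4
  filter_upwards [h2.eventually (isOpen_interior.mem_nhds h.θ_mem)] with k hk
  -- The error and the step both tend to zero, so the unprojected point enters the interior of `D`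
  -- around `θ` and the projection acts as the identity.
  have hfeas : S.θ - (S.θ - t k - S.innov k ω (t k) • r k) ∈ S.D := interior_subset hk
  have h5 : t (k + 1) = S.θ - (S.θ - t k - S.innov k ω (t k) • r k) := by
    rw [h.next_t]
    unfold nextθ
    have h6 : t k + (S.gain k ω (m k) (β k) (A k) * S.b k ω * S.innov k ω (t k)) •
        (A k *ᵥ S.φ k ω) = S.θ - (S.θ - t k - S.innov k ω (t k) • r k) := by
      rw [mul_assoc (S.gain k ω (m k) (β k) (A k)), mul_comm (S.gain k ω (m k) (β k) (A k)),
        mul_smul, S.gain_smul_mulVec (h.m_pos k) (h.β_pos k).le (h.posDef k), ← h.next_A]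
      simp only [r, smul_smul]
      rw [show S.b k ω * S.innov k ω (t k) * (1 / m k) =
        S.innov k ω (t k) * (S.b k ω / m k) by ring]
      abel
    rw [h6]
    exact proj_eq_self (S.posDef_nextP (h.m_pos k) (h.β_pos k).le (h.posDef k)).inv
      h.convex_D h.compact_D hfeas
  rw [h5]
  abel

/-- The iterated-logarithm rate along a sample path on which the noise obeys the dyadic bounds. -/
theorem isBigO (h : S.Path ω t A m β c K) {c₁ : ℝ} (hc₁ : 0 < c₁) {k₀ : ℕ}
    (hPE : ∀ k ≥ k₀, ∀ v : Fin d → ℝ,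
      c₁ * k * euclNorm v ^ 2 ≤ ∑ i ∈ Finset.range k, (S.φ i ω ⬝ᵥ v) ^ 2)
    {e : ℕ → ℝ} (he : ∀ᶠ k : ℕ in atTop, e k ^ 2 ≤ K * (Real.log (Real.log k) / k))
    (hdrift : ∀ k, β k * (S.φ k ω ⬝ᵥ (S.θ - t k)) ^ 2 - |e k| * |S.φ k ω ⬝ᵥ (S.θ - t k)| ≤
      S.drift k ω (S.φ k ω ⬝ᵥ t k) (S.φ k ω ⬝ᵥ S.θ) * (S.φ k ω ⬝ᵥ (S.θ - t k)))
    (hdrift' : ∀ k, |S.drift k ω (S.φ k ω ⬝ᵥ t k) (S.φ k ω ⬝ᵥ S.θ)| ≤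
      K * |S.φ k ω ⬝ᵥ (S.θ - t k)|)
    {W : ℝ}
    (hN : ∀ n : ℕ, DyadicBound (fun _ i => 1 / ((n : ℝ) + 1) *
      (-2 * (S.b i ω / m i) * (S.φ i ω ⬝ᵥ (S.θ - t i)))) (fun i => S.noise i ω (t i)) W)
    (hN' : ∀ a : Fin d, DyadicBound (fun j i => √(2 ^ j * Real.log j) *
      ((S.b i ω / m i) • (A (i + 1) *ᵥ S.φ i ω)) a) (fun i => S.noise i ω (t i)) W)
    (hN'' : ∀ a : Fin d, DyadicBound (fun j i => √(2 ^ j * Real.log j) *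
      -((S.b i ω / m i) • (A (i + 1) *ᵥ S.φ i ω)) a) (fun i => S.noise i ω (t i)) W) :
    (fun k => euclNorm (S.θ - t k) ^ 2) =O[atTop]
      fun k : ℕ => Real.log (Real.log k) / k := by
  have hc := h.c_pos
  have hK := h.K_pos
  set c₂ := c ^ 3 / K * c₁
  have hc₂ : 0 < c₂ := by positivity
  have hlow : ∀ k ≥ k₀, ∀ v : Fin d → ℝ, c₂ * k * euclNorm v ^ 2 ≤ v ⬝ᵥ ((A k)⁻¹ *ᵥ v) :=
    h.le_quad hPE
  obtain ⟨C₁, hup⟩ := h.exists_quad_le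
  have hq : ∀ k ≥ max k₀ 1, euclNorm (A (k + 1) *ᵥ S.φ k ω) ≤ K / c₂ / k := by
    intro k hk
    simp only [ge_iff_le, max_le_iff] at hk
    exact h.euclNorm_mulVec_le hc₂ hk.2 (hlow (k + 1) (by omega))
  set r : ℕ → Fin d → ℝ := fun k => (S.b k ω / m k) • (A (k + 1) *ᵥ S.φ k ω)
  set C₂ := 1 / c * (K / c₂)
  have hC₂ : 0 ≤ C₂ := by positivity
  have hr : ∀ k ≥ max k₀ 1, euclNorm (r k) ≤ C₂ / k := by
    intro k hk
    simp only [r]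
    rw [euclNorm_smul, abs_of_pos (h.ratio_pos k)]
    calc _ ≤ 1 / c * (K / c₂ / k) :=
          mul_le_mul (h.ratio_le k) (hq k hk) (euclNorm_nonneg _) (by positivity)
      _ = _ := by simp only [C₂]; ring
  obtain ⟨k₁, hk₁⟩ := eventually_atTop.1 (he.and (tendsto_log_log_atTop.eventually_ge_atTop 1))
  set x : ℕ → ℝ := fun k => S.φ k ω ⬝ᵥ (S.θ - t k)
  set c₀ := min (min c₁ c₂) (c ^ 2 / (2 * K))
  have hc₀ : 0 < c₀ := lt_min (lt_min hc₁ hc₂) (by positivity)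
  have hc₀1 : c₀ ≤ c₁ := (min_le_left _ _).trans (min_le_left _ _)
  have hc₀2 : c₀ ≤ c₂ := (min_le_left _ _).trans (min_le_right _ _)
  have hc₀3 : c₀ ≤ c ^ 2 / (2 * K) := min_le_right _ _
  set C₃ := 2 / c ^ 2 * K + 9 / c ^ 2 * (K * (K / c₂))
  have hC₃ : 0 ≤ C₃ := by positivity
  set C := max (max K (max C₁ C₂)) C₃
  have hCK : K ≤ C := (le_max_left _ _).trans (le_max_left _ _)
  have hC1 : C₁ ≤ C := (le_max_left _ _).trans ((le_max_right _ _).trans (le_max_left _ _))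
  have hC2 : C₂ ≤ C := (le_max_right _ _).trans ((le_max_right _ _).trans (le_max_left _ _))
  have hC3 : C₃ ≤ C := le_max_right _ _
  set k₂ := max (max k₀ 1) k₁
  have hk₂ : ∀ k ≥ k₂, k ≥ k₀ ∧ k ≥ 1 ∧ k ≥ max k₀ 1 ∧ k ≥ k₁ := by
    intro k hk
    simp only [k₂, ge_iff_le, max_le_iff] at hk ⊢
    tauto
  refine isBigO_log_log_div_of_lyapunov (E := EuclideanSpace ℝ (Fin d))
    (φ := fun k => WithLp.toLp 2 (S.φ k ω)) (θt := fun k => WithLp.toLp 2 (S.θ - t k))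
    (r := fun k => WithLp.toLp 2 (r k))
    (V := fun k => (S.θ - t k) ⬝ᵥ ((A k)⁻¹ *ᵥ (S.θ - t k)))
    (g := fun k => S.drift k ω (S.φ k ω ⬝ᵥ t k) (S.φ k ω ⬝ᵥ S.θ))
    (w := fun k => S.noise k ω (t k))
    (h := fun k => (-2 * (S.b k ω / m k) * (S.φ k ω ⬝ᵥ (S.θ - t k))) * S.noise k ω (t k))
    (c := c₀) (C := C) (k₀ := k₂) hc₀ (hK.le.trans hCK) ?_ ?_ ?_ ?_ ?_ ?_ ?_ ?_ ?_ ?_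
  · exact fun k => (h.φ_le k).trans hCK
  · intro k hk v
    have h1 := hPE k (hk₂ k hk).1 (WithLp.ofLp v)
    have h2 : ∀ i, inner ℝ (WithLp.toLp 2 (S.φ i ω)) v = S.φ i ω ⬝ᵥ WithLp.ofLp v := fun i => by
      rw [← inner_toLp]
    simp only [h2]
    refine le_trans ?_ h1
    change c₀ * k * euclNorm (WithLp.ofLp v) ^ 2 ≤ _
    gcongr
  · intro k hk
    refine le_trans ?_ (hlow k (hk₂ k hk).1 _)
    change c₀ * k * euclNorm (S.θ - t k) ^ 2 ≤ _
    gcongr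
  · intro k hk
    refine (hup k (hk₂ k hk).2.1 _).trans ?_
    change _ ≤ C * k * euclNorm (S.θ - t k) ^ 2
    gcongr
  · intro k hk
    obtain ⟨-, a1, a2, a3⟩ := hk₂ k hk
    obtain ⟨b1, b2⟩ := hk₁ k a3
    have h1 := h.lyapunov_step (hdrift k) (hq k a2)
    simp only [inner_toLp]
    have hk0 : (0 : ℝ) < k := by exact_mod_cast a1
    have h2 : 2 / c ^ 2 * e k ^ 2 + 9 / c ^ 2 * (K * (K / c₂ / k)) ≤
        C * (Real.log (Real.log k) / k) := by
      have h3 : 1 / (k : ℝ) ≤ Real.log (Real.log k) / k := by gcongr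
      calc _ ≤ 2 / c ^ 2 * (K * (Real.log (Real.log k) / k)) +
            9 / c ^ 2 * (K * (K / c₂)) * (1 / k) := by
            refine add_le_add (by gcongr) (le_of_eq (by ring))
        _ ≤ 2 / c ^ 2 * (K * (Real.log (Real.log k) / k)) +
            9 / c ^ 2 * (K * (K / c₂)) * (Real.log (Real.log k) / k) := by gcongr
        _ = C₃ * (Real.log (Real.log k) / k) := by simp only [C₃]; ring
        _ ≤ _ := by gcongr
    have h4 : c₀ * (S.φ k ω ⬝ᵥ (S.θ - t k)) ^ 2 ≤
        c ^ 2 / (2 * K) * (S.φ k ω ⬝ᵥ (S.θ - t k)) ^ 2 := by gcongr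
    linarith
  · simp only [inner_toLp]
    -- Half of the descent is reserved for the noise compensator; `4 / c ^ 2` comes from squaring
    -- the weight `-2 b / m`.
    refine exists_sum_le_of_dyadicBound (x := x) (R := 4 / c ^ 2) (half_pos hc₀)
      (fun i => ?_) hN
    have h1 := h.ratio_le i
    have h2 := h.ratio_pos i
    have h3 : (S.b i ω / m i) ^ 2 ≤ 1 / c ^ 2 := by
      calc _ ≤ (1 / c) ^ 2 := by gcongr
        _ = _ := by ring
    calc (-2 * (S.b i ω / m i) * (S.φ i ω ⬝ᵥ (S.θ - t i))) ^ 2 =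
          4 * (S.b i ω / m i) ^ 2 * x i ^ 2 := by simp only [x]; ring
      _ ≤ 4 * (1 / c ^ 2) * x i ^ 2 := by gcongr
      _ = _ := by ring
  · intro k hk
    refine (hr k (hk₂ k hk).2.2.1).trans ?_
    gcongr
  · intro k hk
    simp only [inner_toLp]
    refine (hdrift' k).trans ?_
    gcongr
  · intro J
    have hra : ∀ a : Fin d, ∀ k ≥ max k₀ 1, |r k a| ≤ C₂ / k := fun a k hk =>
      (abs_apply_le_euclNorm _ _).trans (hr k hk)
    -- The vector sum is bounded coordinate by coordinate.
    choose B hB0 j₀ hB using fun a : Fin d =>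
      exists_sq_sum_le_of_dyadicBound hC₂ (hra a) (hN' a) (hN'' a) J
    refine ⟨∑ a, B a, Finset.univ.sup j₀, fun j hj n hn hnJ => ?_⟩
    rw [EuclideanSpace.real_norm_sq_eq, Finset.sum_mul]
    refine Finset.sum_le_sum fun a _ => ?_
    have h1 := hB a j ((Finset.le_sup (Finset.mem_univ a)).trans hj) n hn hnJ
    refine le_trans (le_of_eq ?_) h1
    congr 1
    rw [WithLp.ofLp_sum, Finset.sum_apply]
    rfl
  · intro hlim
    filter_upwards [h.eventually_linear hlim hr] with k hk
    have hv : S.innov k ω (t k) = S.drift k ω (S.φ k ω ⬝ᵥ t k) (S.φ k ω ⬝ᵥ S.θ) +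
      S.noise k ω (t k) := by unfold noise; ring
    rw [hk, hv]
    rfl

end Path

end Setup

/-! ### From sample paths to almost sure rates -/

namespace Setup

variable {Ω : Type*} {d : ℕ} {S : Setup Ω d} [mΩ : MeasurableSpace Ω] {P : Measure Ω}
  {ℱ : Filtration ℕ mΩ} {M Cmax : ℝ}

theorem measData (hReg : S.RegressorAssumption P ℱ) (hThr : S.ThresholdAssumption P ℱ M)
    (hNoise : S.NoiseAssumption P ℱ M Cmax) (k : ℕ) : @MeasData Ω d S (ℱ k) k :=
  @MeasData.mk Ω d S (ℱ k) k (hReg.meas_φ k) (hThr.meas_l k) (hThr.meas_u k) (hThr.meas_L k)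
    (hThr.meas_U k) (hThr.meas_b k) (hNoise.meas_C k) (hNoise.meas_f k) (hNoise.continuous_f k)
    (hNoise.nonneg_f k)

/-- The data that enter one update remain measurable at the next time. -/
theorem measData_succ (hReg : S.RegressorAssumption P ℱ) (hThr : S.ThresholdAssumption P ℱ M)
    (hNoise : S.NoiseAssumption P ℱ M Cmax) (k : ℕ) : @MeasData Ω d S (ℱ (k + 1)) k :=
  have hle : ℱ k ≤ ℱ (k + 1) := ℱ.mono (Nat.le_succ k)
  @MeasData.mk Ω d S (ℱ (k + 1)) k ((hReg.meas_φ k).mono hle le_rfl)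
    ((hThr.meas_l k).mono hle le_rfl) ((hThr.meas_u k).mono hle le_rfl)
    ((hThr.meas_L k).mono hle le_rfl) ((hThr.meas_U k).mono hle le_rfl)
    ((hThr.meas_b k).mono hle le_rfl) ((hNoise.meas_C k).mono hle le_rfl)
    (fun x => (hNoise.meas_f k x).mono hle le_rfl) (hNoise.continuous_f k) (hNoise.nonneg_f k)

theorem ae_ordered (hThr : S.ThresholdAssumption P ℱ M) : ∀ᵐ ω ∂P, ∀ k, S.Ordered k ω := by
  filter_upwards [hThr.ordered, hThr.nondegenerate] with ω h1 h2 k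
  exact ⟨h1 k, h2 k⟩

/-- The conditional law integrated over an event of the past: the hypothesis the disintegration
lemmas need. -/
theorem measureReal_inter_le [IsProbabilityMeasure P] (hNoise : S.NoiseAssumption P ℱ M Cmax)
    (k : ℕ) (A : Set Ω) (hA : MeasurableSet[ℱ k] A) (a : ℝ) :
    P.real (A ∩ {ω | S.ε (k + 1) ω ≤ a}) = ∫ ω in A, S.cdf k ω a ∂P := by
  have hs : MeasurableSet {ω | S.ε (k + 1) ω ≤ a} :=
    measurableSet_le (hNoise.meas_ε k) measurable_const
  rw [setIntegral_congr_ae ((ℱ.le k) A hA) ((hNoise.cond_law k a).mono fun ω h _ => h),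
    setIntegral_condExp (ℱ.le k) ((integrable_const (1 : ℝ)).indicator hs) hA,
    setIntegral_indicator hs]
  simp

/-- The centred innovations at adapted estimates form a bounded noise. -/
theorem isNoise_noise [IsProbabilityMeasure P] (hReg : S.RegressorAssumption P ℱ)
    (hThr : S.ThresholdAssumption P ℱ M) (hNoise : S.NoiseAssumption P ℱ M Cmax)
    {t : ℕ → Ω → Fin d → ℝ} (ht : ∀ k, Measurable[ℱ k] (t k)) :
    IsNoise P ℱ 5 fun k ω => S.noise k ω (t k ω) where
  pos := by norm_num
  bdd k ω := abs_noise_le (hNoise.nonneg_f k ω) (hNoise.integrable_f k ω)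
    (hNoise.integral_f k ω) _
  meas k := by
    have hle : ℱ k ≤ ℱ (k + 1) := ℱ.mono (Nat.le_succ k)
    have h' := measData_succ hReg hThr hNoise k
    exact @MeasData.noise Ω d S k (ℱ (k + 1)) h' (hNoise.meas_y k) (t k)
      ((ht k).mono hle le_rfl)
  orth k H hH := by
    rintro ⟨B, hB⟩
    have h := measData hReg hThr hNoise k
    have hz : Measurable[ℱ k] fun ω => S.φ k ω ⬝ᵥ t k ω :=
      @measurable_dotProduct Ω (ℱ k) d _ _ (hReg.meas_φ k) (ht k)
    have hz0 : Measurable[ℱ k] fun ω => S.φ k ω ⬝ᵥ S.θ :=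
      @measurable_dotProduct Ω (ℱ k) d _ _ (hReg.meas_φ k) measurable_const
    have hthr : Measurable[ℱ k] fun ω => S.thr k ω (S.φ k ω ⬝ᵥ t k ω) - S.φ k ω ⬝ᵥ S.θ :=
      (@MeasData.thr Ω d S k (ℱ k) h _ hz).sub hz0
    have hjump : Measurable[ℱ k] fun ω => S.jump k ω (S.φ k ω ⬝ᵥ t k ω) :=
      @MeasData.jump Ω d S k (ℱ k) h _ hz
    have hf : @Measurable (Ω × ℝ) ℝ (@Prod.instMeasurableSpace Ω ℝ (ℱ k) _) _
        fun p => S.f k p.1 p.2 := @measurable_uncurry_density Ω (ℱ k) (S.f k) (hNoise.meas_f k)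
          (hNoise.continuous_f k)
    -- The conditioning variable is the identity into `Ω` with the smaller `σ`-algebra `ℱ k`, so
    -- every `ℱ k`-measurable threshold is a function of it.
    have hid : @Measurable Ω Ω mΩ (ℱ k) id := measurable_id'' (ℱ.le k)
    have hlaw := fun A (hA : MeasurableSet[ℱ k] A) a => measureReal_inter_le hNoise k A hA a
    set τ : Ω → ℝ := fun ω => S.thr k ω (S.φ k ω ⬝ᵥ t k ω) - S.φ k ω ⬝ᵥ S.θ
    set H' : Ω → ℝ := fun ω => H ω * S.jump k ω (S.φ k ω ⬝ᵥ t k ω)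
    have hH' : Measurable[ℱ k] H' := hH.mul hjump
    have hB' : ∀ ω, |H' ω| ≤ B * 2 := fun ω => by
      simp only [H', abs_mul, abs_of_nonneg (jump_nonneg _)]
      exact mul_le_mul (hB ω) (jump_le_two _) (jump_nonneg _) ((abs_nonneg _).trans (hB ω))
    have key := @integral_mul_indicator_le Ω Ω mΩ (ℱ k) P _ id (S.ε (k + 1)) (S.f k) hid
      (hNoise.meas_ε k) hf (hNoise.nonneg_f k) (hNoise.integrable_f k) (hNoise.integral_f k)
      hlaw τ H' hthr hH' (B * 2) hB'
    have hne := @ae_ne_threshold Ω Ω mΩ (ℱ k) P _ id (S.ε (k + 1)) (S.f k) hid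
      (hNoise.meas_ε k) hf (hNoise.nonneg_f k) (hNoise.integrable_f k) (hNoise.integral_f k)
      hlaw τ hthr
    have hcdf : Measurable[ℱ k] fun ω => S.cdf k ω (τ ω) := @MeasData.cdf Ω d S (ℱ k) k h _ hthr
    have hle := ℱ.le k
    have hi1 : Integrable (fun ω => H' ω * S.cdf k ω (τ ω)) P := by
      refine Integrable.of_bound (C := B * 2)
        (((hH'.mul hcdf).mono hle le_rfl).aestronglyMeasurable) (ae_of_all _ fun ω => ?_)
      rw [Real.norm_eq_abs, abs_mul, abs_of_nonneg (cdf_nonneg (hNoise.nonneg_f k ω) _)]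
      exact (mul_le_of_le_one_right (abs_nonneg _) (cdf_le_one (hNoise.nonneg_f k ω)
        (hNoise.integrable_f k ω) (hNoise.integral_f k ω) _)).trans (hB' ω)
    have hi2 : Integrable (fun ω => H' ω * (if S.ε (k + 1) ω ≤ τ ω then 1 else 0)) P := by
      refine Integrable.of_bound (C := B * 2) ((hH'.mono hle le_rfl).mul (Measurable.ite
        (measurableSet_le (hNoise.meas_ε k) (hthr.mono hle le_rfl)) measurable_const
        measurable_const)).aestronglyMeasurable (ae_of_all _ fun ω => ?_)
      rw [Real.norm_eq_abs, abs_mul]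
      refine (mul_le_of_le_one_right (abs_nonneg _) ?_).trans (hB' ω)
      split_ifs <;> simp
    calc ∫ ω, H ω * S.noise k ω (t k ω) ∂P
        = ∫ ω, (H' ω * S.cdf k ω (τ ω) -
            H' ω * (if S.ε (k + 1) ω ≤ τ ω then 1 else 0)) ∂P := by
          refine integral_congr_ae ?_
          filter_upwards [ae_ordered hThr, hne] with ω h1 h2
          simp only [H', noise, drift]
          rw [innov_eq (h1 k) (hNoise.median k ω) (t k ω) h2]
          simp only [τ]
          ring
      _ = 0 := by
          rw [integral_sub hi1 hi2, sub_eq_zero]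
          exact key.symm

/-- On almost every sample path the centred innovations obey the dyadic bounds. -/
theorem ae_dyadicBound [IsProbabilityMeasure P] {W : ℝ} {w : ℕ → Ω → ℝ} (hw : IsNoise P ℱ W w)
    {c : ℕ → ℕ → Ω → ℝ} (hc : ∀ j k, Measurable[ℱ k] (c j k)) :
    ∀ᵐ ω ∂P, DyadicBound (fun j i => c j i ω) (fun i => w i ω) W :=
  ae_eventually_sum_Ico_lt hw hc

/-- The iterated-logarithm rate for one step of the algorithm, given a lower bound of the drift. -/
theorem ae_isBigO_of_recursion [IsProbabilityMeasure P] (hReg : S.RegressorAssumption P ℱ)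
    (hThr : S.ThresholdAssumption P ℱ M) (hNoise : S.NoiseAssumption P ℱ M Cmax)
    (hExc : ∀ᵐ ω ∂P, ∃ c : ℝ, 0 < c ∧ ∃ k₀ : ℕ, ∀ k ≥ k₀, ∀ v : Fin d → ℝ,
      c * k * euclNorm v ^ 2 ≤ ∑ i ∈ Finset.range k, (S.φ i ω ⬝ᵥ v) ^ 2)
    {t : ℕ → Ω → Fin d → ℝ} {A : ℕ → Ω → Matrix (Fin d) (Fin d) ℝ} {m β : ℕ → Ω → ℝ}
    (ht : ∀ k, Measurable[ℱ k] (t k)) (hA : ∀ k i j, Measurable[ℱ k] fun ω => A k ω i j)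
    (hm : ∀ k, Measurable[ℱ k] (m k)) (hβ : ∀ k, Measurable[ℱ k] (β k))
    (hpos : ∀ k ω, (A k ω).PosDef)
    (next_t : ∀ k ω, t (k + 1) ω = S.nextθ k ω (m k ω) (β k ω) (A k ω) (t k ω))
    (next_A : ∀ k ω, A (k + 1) ω = S.nextP k ω (m k ω) (β k ω) (A k ω))
    (hmb : ∀ᵐ ω ∂P, ∃ c K : ℝ, 0 < c ∧ ∀ k, c ≤ m k ω ∧ m k ω ≤ K)
    (hβb : ∀ᵐ ω ∂P, ∃ c K : ℝ, 0 < c ∧ ∀ k, c ≤ β k ω ∧ β k ω ≤ K)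
    (hdrift : ∀ᵐ ω ∂P, ∃ (e : ℕ → ℝ) (K : ℝ),
      (∀ᶠ k : ℕ in atTop, e k ^ 2 ≤ K * (Real.log (Real.log k) / k)) ∧
      (∀ k, β k ω * (S.φ k ω ⬝ᵥ (S.θ - t k ω)) ^ 2 - |e k| * |S.φ k ω ⬝ᵥ (S.θ - t k ω)| ≤
        S.drift k ω (S.φ k ω ⬝ᵥ t k ω) (S.φ k ω ⬝ᵥ S.θ) * (S.φ k ω ⬝ᵥ (S.θ - t k ω))) ∧
      ∀ k, |S.drift k ω (S.φ k ω ⬝ᵥ t k ω) (S.φ k ω ⬝ᵥ S.θ)| ≤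
        K * |S.φ k ω ⬝ᵥ (S.θ - t k ω)|) :
    ∀ᵐ ω ∂P, (fun k => euclNorm (S.θ - t k ω) ^ 2) =O[atTop]
      fun k : ℕ => Real.log (Real.log k) / k := by
  have hn := isNoise_noise hReg hThr hNoise ht
  have hmd := measData hReg hThr hNoise
  have hratio : ∀ k, Measurable[ℱ k] fun ω => S.b k ω / m k ω := fun k =>
    (hThr.meas_b k).div (hm k)
  have hx : ∀ k, Measurable[ℱ k] fun ω => S.φ k ω ⬝ᵥ (S.θ - t k ω) := fun k =>
    @measurable_dotProduct Ω (ℱ k) d _ _ (hReg.meas_φ k) (measurable_const.sub (ht k))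
  have hr : ∀ k a, Measurable[ℱ k] fun ω => ((S.b k ω / m k ω) • (A (k + 1) ω *ᵥ S.φ k ω)) a := by
    intro k a
    -- The matrix with index `k + 1` is built from data with index `k` and does not involve
    -- `y_{k+1}`. The noise weights containing it are therefore predictable.
    have hA' : ∀ i j, Measurable[ℱ k] fun ω => A (k + 1) ω i j := by
      intro i j
      simp only [next_A]
      exact @MeasData.nextP Ω d S (ℱ k) k _ _ _ (hmd k) (hm k) (hβ k) (hA k) i j
    have h1 := @measurable_mulVec Ω (ℱ k) d _ _ hA' (hReg.meas_φ k)
    exact (hratio k).mul ((measurable_pi_apply a).comp h1)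
  have hN : ∀ᵐ ω ∂P, ∀ n : ℕ, DyadicBound (fun _ i => 1 / ((n : ℝ) + 1) *
      (-2 * (S.b i ω / m i ω) * (S.φ i ω ⬝ᵥ (S.θ - t i ω))))
      (fun i => S.noise i ω (t i ω)) 5 := by
    rw [ae_all_iff]
    intro n
    exact ae_dyadicBound hn (c := fun _ i ω => 1 / ((n : ℝ) + 1) *
      (-2 * (S.b i ω / m i ω) * (S.φ i ω ⬝ᵥ (S.θ - t i ω))))
      fun _ k => (((hratio k).const_mul (-2)).mul (hx k)).const_mul _
  have hN' : ∀ᵐ ω ∂P, ∀ a : Fin d, DyadicBound (fun j i => √(2 ^ j * Real.log j) *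
      ((S.b i ω / m i ω) • (A (i + 1) ω *ᵥ S.φ i ω)) a) (fun i => S.noise i ω (t i ω)) 5 := by
    rw [ae_all_iff]
    intro a
    exact ae_dyadicBound hn (c := fun j i ω => √(2 ^ j * Real.log j) *
      ((S.b i ω / m i ω) • (A (i + 1) ω *ᵥ S.φ i ω)) a) fun _ k => (hr k a).const_mul _
  have hN'' : ∀ᵐ ω ∂P, ∀ a : Fin d, DyadicBound (fun j i => √(2 ^ j * Real.log j) *
      -((S.b i ω / m i ω) • (A (i + 1) ω *ᵥ S.φ i ω)) a) (fun i => S.noise i ω (t i ω)) 5 := by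
    rw [ae_all_iff]
    intro a
    exact ae_dyadicBound hn (c := fun j i ω => √(2 ^ j * Real.log j) *
      -((S.b i ω / m i ω) • (A (i + 1) ω *ᵥ S.φ i ω)) a) fun _ k => (hr k a).neg.const_mul _
  filter_upwards [hN, hN', hN'', hExc, hmb, hβb, hdrift, hReg.bdd_φ, hThr.bounds_b] with ω h1 h2 h3
    ⟨c₁, hc₁, k₀, hPE⟩ ⟨c₂, K₂, hc₂, hm2⟩ ⟨c₃, K₃, hc₃, hβ3⟩ ⟨e, K₄, he, hd1, hd2⟩ ⟨K₅, hφ⟩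
    ⟨⟨c₆, hc₆, hb⟩, hb1⟩
  set c := min c₂ (min c₃ c₆)
  set K := max (max K₂ K₃) (max (max K₄ K₅) 1)
  have hc : 0 < c := lt_min hc₂ (lt_min hc₃ hc₆)
  have hcc : c ≤ c₂ ∧ c ≤ c₃ ∧ c ≤ c₆ := by simp [c]
  have hKK : K₂ ≤ K ∧ K₃ ≤ K ∧ K₄ ≤ K ∧ K₅ ≤ K ∧ 1 ≤ K := by simp [K]
  obtain ⟨q2, q3, q6⟩ := hcc
  obtain ⟨p2, p3, p4, p5, p1⟩ := hKK
  have hpath : S.Path ω (fun k => t k ω) (fun k => A k ω) (fun k => m k ω) (fun k => β k ω) c K :=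
    { convex_D := hReg.convex_D
      compact_D := hReg.compact_D
      θ_mem := hReg.θ_mem
      posDef := fun k => hpos k ω
      next_t := fun k => next_t k ω
      next_A := fun k => next_A k ω
      c_pos := hc
      K_pos := by linarith
      φ_le := fun k => (hφ k).trans p5
      le_b := fun k => q6.trans (hb k)
      b_le := hb1
      le_m := fun k => q2.trans (hm2 k).1
      m_le := fun k => (hm2 k).2.trans p2
      le_β := fun k => q3.trans (hβ3 k).1
      β_le := fun k => (hβ3 k).2.trans p3
      innov_le := fun k => abs_innov_le (hNoise.nonneg_f k ω) (hNoise.integrable_f k ω)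
        (hNoise.integral_f k ω) _ }
  refine hpath.isBigO hc₁ hPE ?_ hd1 ?_ h1 h2 h3
  · filter_upwards [he, tendsto_log_log_atTop.eventually_ge_atTop 0] with k hk hk0
    exact hk.trans (by gcongr)
  · intro k
    exact (hd2 k).trans (by gcongr)

section Iterates

/-- The three claims are proved jointly because the projection is measurable only along positive
definite matrices. The measurability of `β k` may use that of `t k`, as the gain of the second step
depends on the current estimate. -/
theorem iterates_meas (hReg : S.RegressorAssumption P ℱ) (hThr : S.ThresholdAssumption P ℱ M)
    (hNoise : S.NoiseAssumption P ℱ M Cmax) {t : ℕ → Ω → Fin d → ℝ}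
    {A : ℕ → Ω → Matrix (Fin d) (Fin d) ℝ} {m β : ℕ → Ω → ℝ}
    (ht0 : Measurable[ℱ 0] (t 0)) (hA0 : ∀ i j, Measurable[ℱ 0] fun ω => A 0 ω i j)
    (hpos0 : ∀ ω, (A 0 ω).PosDef) (hm : ∀ k, Measurable[ℱ k] (m k))
    (hβ : ∀ k, Measurable[ℱ k] (t k) → Measurable[ℱ k] (β k))
    (hm0 : ∀ k ω, 0 < m k ω) (hβ0 : ∀ k ω, 0 ≤ β k ω)
    (next_t : ∀ k ω, t (k + 1) ω = S.nextθ k ω (m k ω) (β k ω) (A k ω) (t k ω))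
    (next_A : ∀ k ω, A (k + 1) ω = S.nextP k ω (m k ω) (β k ω) (A k ω)) (k : ℕ) :
    Measurable[ℱ k] (t k) ∧ (∀ i j, Measurable[ℱ k] fun ω => A k ω i j) ∧
      ∀ ω, (A k ω).PosDef := by
  induction k with
  | zero => exact ⟨ht0, hA0, hpos0⟩
  | succ k ih =>
    obtain ⟨iht, ihA, ihpos⟩ := ih
    have hle : ℱ k ≤ ℱ (k + 1) := ℱ.mono (Nat.le_succ k)
    have h' := measData_succ hReg hThr hNoise k
    have hmk := (hm k).mono hle le_rfl
    have hβk := (hβ k iht).mono hle le_rfl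
    have hAk : ∀ i j, Measurable[ℱ (k + 1)] fun ω => A k ω i j :=
      fun i j => (ihA i j).mono hle le_rfl
    refine ⟨?_, fun i j => ?_, fun ω => ?_⟩
    · have : t (k + 1) = fun ω => S.nextθ k ω (m k ω) (β k ω) (A k ω) (t k ω) :=
        funext (next_t k)
      rw [this]
      exact @MeasData.nextθ Ω d S (ℱ (k + 1)) k _ _ _ h' (hNoise.meas_y k) hReg.convex_D
        hReg.compact_D ⟨_, interior_subset hReg.θ_mem⟩ hmk hβk hAk (hm0 k) (hβ0 k) ihpos _
        (iht.mono hle le_rfl)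
    · simp only [next_A]
      exact @MeasData.nextP Ω d S (ℱ (k + 1)) k _ _ _ h' hmk hβk hAk i j
    · rw [next_A]
      exact S.posDef_nextP (hm0 k ω) (hβ0 k ω) (ihpos ω)

theorem iterates_mem (hReg : S.RegressorAssumption P ℱ) {t : ℕ → Ω → Fin d → ℝ}
    {A : ℕ → Ω → Matrix (Fin d) (Fin d) ℝ} {m β : ℕ → Ω → ℝ} (ht0 : ∀ ω, t 0 ω ∈ S.D)
    (next_t : ∀ k ω, t (k + 1) ω = S.nextθ k ω (m k ω) (β k ω) (A k ω) (t k ω)) (k : ℕ) (ω : Ω) :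
    t k ω ∈ S.D := by
  cases k with
  | zero => exact ht0 ω
  | succ k =>
    rw [next_t]
    exact (isProj_proj hReg.compact_D ⟨_, interior_subset hReg.θ_mem⟩ _).1

end Iterates

/-- The density is bounded and bounded away from zero where the algorithm evaluates it. -/
theorem ae_density_bounds (hReg : S.RegressorAssumption P ℱ) (hThr : S.ThresholdAssumption P ℱ M)
    (hNoise : S.NoiseAssumption P ℱ M Cmax) : ∀ᵐ ω ∂P, ∃ c K : ℝ, 0 < c ∧ ∀ k,
      0 ≤ S.radius k ω ∧ ∀ x, |x| ≤ S.radius k ω → c ≤ S.f k ω x ∧ S.f k ω x ≤ K := by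
  filter_upwards [hNoise.bounds_f, hNoise.le_C, hNoise.C_le, hThr.bounded] with ω
    ⟨c, K, hc, hf⟩ h1 h2 h3
  refine ⟨c, K, hc, fun k => ⟨?_, fun x hx => hf k x (hx.trans ?_)⟩⟩
  · have := (abs_nonneg _).trans (h1 k _ (interior_subset hReg.θ_mem))
    exact le_trans (by linarith) (le_max_left _ _)
  · have a2 := h2 k
    have a3 := h3 k
    rw [max_le_iff] at a3
    refine max_le ((by linarith : _ ≤ 2 * Cmax).trans (le_max_left _ _)) (max_le ?_ ?_)
    · exact (by linarith : _ ≤ Cmax + M).trans (le_max_right _ _)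
    · exact (by linarith : _ ≤ Cmax + M).trans (le_max_right _ _)

theorem ae_excitation (hAlg : S.Admissible P ℱ)
    (hExc : ∀ᵐ ω ∂P, (fun k : ℕ => (k : ℝ)) =O[atTop] fun k : ℕ => lambdaMin (S.info k ω)) :
    ∀ᵐ ω ∂P, ∃ c : ℝ, 0 < c ∧ ∃ k₀ : ℕ, ∀ k ≥ k₀, ∀ v : Fin d → ℝ,
      c * k * euclNorm v ^ 2 ≤ ∑ i ∈ Finset.range k, (S.φ i ω ⬝ᵥ v) ^ 2 := by
  filter_upwards [hExc] with ω h
  exact S.exists_excitation (hAlg.P0_posDef ω) h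

theorem step1_iterates (hReg : S.RegressorAssumption P ℱ) (hThr : S.ThresholdAssumption P ℱ M)
    (hNoise : S.NoiseAssumption P ℱ M Cmax) (hAlg : S.Admissible P ℱ) (k : ℕ) :
    Measurable[ℱ k] (S.thetaBar k) ∧ (∀ i j, Measurable[ℱ k] fun ω => (S.step1 ω k).2 i j) ∧
      ∀ ω, (S.step1 ω k).2.PosDef :=
  iterates_meas (t := S.thetaBar) (A := fun k ω => (S.step1 ω k).2) (m := S.μbar)
    (β := S.betaBar) hReg hThr hNoise hAlg.meas_θbar0 hAlg.meas_Pbar0 hAlg.Pbar0_posDef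
    hAlg.meas_μbar (fun k _ => @MeasData.betaBar Ω d S (ℱ k) k (measData hReg hThr hNoise k))
    hAlg.μbar_pos (fun k ω => betaBar_nonneg (hNoise.nonneg_f k ω)) (fun _ _ => rfl)
    (fun _ _ => rfl) k

theorem thetaBar_mem (hReg : S.RegressorAssumption P ℱ) (hAlg : S.Admissible P ℱ) (k : ℕ)
    (ω : Ω) : S.thetaBar k ω ∈ S.D :=
  iterates_mem (t := S.thetaBar) (A := fun k ω => (S.step1 ω k).2) (m := S.μbar)
    (β := S.betaBar) hReg hAlg.θbar0_mem (fun _ _ => rfl) k ω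

/-- The rate of the preliminary estimates. -/
theorem ae_isBigO_thetaBar [IsProbabilityMeasure P] (hReg : S.RegressorAssumption P ℱ)
    (hThr : S.ThresholdAssumption P ℱ M) (hNoise : S.NoiseAssumption P ℱ M Cmax)
    (hAlg : S.Admissible P ℱ)
    (hExc : ∀ᵐ ω ∂P, (fun k : ℕ => (k : ℝ)) =O[atTop] fun k : ℕ => lambdaMin (S.info k ω)) :
    ∀ᵐ ω ∂P, (fun k => euclNorm (S.θ - S.thetaBar k ω) ^ 2) =O[atTop]
      fun k : ℕ => Real.log (Real.log k) / k := by
  have hit := step1_iterates hReg hThr hNoise hAlg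
  refine ae_isBigO_of_recursion (t := S.thetaBar) (A := fun k ω => (S.step1 ω k).2) (m := S.μbar)
    (β := S.betaBar) hReg hThr hNoise (ae_excitation hAlg hExc) (fun k => (hit k).1)
    (fun k => (hit k).2.1) hAlg.meas_μbar
    (fun k => @MeasData.betaBar Ω d S (ℱ k) k (measData hReg hThr hNoise k))
    (fun k => (hit k).2.2) (fun _ _ => rfl) (fun _ _ => rfl) hAlg.bounds_μbar ?_ ?_
  · filter_upwards [ae_density_bounds hReg hThr hNoise] with ω ⟨c, K, hc, hf⟩
    refine ⟨c, K, hc, fun k => ⟨le_betaBar (hf k).1 fun x hx => ((hf k).2 x hx).1, ?_⟩⟩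
    have h0 : |(0 : ℝ)| ≤ S.radius k ω := by rw [abs_zero]; exact (hf k).1
    exact (betaBar_le (hNoise.nonneg_f k ω) h0).trans ((hf k).2 0 h0).2
  · filter_upwards [ae_density_bounds hReg hThr hNoise, hNoise.le_C, ae_ordered hThr] with ω
      ⟨c, K, hc, hf⟩ hC hord
    have hθ := interior_subset hReg.θ_mem
    -- No drift error: `β̄_k` is the infimum of the density over all arguments that can occur.
    refine ⟨0, max (2 * K) 0, ?_, fun k => ?_, fun k => ?_⟩
    · filter_upwards [tendsto_log_log_atTop.eventually_ge_atTop 0] with k hk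
      have : 0 ≤ max (2 * K) 0 := le_max_right _ _
      rw [Pi.zero_apply, zero_pow two_ne_zero]
      positivity
    · have := mul_sq_le_drift_mul (hNoise.integrable_f k ω) (hord k)
        (betaBar_nonneg (hNoise.nonneg_f k ω)) (fun x hx => betaBar_le (hNoise.nonneg_f k ω) hx)
        (hC k _ (thetaBar_mem hReg hAlg k ω)) (hC k _ hθ)
      simpa [dotProduct_sub] using this
    · have := abs_drift_sub_drift_le (hNoise.nonneg_f k ω) (hNoise.integrable_f k ω) (hord k)
        (fun x hx => ((hf k).2 x hx).2) (hC k _ (thetaBar_mem hReg hAlg k ω)) (hC k _ hθ)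
        (hC k _ (thetaBar_mem hReg hAlg k ω))
      rw [drift_self, sub_zero, ← dotProduct_sub] at this
      exact this.trans (by gcongr; exact le_max_left _ _)

/-- The adaptation gain of the second step along the iterates. -/
noncomputable def betaIter (S : Setup Ω d) (k : ℕ) (ω : Ω) : ℝ :=
  S.beta k ω (S.thetaBar k ω) (S.estimate k ω)

theorem measurable_betaIter (hReg : S.RegressorAssumption P ℱ)
    (hThr : S.ThresholdAssumption P ℱ M) (hNoise : S.NoiseAssumption P ℱ M Cmax)
    (hAlg : S.Admissible P ℱ) (k : ℕ) (h : Measurable[ℱ k] (S.estimate k)) :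
    Measurable[ℱ k] (S.betaIter k) :=
  @MeasData.beta Ω d S (ℱ k) k (measData hReg hThr hNoise k) _ _
    (step1_iterates hReg hThr hNoise hAlg k).1 h

theorem step2_iterates (hReg : S.RegressorAssumption P ℱ) (hThr : S.ThresholdAssumption P ℱ M)
    (hNoise : S.NoiseAssumption P ℱ M Cmax) (hAlg : S.Admissible P ℱ) (k : ℕ) :
    Measurable[ℱ k] (S.estimate k) ∧ (∀ i j, Measurable[ℱ k] fun ω => (S.step2 ω k).2 i j) ∧
      ∀ ω, (S.step2 ω k).2.PosDef :=
  iterates_meas (t := S.estimate) (A := fun k ω => (S.step2 ω k).2) (m := S.μ)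
    (β := S.betaIter) hReg hThr hNoise hAlg.meas_θ0 hAlg.meas_P0 hAlg.P0_posDef
    hAlg.meas_μ (measurable_betaIter hReg hThr hNoise hAlg)
    hAlg.μ_pos (fun k ω => beta_nonneg (hNoise.nonneg_f k ω) (hNoise.integrable_f k ω)
      (hNoise.median k ω) _ _) (fun _ _ => rfl) (fun _ _ => rfl) k

theorem estimate_mem (hReg : S.RegressorAssumption P ℱ) (hAlg : S.Admissible P ℱ) (k : ℕ)
    (ω : Ω) : S.estimate k ω ∈ S.D :=
  iterates_mem (t := S.estimate) (A := fun k ω => (S.step2 ω k).2) (m := S.μ)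
    (β := S.betaIter) hReg hAlg.θ0_mem (fun _ _ => rfl) k ω

/-- The rate of the estimates of the second step. -/
theorem ae_isBigO_estimate [IsProbabilityMeasure P] (hReg : S.RegressorAssumption P ℱ)
    (hThr : S.ThresholdAssumption P ℱ M) (hNoise : S.NoiseAssumption P ℱ M Cmax)
    (hAlg : S.Admissible P ℱ)
    (hExc : ∀ᵐ ω ∂P, (fun k : ℕ => (k : ℝ)) =O[atTop] fun k : ℕ => lambdaMin (S.info k ω)) :
    ∀ᵐ ω ∂P, (fun k => euclNorm (S.θ - S.estimate k ω) ^ 2) =O[atTop]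
      fun k : ℕ => Real.log (Real.log k) / k := by
  have hit := step2_iterates hReg hThr hNoise hAlg
  refine ae_isBigO_of_recursion (t := S.estimate) (A := fun k ω => (S.step2 ω k).2) (m := S.μ)
    (β := S.betaIter) hReg hThr hNoise (ae_excitation hAlg hExc) (fun k => (hit k).1)
    (fun k => (hit k).2.1) hAlg.meas_μ
    (fun k => measurable_betaIter hReg hThr hNoise hAlg k (hit k).1)
    (fun k => (hit k).2.2) (fun _ _ => rfl) (fun _ _ => rfl) hAlg.bounds_μ ?_ ?_
  · filter_upwards [ae_density_bounds hReg hThr hNoise, hNoise.le_C, ae_ordered hThr] with ω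
      ⟨c, K, hc, hf⟩ hC hord
    refine ⟨c, 2 * K, hc, fun k => beta_mem_Icc (hNoise.nonneg_f k ω) (hNoise.integrable_f k ω)
      (hord k) (hNoise.median k ω) hc.le (fun x hx => ((hf k).2 x hx).1)
      (fun x hx => ((hf k).2 x hx).2) (hC k _ (thetaBar_mem hReg hAlg k ω))
      (hC k _ (estimate_mem hReg hAlg k ω))⟩
  · filter_upwards [ae_density_bounds hReg hThr hNoise, hNoise.le_C, ae_ordered hThr,
      ae_isBigO_thetaBar hReg hThr hNoise hAlg hExc, hReg.bdd_φ] with ω ⟨c, K, hc, hf⟩ hC hord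
      hbar ⟨Kφ, hφ⟩
    have hθ := interior_subset hReg.θ_mem
    have hK : 0 ≤ K := by
      have h0 : |(0 : ℝ)| ≤ S.radius 0 ω := by rw [abs_zero]; exact (hf 0).1
      have := (hf 0).2 0 h0
      linarith
    obtain ⟨B, hB, hO⟩ := hbar.exists_pos
    -- One `2 * K` comes from moving the drift from `θ̄_k` to `θ`, the other from the bound `β_k ≤ 2
    -- * K` on the secant.
    refine ⟨fun k => 4 * K * (S.φ k ω ⬝ᵥ (S.θ - S.thetaBar k ω)),
      max (2 * K) ((4 * K) ^ 2 * Kφ ^ 2 * B), ?_, fun k => ?_, fun k => ?_⟩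
    · filter_upwards [hO.bound, tendsto_log_log_atTop.eventually_ge_atTop 0] with k hk hk0
      have hnn : 0 ≤ Real.log (Real.log k) / k := by positivity
      rw [Real.norm_of_nonneg (sq_nonneg _), Real.norm_of_nonneg hnn] at hk
      have h1 : (S.φ k ω ⬝ᵥ (S.θ - S.thetaBar k ω)) ^ 2 ≤
          Kφ ^ 2 * euclNorm (S.θ - S.thetaBar k ω) ^ 2 := by
        rw [← sq_abs, ← mul_pow]
        have := (abs_dotProduct_le (S.φ k ω) (S.θ - S.thetaBar k ω)).trans
          (mul_le_mul_of_nonneg_right (hφ k) (euclNorm_nonneg _))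
        gcongr
      calc (4 * K * (S.φ k ω ⬝ᵥ (S.θ - S.thetaBar k ω))) ^ 2
          = (4 * K) ^ 2 * (S.φ k ω ⬝ᵥ (S.θ - S.thetaBar k ω)) ^ 2 := by ring
        _ ≤ (4 * K) ^ 2 * (Kφ ^ 2 * (B * (Real.log (Real.log k) / k))) := by
            gcongr
            exact h1.trans (by gcongr)
        _ = (4 * K) ^ 2 * Kφ ^ 2 * B * (Real.log (Real.log k) / k) := by ring
        _ ≤ _ := by gcongr; exact le_max_right _ _
    · have h1 := abs_drift_sub_drift_le (hNoise.nonneg_f k ω) (hNoise.integrable_f k ω) (hord k)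
        (fun x hx => ((hf k).2 x hx).2) (hC k _ (estimate_mem hReg hAlg k ω)) (hC k _ hθ)
        (hC k _ (thetaBar_mem hReg hAlg k ω))
      have h2 := beta_mul_sub (hNoise.median k ω) (S.thetaBar k ω) (S.estimate k ω)
      have h3 := beta_mem_Icc (hNoise.nonneg_f k ω) (hNoise.integrable_f k ω)
        (hord k) (hNoise.median k ω) hc.le (fun x hx => ((hf k).2 x hx).1)
        (fun x hx => ((hf k).2 x hx).2) (hC k _ (thetaBar_mem hReg hAlg k ω))
        (hC k _ (estimate_mem hReg hAlg k ω))
      rw [← h2] at h1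
      simp only [betaIter, dotProduct_sub] at *
      set z := S.φ k ω ⬝ᵥ S.estimate k ω
      set zb := S.φ k ω ⬝ᵥ S.thetaBar k ω
      set z0 := S.φ k ω ⬝ᵥ S.θ
      set β := S.beta k ω (S.thetaBar k ω) (S.estimate k ω)
      set g := S.drift k ω z z0
      have h4 : |g - β * (z0 - z)| ≤ 4 * K * |z0 - zb| := by
        calc |g - β * (z0 - z)| = |(g - β * (zb - z)) + -(β * (z0 - zb))| := by congr 1; ring
          _ ≤ |g - β * (zb - z)| + |-(β * (z0 - zb))| := abs_add_le _ _
          _ ≤ 2 * K * |z0 - zb| + 2 * K * |z0 - zb| := by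
              refine add_le_add h1 ?_
              rw [abs_neg, abs_mul, abs_of_nonneg (hc.le.trans h3.1)]
              exact mul_le_mul_of_nonneg_right h3.2 (abs_nonneg _)
          _ = _ := by ring
      have h5 : |4 * K * (z0 - zb)| = 4 * K * |z0 - zb| := by
        rw [abs_mul, abs_of_nonneg (by positivity)]
      rw [h5]
      have h6 := mul_le_mul_of_nonneg_right h4 (abs_nonneg (z0 - z))
      rw [← abs_mul] at h6
      have h7 := neg_abs_le ((g - β * (z0 - z)) * (z0 - z))
      nlinarith
    · have := abs_drift_sub_drift_le (hNoise.nonneg_f k ω) (hNoise.integrable_f k ω) (hord k)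
        (fun x hx => ((hf k).2 x hx).2) (hC k _ (estimate_mem hReg hAlg k ω)) (hC k _ hθ)
        (hC k _ (estimate_mem hReg hAlg k ω))
      rw [drift_self, sub_zero, ← dotProduct_sub] at this
      exact this.trans (by gcongr; exact le_max_left _ _)

end Setup

/-- From `log (k + 1) ≤ 2 log k` follows `log log (k + 1) ≤ log 2 + log log k`, and `log 2` is
absorbed once `log log k ≥ 1`. -/
theorem isBigO_log_log_succ :
    (fun k : ℕ => Real.log (Real.log ((k + 1 : ℕ) : ℝ)) / ((k + 1 : ℕ) : ℝ)) =O[atTop]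
      fun k : ℕ => Real.log (Real.log k) / k := by
  refine IsBigO.of_bound 2 ?_
  filter_upwards [tendsto_log_log_atTop.eventually_ge_atTop 1, eventually_ge_atTop 2,
    (tendsto_add_atTop_iff_nat 1).2 tendsto_log_log_atTop |>.eventually_ge_atTop 0]
    with k hk hk2 hk'
  have hk0 : (2 : ℝ) ≤ k := by exact_mod_cast hk2
  have h1 : 0 < Real.log k := Real.log_pos (by linarith)
  have h2 : Real.log ((k + 1 : ℕ) : ℝ) ≤ 2 * Real.log k := by
    have : Real.log ((k + 1 : ℕ) : ℝ) ≤ Real.log ((k : ℝ) ^ 2) :=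
      Real.log_le_log (by positivity) (by push_cast; nlinarith)
    rwa [Real.log_pow] at this
  have h3 : Real.log (Real.log ((k + 1 : ℕ) : ℝ)) ≤ 2 * Real.log (Real.log k) := by
    have h4 : Real.log (Real.log ((k + 1 : ℕ) : ℝ)) ≤ Real.log (2 * Real.log k) :=
      Real.log_le_log (Real.log_pos (by push_cast; linarith)) h2
    rw [Real.log_mul (by norm_num) h1.ne'] at h4
    linarith [Real.log_two_lt_d9]
  rw [Real.norm_of_nonneg (by positivity), Real.norm_of_nonneg (by positivity), ← mul_div_assoc]
  gcongr
  linarith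

end TSWLAD

theorem corollary1 {Ω : Type*} [mΩ : MeasurableSpace Ω] (P : Measure Ω) [IsProbabilityMeasure P]
    (ℱ : Filtration ℕ mΩ) (d : ℕ) (hd : 1 ≤ d) (S : TSWLAD.Setup Ω d) (M Cmax : ℝ)
    (hReg : S.RegressorAssumption P ℱ) (hThr : S.ThresholdAssumption P ℱ M)
    (hNoise : S.NoiseAssumption P ℱ M Cmax) (hAlg : S.Admissible P ℱ)
    (hExc : ∀ᵐ ω ∂P, (fun k : ℕ => (k : ℝ)) =O[atTop]
      fun k : ℕ => TSWLAD.lambdaMin (S.info k ω)) :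
    ∀ᵐ ω ∂P, (fun k : ℕ => TSWLAD.euclNorm (S.θ - S.estimate (k + 1) ω) ^ 2) =O[atTop]
      fun k : ℕ => Real.log (Real.log k) / k := by
  filter_upwards [TSWLAD.Setup.ae_isBigO_estimate hReg hThr hNoise hAlg hExc] with ω h
  exact (h.comp_tendsto (tendsto_add_atTop_nat 1)).trans TSWLAD.isBigO_log_log_succ
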